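/- **Setting.** For $x\in\mathbb R^3$ let $r=(x_1^2+x_2^2)^{1/2}$, $e_r=(x_1/r,x_2/r,0)$, $e_\theta=(x_2/r,-x_1/r,0)$, $e_z=(0,0,1)$. A vector field $w$ is axisymmetric without swirl if $w=w_re_r+w_ze_z$ with $w_r,w_z$ depending only on $(r,x_3)$; $w^\theta=w\cdot e_\theta$. Fix $\alpha>0$ and put $$f_\alpha(\rho)=\frac1{\alpha^2}f\Big(\frac{\rho}{\alpha}\Big),\qquad f(z)=\frac{(1+z)e^{-z}-1}{4\pi z^2},\qquad (K_\alpha*q)(x)=\int_{\mathbb R^3} f_\alpha(|x-y|)\,\frac{x-y}{|x-y|}\times q(y)\,dy ,$$ the integral kernel of the inverse of $(1-\alpha^2\Delta)\operatorname{curl}$. Let $\mathcal G$ be the group of homeomorphisms of $\mathbb R^3$ preserving Lebesgue measure, with uniform convergence of maps and inverses, and let $\mathrm{Lip}$ be the space of bounded Lipschitz fields with norm $\sup|w|+\mathrm{Lip}(w)$. **Definition.** Let $T>0$ and $p\ge1$, let $u_0$ be an initial velocity and $q_0=\operatorname{curl}v_0$, $v_0=(1-\alpha^2\Delta)u_0$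 (in the sense of distributions). A pair $(u,q)$ is a weak solution on $[0,T]$, with $q$ of class $L^p$, of the axisymmetric, swirl-free Euler-$\alpha$ vorticity system $$\partial_t q+u\cdot\nabla q=q\cdot\nabla u,\qquad u=K_\alpha*q,\qquad q|_{t=0}=q_0$$ if $u\in C([0,T];\mathrm{Lip})$ and, for every $t\in[0,T]$: $u(t)$ is axisymmetric without swirl; $q(t)\in L^p(\mathbb R^3)$; $q(t)=\operatorname{curl}v(t)$ with $v=(1-\alpha^2\Delta)u$ in the sense of distributions; $q(t)=q^\theta(t)e_\theta$ almost everywhere; $u(t)=K_\alpha*q(t)$ with an absolutely convergent integral at every point; and moreover $u(0)=u_0$, $q(0)=q_0$ a.e.; there is exactly one $y\in C([0,T];\mathcal G)$ with $$y(t,x)=x+\int_0^tu(s,y(s,x))\,ds\qquad(0\le t\le T,\ x\in\mathbb R^3);$$ and the vorticity equation, which for such flows is the transport equation for $q^\theta/r$, holds in the sense that $q^\theta/r$ is locally integrable on $[0,T]\times\mathbb R^3$ and $$\int_0^T\!\!\int_{\mathbb R^3}(\partial_t\varphi+u\cdot\nabla\varphi)\,\frac{q^\theta}{r}\,dx\,dt=0\qquad\text{for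 all }\varphi\in C_c^\infty((0,T)\times\mathbb R^3).$$ **Theorem 2.1.** Let $\frac32<p\le\infty$. Let $u_0$ be a continuous vector field on $\mathbb R^3$ that tends to $0$ at infinity, is divergence free and axisymmetric without swirl, and for which $q_0=\operatorname{curl}v_0$, $v_0=(1-\alpha^2\Delta)u_0$, is a function with compact support and $q_0/r\in L^p(\mathbb R^3)$. Then for every $T>0$ there is a weak solution $(u,q)$ on $[0,T]$ with $q$ of class $L^p$. It is unique: any weak solution $(u',q')$ on $[0,T]$ with the same data, with $q'$ of class $L^s$ for some $s\in[1,\infty]$, satisfies $u'(t)=u(t)$ and $q'(t)=q(t)$ a.e. for every $t\in[0,T]$. Moreover, along its Lagrangian trajectory $y$, for every $t\in[0,T]$, $$\frac{q^\theta}{r}(t,y(t,x))=\frac{q_0^\theta}{r}(x)\qquad\text{for a.e. }x .$$ -/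

import Mathlib

open MeasureTheory Set Filter Topology
open scoped ContDiff NNReal ENNReal RealInnerProductSpace

noncomputable section

namespace EulerAlpha

/-- Physical space, with the Euclidean norm and Lebesgue measure. -/
abbrev R3 := EuclideanSpace ℝ (Fin 3)

/-! ### Vector calculus -/

/-- The cross product `a × b`. -/
def cross (a b : R3) : R3 :=
  !₂[a 1 * b 2 - a 2 * b 1, a 2 * b 0 - a 0 * b 2, a 0 * b 1 - a 1 * b 0]

/-- The partial derivative `∂_i w_j` at `x` of a vector field. -/
def partialDeriv (i j : Fin 3) (w : R3 → R3) (x : R3) : ℝ :=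
  (fderiv ℝ w x (EuclideanSpace.single i 1)) j

/-- The classical curl of a (smooth) vector field. -/
def curl (w : R3 → R3) (x : R3) : R3 :=
  !₂[partialDeriv 1 2 w x - partialDeriv 2 1 w x,
     partialDeriv 2 0 w x - partialDeriv 0 2 w x,
     partialDeriv 0 1 w x - partialDeriv 1 0 w x]

/-- `div w = 0` in the sense of distributions. -/
def IsWeaklyDivFree (w : R3 → R3) : Prop :=
  ∀ φ : R3 → ℝ, ContDiff ℝ ∞ φ → HasCompactSupport φ → ∫ x, fderiv ℝ φ x (w x) = 0

/-- `q = curl v` in the sense of distributions, where `v = (1 - α² Δ) u` is the unfiltered velocity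
belonging to `u`: all derivatives are moved to the test field. -/
def IsUnfilteredVorticity (α : ℝ) (u q : R3 → R3) : Prop :=
  ∀ φ : R3 → R3, ContDiff ℝ ∞ φ → HasCompactSupport φ →
    ∫ x, ⟪u x, curl φ x - α ^ 2 • Laplacian.laplacian (curl φ) x⟫ = ∫ x, ⟪q x, φ x⟫

/-! ### Cylindrical coordinates -/

/-- The distance to the axis of symmetry. -/
def cylRadius (x : R3) : ℝ := Real.sqrt (x 0 ^ 2 + x 1 ^ 2)

/-- `e_r` (zero on the axis, by convention). -/
def eR (x : R3) : R3 := !₂[x 0 / cylRadius x, x 1 / cylRadius x, 0]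

/-- `e_θ = (x₂ / r, - x₁ / r, 0)` (zero on the axis, by convention). -/
def eTheta (x : R3) : R3 := !₂[x 1 / cylRadius x, -x 0 / cylRadius x, 0]

/-- `e_z`. -/
def eZ : R3 := !₂[0, 0, 1]

/-- Axisymmetric without swirl: `w = w_r e_r + w_z e_z` with `w_r`, `w_z` functions of `(r, z)`. -/
def IsAxisymmetricNoSwirl (w : R3 → R3) : Prop :=
  ∃ a b : ℝ → ℝ → ℝ, ∀ x, w x = a (cylRadius x) (x 2) • eR x + b (cylRadius x) (x 2) • eZ

/-- The azimuthal component `w^θ` of a vector field. -/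
def azimuthal (w : R3 → R3) (x : R3) : ℝ := ⟪w x, eTheta x⟫

/-- The scalar `w^θ / r`. -/
def potVorticity (w : R3 → R3) (x : R3) : ℝ := azimuthal w x / cylRadius x

/-! ### The kernel -/

/-- The profile `f(z) = ((1 + z) e^{-z} - 1) / (4 π z²)`. -/
def profile (z : ℝ) : ℝ := ((1 + z) * Real.exp (-z) - 1) / (4 * Real.pi * z ^ 2)

/-- `f_α(ρ) = α⁻² f(ρ / α)`, the radial derivative of `G_α(ρ) = (1 - e^{-ρ/α}) / (4 π ρ)`. -/
def profileAlpha (α ρ : ℝ) : ℝ := (1 / α ^ 2) * profile (ρ / α)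

/-- `∇ G_α (z) = f_α(|z|) z / |z|`. -/
def gradGreen (α : ℝ) (z : R3) : R3 := (profileAlpha α ‖z‖ / ‖z‖) • z

/-- `w = K_α * q`, i.e. `w(x) = ∫ f_α(|x-y|) (x-y)/|x-y| × q(y) dy`, the integral being absolutely
convergent for every `x`. -/
def IsKernelConvolution (α : ℝ) (q w : R3 → R3) : Prop :=
  ∀ x, Integrable (fun y => cross (gradGreen α (x - y)) (q y)) ∧
    w x = ∫ y, cross (gradGreen α (x - y)) (q y)

/-! ### Solutions -/

/-- `u ∈ C([0, T]; Lip(ℝ³))`, where `Lip(ℝ³)` is the space of bounded Lipschitz fields with the norm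
`sup |w| + Lip(w)`. -/
structure IsContinuousLipCurve (T : ℝ) (u : ℝ → R3 → R3) : Prop where
  mem_lip : ∀ t ∈ Icc 0 T, ∃ C : ℝ≥0, (∀ x, ‖u t x‖ ≤ C) ∧ LipschitzWith C (u t)
  continuous : ∀ t₀ ∈ Icc 0 T, ∀ ε : ℝ≥0, 0 < ε → ∃ δ : ℝ, 0 < δ ∧ ∀ t ∈ Icc 0 T, |t - t₀| < δ →
    (∀ x, ‖u t x - u t₀ x‖ ≤ ε) ∧ LipschitzWith ε (fun x => u t x - u t₀ x)

/-- `y` is a Lagrangian flow of `u`, lying in `C([0, T]; 𝒢)`, where `𝒢` is the group of homeomorphisms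
of `ℝ³` that preserve Lebesgue measure, with uniform convergence of the maps and their inverses. -/
structure IsLagrangianFlow (T : ℝ) (u : ℝ → R3 → R3) (y : ℝ → R3 ≃ₜ R3) : Prop where
  measurePreserving : ∀ t ∈ Icc 0 T, MeasurePreserving (y t) volume volume
  continuous : ∀ t₀ ∈ Icc 0 T, ∀ ε : ℝ, 0 < ε → ∃ δ : ℝ, 0 < δ ∧ ∀ t ∈ Icc 0 T, |t - t₀| < δ →
    ∀ x, ‖y t x - y t₀ x‖ ≤ ε ∧ ‖(y t).symm x - (y t₀).symm x‖ ≤ ε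
  trajectory : ∀ t ∈ Icc 0 T, ∀ x, y t x = x + ∫ s in (0 : ℝ)..t, u s (y s x)

/-- `∂_t h + u · ∇ h = 0` on `(0, T) × ℝ³` in the weak sense: `∬ (∂_t φ + u · ∇φ) h dx dt = 0` for all
`φ ∈ C_c^∞((0, T) × ℝ³)`. -/
def IsWeaklyTransported (T : ℝ) (u : ℝ → R3 → R3) (h : ℝ → R3 → ℝ) : Prop :=
  ∀ φ : ℝ × R3 → ℝ, ContDiff ℝ ∞ φ → HasCompactSupport φ → tsupport φ ⊆ Ioo 0 T ×ˢ univ →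
    ∫ z in Ioo 0 T ×ˢ univ, fderiv ℝ φ z (1, u z.1 z.2) * h z.1 z.2 = 0

/-- `(u, q)` is a weak solution on `[0, T]`, with `q` of class `L^p`, of the Euler-α vorticity system
for axisymmetric flows without swirl, with initial velocity `u₀` and initial unfiltered
vorticity `q₀`. -/
structure IsWeakSolution (α T : ℝ) (p : ℝ≥0∞) (u₀ q₀ : R3 → R3) (u q : ℝ → R3 → R3) : Prop where
  lip : IsContinuousLipCurve T u
  axisymmetric : ∀ t ∈ Icc 0 T, IsAxisymmetricNoSwirl (u t)
  memLp : ∀ t ∈ Icc 0 T, MemLp (q t) p volume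
  /-- `q = curl v` with `v = (1 - α² Δ) u`. -/
  vorticity : ∀ t ∈ Icc 0 T, IsUnfilteredVorticity α (u t) (q t)
  /-- `q = q^θ e_θ`. -/
  azimuthal_only : ∀ t ∈ Icc 0 T, ∀ᵐ x, q t x = azimuthal (q t) x • eTheta x
  /-- There is exactly one Lagrangian trajectory. -/
  flow : ∃ y : ℝ → R3 ≃ₜ R3, IsLagrangianFlow T u y ∧
    ∀ y' : ℝ → R3 ≃ₜ R3, IsLagrangianFlow T u y' → ∀ t ∈ Icc 0 T, y' t = y t
  /-- `u = K_α * q`. -/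
  recovery : ∀ t ∈ Icc 0 T, IsKernelConvolution α (q t) (u t)
  initial_velocity : u 0 = u₀
  initial_vorticity : q 0 =ᵐ[volume] q₀
  /-- `q^θ / r` is locally integrable on `[0, T] × ℝ³` and is a weak solution of the transport
  equation. -/
  locallyIntegrable : LocallyIntegrableOn (fun z : ℝ × R3 => potVorticity (q z.1) z.2)
    (Icc 0 T ×ˢ univ)
  transport : IsWeaklyTransported T u (fun t => potVorticity (q t))

end EulerAlpha

end

open MeasureTheory Set Filter Topology
open scoped ContDiff NNReal ENNReal RealInnerProductSpace

noncomputable section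

namespace EulerAlpha

/-! ### Algebra of the cross product and of the angular field -/

/-! Write `ζ = q₀^θ / r`. Without swirl, the quotient `q^θ / r` is carried by the flow `Y`, which
preserves volume, so `q(t, x) = ζ(Y_t⁻¹ x) • angular x`, where `angular` is the linear field `r
e_θ`. Substituting `y = Y_t z` in the recovery law gives `u(t, x) = ∫ ζ(z) ∇G_α(x - Y_t z) × angular
(Y_t z) dz`, which is `velocity α ζ (Y t) x`. The system becomes an ordinary differential equation
for the particle map, and the theorem is Picard's theorem for that equation.

The Lipschitz estimate is `norm_velocity_sub_le`. The kernel `gradGreen` is bounded, and its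
increment from `a` to `b` is at most `C (1 + 2 / |a|) |a - b|`. So `velocity` is Lipschitz in the
evaluation point and in the map together as soon as `∫ |ζ(z)| / |x - m(z)| dz` is bounded uniformly
in `x` and in the volume preserving map `m`. By Young's inequality the integrand is at most `|ζ| +
|ζ|^p` plus `|x - m(z)|^{-p'}` cut off to the unit ball. The integral of the last term depends on
neither `x` nor `m`, and it is finite because `p' < 3`, that is `p > 3/2`.

`exists_lagrangian` iterates the map sending a curve of maps to the flow of its velocity. The
iterates obey a common exponential bound, and they preserve volume by Liouville's theorem
(`IsFlow.measurePreserving`), since `K_α * q` is divergence free. Successive differences halve in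
the norm weighted by `exp (4 K t)`; the same mechanism proves `lagrangian_unique`.

Axisymmetry without swirl means commuting with the reflections in the planes containing the axis
(`isAxisymmetricNoSwirl_iff`). The mirror image of a Lagrangian solution is again one with the same
profile, so by uniqueness `Y` commutes with these reflections. The symmetry also enters the
vorticity: testing `K_α * q` against `(1 - α² Δ) curl φ` returns `q` against `φ` minus a gradient,
and an axisymmetric swirl field is orthogonal to gradients (`isUnfilteredVorticity_kernelConv`).

For the data, reflection symmetry forces `q₀` to be azimuthal. Moreover `u₀ = K_α * q₀`, because the
difference decays, is divergence free and is annihilated by `Δ (1 - α² Δ)`, so the maximum principle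
makes it vanish (`eq_zero_of_isUnfilteredVorticity_zero`).

Uniqueness among weak solutions rests on `IsFlow.ae_potVorticity_eq_comp_symm`. The functions `η(t)
φ(Y_t⁻¹ x)` are in general not smooth, but they are uniformly differentiable along `(1, u)`, so
after mollification they may be used as test functions; hence `∫ φ(Y_t⁻¹ x) (q^θ / r)(t, x) dx` is
constant for almost every `t`. The relation between `u` and `q` supplies weak continuity in time off
the axis, which gives the transport formula at every time. Every weak solution is therefore
Lagrangian with profile `ζ`, and `lagrangian_unique` applies. -/

lemma r3_ext {a b : R3} (h0 : a 0 = b 0) (h1 : a 1 = b 1) (h2 : a 2 = b 2) : a = b := by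
  ext i; fin_cases i <;> assumption

lemma norm_sq_r3 (a : R3) : ‖a‖ ^ 2 = a 0 ^ 2 + a 1 ^ 2 + a 2 ^ 2 := by
  rw [EuclideanSpace.norm_sq_eq]; simp [Fin.sum_univ_three]

lemma inner_r3 (a b : R3) : ⟪a, b⟫ = a 0 * b 0 + a 1 * b 1 + a 2 * b 2 := by
  rw [PiLp.inner_apply]; simp [Fin.sum_univ_three]; ring

lemma abs_apply_le_norm (a : R3) (i : Fin 3) : |a i| ≤ ‖a‖ := by
  simpa using PiLp.norm_apply_le a i

@[simp] lemma cross_zero_apply (a b : R3) : cross a b 0 = a 1 * b 2 - a 2 * b 1 := by simp [cross]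
@[simp] lemma cross_one_apply (a b : R3) : cross a b 1 = a 2 * b 0 - a 0 * b 2 := by simp [cross]
@[simp] lemma cross_two_apply (a b : R3) : cross a b 2 = a 0 * b 1 - a 1 * b 0 := by simp [cross]

/-- Lagrange's identity `|a × b|² + ⟪a, b⟫² = |a|² |b|²`. -/
lemma norm_cross_le (a b : R3) : ‖cross a b‖ ≤ ‖a‖ * ‖b‖ := by
  refine le_of_sq_le_sq ?_ (by positivity)
  rw [mul_pow, norm_sq_r3, norm_sq_r3, norm_sq_r3]
  simp only [cross_zero_apply, cross_one_apply, cross_two_apply]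
  nlinarith [sq_nonneg (a 0 * b 0 + a 1 * b 1 + a 2 * b 2)]

/-- The cross product as a continuous bilinear map. -/
def crossL : R3 →L[ℝ] R3 →L[ℝ] R3 :=
  LinearMap.mkContinuous₂
    (LinearMap.mk₂ ℝ cross
      (fun a a' b => by apply r3_ext <;> simp <;> ring)
      (fun c a b => by apply r3_ext <;> simp <;> ring)
      (fun a b b' => by apply r3_ext <;> simp <;> ring)
      (fun c a b => by apply r3_ext <;> simp <;> ring)) 1
    (fun a b => by simpa using norm_cross_le a b)

@[simp] lemma crossL_apply (a b : R3) : crossL a b = cross a b := rfl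

lemma cross_smul_right (c : ℝ) (a b : R3) : cross a (c • b) = c • cross a b := by
  simp [← crossL_apply]

lemma cross_sub_left (a a' b : R3) : cross (a - a') b = cross a b - cross a' b := by
  simp [← crossL_apply]

lemma cross_sub_right (a b b' : R3) : cross a (b - b') = cross a b - cross a b' := by
  simp [← crossL_apply]

/-- The field `r e_θ`, which is linear. -/
def angular : R3 →L[ℝ] R3 :=
  LinearMap.toContinuousLinearMap
    { toFun := fun x => !₂[x 1, -x 0, 0]
      map_add' := fun a b => by apply r3_ext <;> simp; ring
      map_smul' := fun c a => by apply r3_ext <;> simp }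

@[simp] lemma angular_zero_apply (x : R3) : angular x 0 = x 1 := by simp [angular]
@[simp] lemma angular_one_apply (x : R3) : angular x 1 = -x 0 := by simp [angular]
@[simp] lemma angular_two_apply (x : R3) : angular x 2 = 0 := by simp [angular]

lemma cylRadius_sq (x : R3) : cylRadius x ^ 2 = x 0 ^ 2 + x 1 ^ 2 :=
  Real.sq_sqrt (by positivity)

lemma cylRadius_nonneg (x : R3) : 0 ≤ cylRadius x := Real.sqrt_nonneg _

lemma continuous_cylRadius : Continuous cylRadius := by unfold cylRadius; fun_prop

lemma norm_angular (x : R3) : ‖angular x‖ = cylRadius x := by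
  have : ‖angular x‖ ^ 2 = cylRadius x ^ 2 := by
    rw [norm_sq_r3, cylRadius_sq]; simp; ring
  exact (sq_eq_sq₀ (norm_nonneg _) (cylRadius_nonneg x)).1 this

lemma cylRadius_le_norm (x : R3) : cylRadius x ≤ ‖x‖ := by
  refine le_of_sq_le_sq ?_ (norm_nonneg _)
  rw [cylRadius_sq, norm_sq_r3]; nlinarith [sq_nonneg (x 2)]

lemma norm_angular_le (x : R3) : ‖angular x‖ ≤ ‖x‖ := norm_angular x ▸ cylRadius_le_norm x

lemma eTheta_eq (x : R3) : eTheta x = (cylRadius x)⁻¹ • angular x := by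
  apply r3_ext <;> simp [eTheta, div_eq_inv_mul]

/-- The axis of symmetry is a null set. -/
lemma ae_cylRadius_ne_zero : ∀ᵐ x : R3, cylRadius x ≠ 0 := by
  -- The axis lies in the plane `x₀ = 0`, a proper subspace.
  have hs : volume ((LinearMap.ker (EuclideanSpace.proj (𝕜 := ℝ) (0 : Fin 3) :
      R3 →L[ℝ] ℝ).toLinearMap : Submodule ℝ R3) : Set R3) = 0 := by
    apply Measure.addHaar_submodule
    intro h
    have : (EuclideanSpace.single (0 : Fin 3) (1 : ℝ) : R3) ∈
        (LinearMap.ker (EuclideanSpace.proj (𝕜 := ℝ) (0 : Fin 3) :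
      R3 →L[ℝ] ℝ).toLinearMap : Submodule ℝ R3) := by rw [h]; trivial
    simp at this
  refine measure_mono_null (fun x hx => ?_) hs
  simp only [mem_compl_iff, mem_ofPred_eq, not_not] at hx
  have h2 := cylRadius_sq x
  rw [hx] at h2
  have : x 0 = 0 := by nlinarith [sq_nonneg (x 0), sq_nonneg (x 1)]
  simpa using this

/-! ### The kernel -/

/-- Removes the apparent singularity at `0`: the sup bound and the Lipschitz bound can both be read
off the integrand. Positivity of `z` matters, since division by zero gives `profile 0 = 0` while the
integral gives the limit `-1 / (8 π)`. -/
lemma profile_eq_integral {z : ℝ} (hz : 0 < z) :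
    profile z = -(1 / (4 * Real.pi)) * ∫ s in (0 : ℝ)..1, s * Real.exp (-(s * z)) := by
  have key : ∫ s in (0 : ℝ)..1, s * Real.exp (-(s * z)) =
      -(1 * z + 1) * Real.exp (-(1 * z)) / z ^ 2 - -(0 * z + 1) * Real.exp (-(0 * z)) / z ^ 2 := by
    refine intervalIntegral.integral_eq_sub_of_hasDerivAt
      (f := fun s => -(s * z + 1) * Real.exp (-(s * z)) / z ^ 2) ?_ ?_
    · intro s _
      have h1 : HasDerivAt (fun s : ℝ => -(s * z + 1)) (-z) s := by
        simpa only [id, one_mul] using (((hasDerivAt_id s).mul_const z).add_const (1 : ℝ)).fun_neg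
      have h2 : HasDerivAt (fun s : ℝ => Real.exp (-(s * z))) (Real.exp (-(s * z)) * -z) s := by
        simpa only [id, one_mul] using (((hasDerivAt_id s).mul_const z).fun_neg).exp
      refine ((h1.fun_mul h2).div_const (z ^ 2)).congr_deriv ?_
      field_simp; ring
    · apply Continuous.intervalIntegrable; fun_prop
  rw [key, profile]
  have := Real.pi_pos
  simp only [zero_mul, neg_zero, Real.exp_zero, one_mul]
  field_simp; ring

lemma abs_profile_le {z : ℝ} (hz : 0 ≤ z) : |profile z| ≤ 1 := by
  rcases hz.eq_or_lt with rfl | hz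
  · simp [profile]
  rw [profile_eq_integral hz, abs_mul]
  have h1 : |(-(1 / (4 * Real.pi)))| ≤ 1 := by
    rw [abs_neg, abs_of_pos (by positivity), div_le_one (by positivity)]
    nlinarith [Real.pi_gt_three]
  have h2 : ‖∫ s in (0 : ℝ)..1, s * Real.exp (-(s * z))‖ ≤ 1 * |1 - 0| := by
    apply intervalIntegral.norm_integral_le_of_norm_le_const
    intro s hs
    rw [uIoc_of_le zero_le_one] at hs
    rw [norm_mul, Real.norm_eq_abs, Real.norm_eq_abs, abs_of_pos hs.1, Real.abs_exp]
    have : Real.exp (-(s * z)) ≤ 1 := by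
      rw [Real.exp_le_one_iff]; nlinarith [hs.1]
    nlinarith [hs.1, hs.2, Real.exp_pos (-(s * z))]
  rw [sub_zero, abs_one, mul_one, Real.norm_eq_abs] at h2
  calc _ ≤ (1 : ℝ) * 1 := mul_le_mul h1 h2 (abs_nonneg _) zero_le_one
    _ = 1 := by ring

/-- Under the integral, `exp (-·)` is 1-Lipschitz on the half-line and the weights `s` are at most
`1`. The endpoint `0` is excluded because of the junk value of the profile there. -/
lemma abs_profile_sub_le {a b : ℝ} (ha : 0 < a) (hb : 0 < b) :
    |profile a - profile b| ≤ |a - b| := by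
  rw [profile_eq_integral ha, profile_eq_integral hb, ← mul_sub,
    ← intervalIntegral.integral_sub (by apply Continuous.intervalIntegrable; fun_prop)
      (by apply Continuous.intervalIntegrable; fun_prop), abs_mul]
  have h1 : |(-(1 / (4 * Real.pi)))| ≤ 1 := by
    rw [abs_neg, abs_of_pos (by positivity), div_le_one (by positivity)]
    nlinarith [Real.pi_gt_three]
  have hexp : ∀ x y : ℝ, 0 ≤ x → 0 ≤ y → |Real.exp (-x) - Real.exp (-y)| ≤ |x - y| := by
    have aux : ∀ x y : ℝ, 0 ≤ x → x ≤ y → |Real.exp (-x) - Real.exp (-y)| ≤ |x - y| := by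
      intro x y hx hxy
      have e1 : Real.exp (-x) ≤ 1 := by rw [Real.exp_le_one_iff]; linarith
      have e2 : Real.exp (-y) = Real.exp (-x) * Real.exp (x - y) := by
        rw [← Real.exp_add]; congr 1; ring
      have e3 := Real.add_one_le_exp (x - y)
      have e4 : Real.exp (-y) ≤ Real.exp (-x) := Real.exp_le_exp.2 (by linarith)
      rw [abs_of_nonneg (by linarith), abs_of_nonpos (by linarith), e2]
      nlinarith [Real.exp_pos (-x)]
    intro x y hx hy
    rcases le_total x y with h | h
    · exact aux x y hx h
    · rw [abs_sub_comm, abs_sub_comm x]; exact aux y x hy h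
  have h2 : ‖∫ s in (0 : ℝ)..1, (s * Real.exp (-(s * a)) - s * Real.exp (-(s * b)))‖ ≤
      |a - b| * |1 - 0| := by
    apply intervalIntegral.norm_integral_le_of_norm_le_const
    intro s hs
    rw [uIoc_of_le zero_le_one] at hs
    rw [← mul_sub, norm_mul, Real.norm_eq_abs, Real.norm_eq_abs, abs_of_pos hs.1]
    have h3 := hexp (s * a) (s * b) (mul_pos hs.1 ha).le (mul_pos hs.1 hb).le
    rw [← mul_sub, abs_mul, abs_of_pos hs.1] at h3
    have h4 : s * |a - b| ≤ |a - b| := by nlinarith [hs.2, abs_nonneg (a - b)]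
    nlinarith [hs.1, hs.2, abs_nonneg (a - b)]
  rw [sub_zero, abs_one, mul_one, Real.norm_eq_abs] at h2
  calc _ ≤ 1 * |a - b| := mul_le_mul h1 h2 (abs_nonneg _) zero_le_one
    _ = _ := by ring

lemma measurable_profileAlpha (α : ℝ) : Measurable (profileAlpha α) := by
  unfold profileAlpha profile; fun_prop

lemma measurable_gradGreen (α : ℝ) : Measurable (gradGreen α) := by
  unfold gradGreen
  exact (((measurable_profileAlpha α).comp measurable_norm).div measurable_norm).smul measurable_id

/-- A Lipschitz and sup bound for the kernel profile. -/
def kernelBound (α : ℝ) : ℝ := 1 / α ^ 2 + 1 / α ^ 2 * (1 / α)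

variable {α : ℝ}

lemma kernelBound_pos (hα : 0 < α) : 0 < kernelBound α := by unfold kernelBound; positivity

lemma abs_profileAlpha_le (hα : 0 < α) {ρ : ℝ} (hρ : 0 ≤ ρ) :
    |profileAlpha α ρ| ≤ kernelBound α := by
  unfold profileAlpha kernelBound
  rw [abs_mul, abs_of_pos (by positivity)]
  have := abs_profile_le (z := ρ / α) (by positivity)
  have h2 : 0 < 1 / α ^ 2 := by positivity
  have h3 : 0 < 1 / α ^ 2 * (1 / α) := by positivity
  nlinarith

lemma abs_profileAlpha_sub_le (hα : 0 < α) {a b : ℝ} (ha : 0 < a) (hb : 0 < b) :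
    |profileAlpha α a - profileAlpha α b| ≤ kernelBound α * |a - b| := by
  unfold profileAlpha kernelBound
  rw [← mul_sub, abs_mul, abs_of_pos (by positivity)]
  have h := abs_profile_sub_le (div_pos ha hα) (div_pos hb hα)
  rw [← sub_div, abs_div, abs_of_pos hα] at h
  have h2 : 0 < 1 / α ^ 2 := by positivity
  calc 1 / α ^ 2 * |profile (a / α) - profile (b / α)| ≤ 1 / α ^ 2 * (|a - b| / α) := by gcongr
    _ = (1 / α ^ 2 * (1 / α)) * |a - b| := by ring
    _ ≤ _ := by gcongr; linarith

lemma gradGreen_zero (α : ℝ) : gradGreen α 0 = 0 := by simp [gradGreen]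

lemma norm_gradGreen_le (hα : 0 < α) (z : R3) : ‖gradGreen α z‖ ≤ kernelBound α := by
  rcases eq_or_ne z 0 with rfl | hz
  · rw [gradGreen_zero, norm_zero]; exact (kernelBound_pos hα).le
  have hz' := norm_pos_iff.2 hz
  rw [gradGreen, norm_smul, norm_div, norm_norm, div_mul_cancel₀ _ hz'.ne']
  exact abs_profileAlpha_le hα (norm_nonneg _)

/-- The radial factor is bounded and Lipschitz; all the singularity sits in the direction `z / |z|`,
whose increments from `a` are at most `2 |a - b| / |a|`. The bound involves only `|a|`, so `b` may
be arbitrary. This asymmetry later allows a singular integral along just one of two maps. -/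
lemma norm_gradGreen_sub_le (hα : 0 < α) {a : R3} (ha : a ≠ 0) (b : R3) :
    ‖gradGreen α a - gradGreen α b‖ ≤ kernelBound α * (1 + 2 * ‖a‖⁻¹) * ‖a - b‖ := by
  have hC := kernelBound_pos hα
  have ha' := norm_pos_iff.2 ha
  -- At `b = 0` the kernel has the value `0` and jumps; the term `2 ‖a‖⁻¹ * ‖a - b‖ = 2` absorbs the
  -- jump.
  rcases eq_or_ne b 0 with rfl | hb
  · rw [gradGreen_zero, sub_zero, sub_zero]
    have e : kernelBound α * (1 + 2 * ‖a‖⁻¹) * ‖a‖ = kernelBound α * (‖a‖ + 2) := by field_simp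
    rw [e]
    nlinarith [norm_gradGreen_le hα a]
  have hb' := norm_pos_iff.2 hb
  have e : gradGreen α a - gradGreen α b =
      (profileAlpha α ‖a‖ - profileAlpha α ‖b‖) • (‖a‖⁻¹ • a)
        + profileAlpha α ‖b‖ • (‖a‖⁻¹ • a - ‖b‖⁻¹ • b) := by
    simp only [gradGreen, div_eq_mul_inv]; module
  have h1 : ‖‖a‖⁻¹ • a‖ = 1 := by rw [norm_smul, norm_inv, norm_norm, inv_mul_cancel₀ ha'.ne']
  have h2 : ‖‖a‖⁻¹ • a - ‖b‖⁻¹ • b‖ ≤ 2 * ‖a‖⁻¹ * ‖a - b‖ := by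
    have e2 : ‖a‖⁻¹ • a - ‖b‖⁻¹ • b = ‖a‖⁻¹ • ((a - b) + (‖b‖ - ‖a‖) • (‖b‖⁻¹ • b)) := by
      rw [smul_add, smul_smul, smul_smul]
      have : ‖a‖⁻¹ * (‖b‖ - ‖a‖) * ‖b‖⁻¹ = ‖a‖⁻¹ - ‖b‖⁻¹ := by field_simp
      rw [this]; module
    have h3 : ‖‖b‖⁻¹ • b‖ = 1 := by rw [norm_smul, norm_inv, norm_norm, inv_mul_cancel₀ hb'.ne']
    rw [e2, norm_smul, norm_inv, norm_norm, mul_comm 2, mul_assoc]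
    gcongr
    refine (norm_add_le _ _).trans ?_
    rw [norm_smul, h3, mul_one, Real.norm_eq_abs, abs_sub_comm]
    linarith [abs_norm_sub_norm_le a b]
  rw [e]
  refine (norm_add_le _ _).trans ?_
  rw [norm_smul _ (‖a‖⁻¹ • a), h1, mul_one, norm_smul, Real.norm_eq_abs, Real.norm_eq_abs]
  have h4 := abs_profileAlpha_sub_le hα ha' hb'
  have h5 := abs_norm_sub_norm_le a b
  have h6 := abs_profileAlpha_le hα (norm_nonneg b)
  calc _ ≤ kernelBound α * ‖a - b‖ + kernelBound α * (2 * ‖a‖⁻¹ * ‖a - b‖) := by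
        gcongr
        exact h4.trans (by gcongr)
    _ = _ := by ring

/-- Since `0 ≤ (1 + w) e^{-w} ≤ 1`, the kernel is dominated by `|z|⁻²`. This yields the decay of
`K_α * q` that the maximum principle needs. -/
lemma tendsto_gradGreen_cocompact (hα : 0 < α) :
    Tendsto (gradGreen α) (cocompact R3) (𝓝 0) := by
  rw [tendsto_zero_iff_norm_tendsto_zero]
  have h : Tendsto (fun z : R3 => (‖z‖ ^ 2)⁻¹) (cocompact R3) (𝓝 0) :=
    ((tendsto_pow_atTop two_ne_zero).comp (tendsto_norm_cocompact_atTop (E := R3))).inv_tendsto_atTop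
  refine squeeze_zero (fun _ => norm_nonneg _) (fun z => ?_) h
  rcases eq_or_ne z 0 with rfl | hz
  · simp [gradGreen_zero]
  have hz' := norm_pos_iff.2 hz
  rw [gradGreen, norm_smul, norm_div, norm_norm, div_mul_cancel₀ _ hz'.ne', profileAlpha, profile]
  have hw : 0 < ‖z‖ / α := by positivity
  set w := ‖z‖ / α with hwdef
  have hzw : ‖z‖ = α * w := by rw [hwdef]; field_simp
  have h1 : |(1 + w) * Real.exp (-w) - 1| ≤ 1 := by
    have e1 : (1 + w) * Real.exp (-w) ≤ 1 := by
      rw [Real.exp_neg, ← div_eq_mul_inv, div_le_one (Real.exp_pos _)]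
      linarith [Real.add_one_le_exp w]
    rw [abs_le]; constructor <;> nlinarith [Real.exp_pos (-w)]
  rw [norm_mul, norm_div _ (4 * Real.pi * w ^ 2), Real.norm_eq_abs, Real.norm_eq_abs,
    Real.norm_eq_abs, abs_of_pos (by positivity : 0 < 1 / α ^ 2),
    abs_of_pos (by positivity : 0 < 4 * Real.pi * w ^ 2), hzw]
  have h2 : 1 ≤ 4 * Real.pi := by nlinarith [Real.pi_gt_three]
  calc _ ≤ 1 / α ^ 2 * (1 / (1 * w ^ 2)) := by gcongr
    _ = _ := by field_simp

/-! ### Potential estimates -/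

lemma _root_.MeasureTheory.MeasurePreserving.integral_comp_aestronglyMeasurable
    {X Y G : Type*} [MeasurableSpace X] [MeasurableSpace Y] [NormedAddCommGroup G]
    [NormedSpace ℝ G] {μ : Measure X} {ν : Measure Y} {m : X → Y} (hm : MeasurePreserving m μ ν)
    {g : Y → G} (hg : AEStronglyMeasurable g ν) : ∫ x, g (m x) ∂μ = ∫ y, g y ∂ν := by
  rw [← hm.map_eq] at hg ⊢
  exact (integral_map hm.aemeasurable hg).symm

lemma measurePreserving_const_sub {m : R3 → R3} (hm : MeasurePreserving m volume volume) (x : R3) :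
    MeasurePreserving (fun z => x - m z) volume volume :=
  (Measure.measurePreserving_sub_left volume x).comp hm

/-- The truncated singular potential `|w|^{-p'}`, `p' = p / (p - 1)`, on the unit ball. -/
def singularPart (p : ℝ) : R3 → ℝ := (Metric.ball 0 1).indicator fun w => ‖w‖ ^ (-(p / (p - 1)))

lemma singularPart_nonneg (p : ℝ) (w : R3) : 0 ≤ singularPart p w :=
  indicator_nonneg (fun _ _ => Real.rpow_nonneg (norm_nonneg _) _) _

/-- In polar coordinates the integrand is `ρ^(2 - p')`, integrable at `0` precisely when `p' < 3`.
This is the source of the threshold `p > 3/2`. -/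
lemma integrable_singularPart {p : ℝ} (hp : 3 / 2 < p) : Integrable (singularPart p) := by
  unfold singularPart
  rw [integrable_indicator_iff measurableSet_ball]
  refine (integrableOn_fun_norm_addHaar volume (f := fun y : ℝ => y ^ (-(p / (p - 1))))).2 ?_
  have hfin : Module.finrank ℝ R3 - 1 = 2 := by simp
  rw [hfin, ← integrableOn_Ioc_iff_integrableOn_Ioo]
  have hq : -1 < 2 - p / (p - 1) := by
    have : p / (p - 1) < 3 := by rw [div_lt_iff₀ (by linarith)]; linarith
    linarith
  have h := (intervalIntegral.intervalIntegrable_rpow' hq (a := 0) (b := 1)).1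
  refine h.congr_fun (fun y hy => ?_) measurableSet_Ioc
  have hy0 : 0 < y := hy.1
  change y ^ (2 - p / (p - 1)) = y ^ 2 • y ^ (-(p / (p - 1)))
  rw [smul_eq_mul, sub_eq_add_neg, Real.rpow_add hy0]; norm_cast

/-- Young's inequality inside the unit ball, `|w|⁻¹ ≤ 1` outside. A sum is preferred to a Hölder
product because the two resulting integrals then separate: one sees only `ζ`, the other only the
kernel. -/
lemma mul_inv_norm_le {p : ℝ} (hp : 3 / 2 < p) {c : ℝ} (hc : 0 ≤ c) (w : R3) :
    c * ‖w‖⁻¹ ≤ c + c ^ p + singularPart p w := by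
  have hcp : 0 ≤ c ^ p := Real.rpow_nonneg hc p
  by_cases hw : ‖w‖ < 1
  · have hwm : w ∈ Metric.ball (0 : R3) 1 := by simpa using hw
    rw [singularPart, indicator_of_mem hwm]
    have hconj : p.HolderConjugate (p / (p - 1)) :=
      Real.HolderConjugate.conjExponent (by linarith)
    have h := Real.young_inequality_of_nonneg hc (inv_nonneg.2 (norm_nonneg w)) hconj
    have h1 : c ^ p / p ≤ c ^ p := div_le_self hcp (by linarith)
    have hq : 1 ≤ p / (p - 1) := by rw [le_div_iff₀ (by linarith)]; linarith
    have h2 : ‖w‖⁻¹ ^ (p / (p - 1)) = ‖w‖ ^ (-(p / (p - 1))) := by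
      rw [Real.inv_rpow (norm_nonneg _), Real.rpow_neg (norm_nonneg _)]
    have h3 : ‖w‖⁻¹ ^ (p / (p - 1)) / (p / (p - 1)) ≤ ‖w‖ ^ (-(p / (p - 1))) := by
      rw [← h2]; exact div_le_self (Real.rpow_nonneg (inv_nonneg.2 (norm_nonneg _)) _) hq
    linarith
  · have h1 : ‖w‖⁻¹ ≤ 1 := inv_le_one_of_one_le₀ (not_lt.1 hw)
    have := singularPart_nonneg p w
    nlinarith

/-- A bound for `∫ |ζ(z)| / |x - m(z)| dz`, uniform in `x` and in measure preserving maps `m`. -/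
def potentialBound (p : ℝ) (ζ : R3 → ℝ) : ℝ :=
  (∫ z, |ζ z|) + (∫ z, |ζ z| ^ p) + ∫ w, singularPart p w

/-- Only the `singularPart` term sees `m`, and `z ↦ x - m z` preserves Lebesgue measure, so its
integral is the same for all `x` and `m`. -/
lemma integrable_mul_inv_norm_sub {p : ℝ} (hp : 3 / 2 < p) {ζ : R3 → ℝ} (h1 : Integrable ζ)
    (h2 : Integrable fun z => |ζ z| ^ p) {m : R3 → R3} (hm : MeasurePreserving m volume volume)
    (x : R3) :
    Integrable (fun z => |ζ z| * ‖x - m z‖⁻¹) ∧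
      ∫ z, |ζ z| * ‖x - m z‖⁻¹ ≤ potentialBound p ζ := by
  have hs := integrable_singularPart hp
  have hm' := measurePreserving_const_sub hm x
  have hint : Integrable fun z => |ζ z| + |ζ z| ^ p + singularPart p (x - m z) :=
    (h1.abs.add h2).add (hm'.integrable_comp_of_integrable hs)
  have hi : Integrable (fun z => |ζ z| * ‖x - m z‖⁻¹) := by
    refine hint.mono' ?_ (ae_of_all _ fun z => ?_)
    · exact h1.abs.aestronglyMeasurable.mul
        (hm'.measurable.norm.inv).aestronglyMeasurable
    · rw [Real.norm_of_nonneg (by positivity)]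
      exact mul_inv_norm_le hp (abs_nonneg _) _
  refine ⟨hi, ?_⟩
  calc _ ≤ ∫ z, (|ζ z| + |ζ z| ^ p + singularPart p (x - m z)) :=
        integral_mono hi hint fun z => mul_inv_norm_le hp (abs_nonneg _) _
    _ = _ := by
        have h3 : Integrable fun z => |ζ z| + |ζ z| ^ p := h1.abs.add h2
        have h4 : Integrable fun z => singularPart p (x - m z) :=
          hm'.integrable_comp_of_integrable hs
        rw [integral_add h3 h4, integral_add h1.abs h2, potentialBound,
          hm'.integral_comp_aestronglyMeasurable hs.aestronglyMeasurable]

lemma potentialBound_nonneg (p : ℝ) (ζ : R3 → ℝ) : 0 ≤ potentialBound p ζ := by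
  have h1 : 0 ≤ ∫ z, |ζ z| := integral_nonneg fun z => abs_nonneg _
  have h2 : 0 ≤ ∫ z, |ζ z| ^ p := integral_nonneg fun z => Real.rpow_nonneg (abs_nonneg _) _
  have h3 : 0 ≤ ∫ w, singularPart p w := integral_nonneg fun z => singularPart_nonneg p z
  unfold potentialBound; positivity

/-! ### The velocity as a functional of the flow map -/

variable {α : ℝ}

/-- The velocity field `K_α * q` of the vorticity `q = ζ J x` transported by `m`. -/
def velocity (α : ℝ) (ζ : R3 → ℝ) (m : R3 → R3) (x : R3) : R3 :=
  ∫ z, ζ z • cross (gradGreen α (x - m z)) (angular (m z))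

lemma measurable_cross {X : Type*} [MeasurableSpace X] {f g : X → R3} (hf : Measurable f)
    (hg : Measurable g) : Measurable fun x => cross (f x) (g x) := by
  have h : Continuous fun z : R3 × R3 => cross z.1 z.2 := by
    have : (fun z : R3 × R3 => cross z.1 z.2) = fun z => crossL z.1 z.2 := rfl
    rw [this]; fun_prop
  exact h.measurable.comp (hf.prodMk hg)

lemma norm_velocity_integrand_le (hα : 0 < α) (ζ : R3 → ℝ) (m : R3 → R3) (x z : R3) :
    ‖ζ z • cross (gradGreen α (x - m z)) (angular (m z))‖ ≤
      kernelBound α * (|ζ z| * ‖m z‖) := by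
  rw [norm_smul, Real.norm_eq_abs]
  calc _ ≤ |ζ z| * (kernelBound α * ‖m z‖) := by
        gcongr
        refine (norm_cross_le _ _).trans ?_
        have := norm_gradGreen_le hα (x - m z)
        have := norm_angular_le (m z)
        have := (kernelBound_pos hα).le
        gcongr
    _ = _ := by ring

/-- `angular (m z)` grows linearly, which is why `m` is required to be bounded where `ζ ≠ 0`. -/
lemma integrable_velocity_integrand (hα : 0 < α) {ζ : R3 → ℝ} (hζ : Integrable ζ) {m : R3 → R3}
    (hm : Measurable m) {B : ℝ} (hB : ∀ᵐ z, ζ z ≠ 0 → ‖m z‖ ≤ B) (x : R3) :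
    Integrable fun z => ζ z • cross (gradGreen α (x - m z)) (angular (m z)) := by
  refine (hζ.abs.const_mul (kernelBound α * B)).mono' ?_ ?_
  · exact hζ.aestronglyMeasurable.smul (measurable_cross ((measurable_gradGreen α).comp
      (measurable_const.sub hm)) (angular.continuous.measurable.comp hm)).aestronglyMeasurable
  · filter_upwards [hB] with z hz
    refine (norm_velocity_integrand_le hα ζ m x z).trans ?_
    by_cases h : ζ z = 0
    · simp [h]
    · have := hz h
      have := kernelBound_pos hα
      have := abs_nonneg (ζ z)
      calc _ ≤ kernelBound α * (|ζ z| * B) := by gcongr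
        _ = _ := by ring

lemma norm_velocity_le (hα : 0 < α) {ζ : R3 → ℝ} (hζ : Integrable ζ) {m : R3 → R3}
    {B : ℝ} (hB : ∀ᵐ z, ζ z ≠ 0 → ‖m z‖ ≤ B) (x : R3) :
    ‖velocity α ζ m x‖ ≤ kernelBound α * (∫ z, |ζ z|) * B := by
  refine (norm_integral_le_of_norm_le (hζ.abs.const_mul (kernelBound α * B)) ?_).trans_eq ?_
  · filter_upwards [hB] with z hz
    refine (norm_velocity_integrand_le hα ζ m x z).trans ?_
    by_cases h : ζ z = 0
    · simp [h]
    · have := hz h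
      have := kernelBound_pos hα
      have := abs_nonneg (ζ z)
      calc _ ≤ kernelBound α * (|ζ z| * B) := by gcongr
        _ = _ := by ring
  · rw [integral_const_mul]; ring

/-- The Lipschitz constant of `velocity` in the evaluation point and in the map. -/
def velocityLip (α p : ℝ) (ζ : R3 → ℝ) (B : ℝ) : ℝ :=
  kernelBound α * (B * ((∫ z, |ζ z|) + 2 * potentialBound p ζ) + ∫ z, |ζ z|)

lemma velocityLip_nonneg (hα : 0 < α) (p : ℝ) (ζ : R3 → ℝ) {B : ℝ} (hB : 0 ≤ B) :
    0 ≤ velocityLip α p ζ B := by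
  have h1 : 0 ≤ ∫ z, |ζ z| := integral_nonneg fun z => abs_nonneg _
  have h2 := potentialBound_nonneg p ζ
  have h3 := kernelBound_pos hα
  unfold velocityLip; positivity

/-- The estimate behind existence, uniqueness and regularity. The increment splits into a kernel
increment and an increment of the linear field `angular`. Only `m` has to preserve volume, since the
kernel increment is singular only in `|x - m z|`. -/
lemma norm_velocity_sub_le (hα : 0 < α) {p : ℝ} (hp : 3 / 2 < p) {ζ : R3 → ℝ}
    (h1 : Integrable ζ) (h2 : Integrable fun z => |ζ z| ^ p) {m m' : R3 → R3}
    (hm : MeasurePreserving m volume volume) (hm' : Measurable m') {B : ℝ} (hB0 : 0 ≤ B)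
    (hB : ∀ᵐ z, ζ z ≠ 0 → ‖m z‖ ≤ B) (hB' : ∀ᵐ z, ζ z ≠ 0 → ‖m' z‖ ≤ B) {δ : ℝ}
    (hδ : ∀ z, ‖m z - m' z‖ ≤ δ) (x x' : R3) :
    ‖velocity α ζ m x - velocity α ζ m' x'‖ ≤ velocityLip α p ζ B * (‖x - x'‖ + δ) := by
  have hδ0 : 0 ≤ δ := (norm_nonneg _).trans (hδ 0)
  obtain ⟨hi, hle⟩ := integrable_mul_inv_norm_sub hp h1 h2 hm x
  have hC := (kernelBound_pos hα).le
  set C := kernelBound α with hCdef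
  set D := ‖x - x'‖ + δ with hD
  have hD0 : 0 ≤ D := by positivity
  rw [velocity, velocity, ← integral_sub (integrable_velocity_integrand hα h1 hm.measurable hB x)
    (integrable_velocity_integrand hα h1 hm' hB' x')]
  have hbound : Integrable fun z =>
      C * D * ((B + 1) * |ζ z| + 2 * B * (|ζ z| * ‖x - m z‖⁻¹)) :=
    ((h1.abs.const_mul _).add (hi.const_mul _)).const_mul _
  refine (norm_integral_le_of_norm_le hbound ?_).trans ?_
  -- The preimage of a point under a volume preserving map is null.
  · have hne : ∀ᵐ z, x - m z ≠ 0 := by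
      have := (measurePreserving_const_sub hm x).quasiMeasurePreserving.ae
        (p := fun w => w ≠ 0) (by simp [ae_iff])
      exact this
    filter_upwards [hB, hne] with z hz hzne
    by_cases h : ζ z = 0
    · simp [h]
    rw [← smul_sub, norm_smul, Real.norm_eq_abs]
    have e : cross (gradGreen α (x - m z)) (angular (m z)) -
        cross (gradGreen α (x' - m' z)) (angular (m' z)) =
        cross (gradGreen α (x - m z) - gradGreen α (x' - m' z)) (angular (m z)) +
          cross (gradGreen α (x' - m' z)) (angular (m z - m' z)) := by
      rw [cross_sub_left, map_sub, cross_sub_right]; abel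
    have hdiff : ‖(x - m z) - (x' - m' z)‖ ≤ D := by
      calc _ = ‖(x - x') - (m z - m' z)‖ := by congr 1; abel
        _ ≤ _ := (norm_sub_le _ _).trans (by rw [hD]; gcongr; exact hδ z)
    have n1 : ‖cross (gradGreen α (x - m z) - gradGreen α (x' - m' z)) (angular (m z))‖ ≤
        C * (1 + 2 * ‖x - m z‖⁻¹) * D * B := by
      refine (norm_cross_le _ _).trans ?_
      gcongr
      · exact (norm_gradGreen_sub_le hα hzne _).trans (by gcongr)
      · exact (norm_angular_le _).trans (hz h)
    have n2 : ‖cross (gradGreen α (x' - m' z)) (angular (m z - m' z))‖ ≤ C * D := by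
      refine (norm_cross_le _ _).trans ?_
      gcongr
      · exact norm_gradGreen_le hα _
      · refine (norm_angular_le _).trans ((hδ z).trans ?_)
        rw [hD]; linarith [norm_nonneg (x - x')]
    rw [e]
    calc _ ≤ |ζ z| * (C * (1 + 2 * ‖x - m z‖⁻¹) * D * B + C * D) := by
          gcongr; exact (norm_add_le _ _).trans (add_le_add n1 n2)
      _ = _ := by ring
  · rw [integral_const_mul, integral_add (h1.abs.const_mul _) (hi.const_mul _),
      integral_const_mul, integral_const_mul]
    have h0 : 0 ≤ ∫ z, |ζ z| := integral_nonneg fun z => abs_nonneg _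
    calc _ ≤ C * D * ((B + 1) * (∫ z, |ζ z|) + 2 * B * potentialBound p ζ) := by gcongr
      _ = _ := by rw [velocityLip]; ring

/-! ### Flows of bounded Lipschitz velocities -/

/-- A time dependent velocity field that is bounded by `M`, `K`-Lipschitz in space and uniformly
continuous in time. -/
structure IsRegularVelocity (K : ℝ≥0) (M : ℝ) (u : ℝ → R3 → R3) : Prop where
  lip : ∀ t, LipschitzWith K (u t)
  bound : ∀ t x, ‖u t x‖ ≤ M
  unif : ∀ ε : ℝ, 0 < ε → ∃ δ : ℝ, 0 < δ ∧ ∀ s t, |s - t| < δ → ∀ x, ‖u s x - u t x‖ ≤ ε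

namespace IsRegularVelocity

variable {K : ℝ≥0} {M : ℝ} {u : ℝ → R3 → R3}

lemma bound_nonneg (hu : IsRegularVelocity K M u) : 0 ≤ M :=
  (norm_nonneg _).trans (hu.bound 0 0)

lemma norm_sub_le (hu : IsRegularVelocity K M u) (t : ℝ) (x y : R3) :
    ‖u t x - u t y‖ ≤ K * ‖x - y‖ := by
  simpa [dist_eq_norm] using (hu.lip t).dist_le_mul x y

lemma continuous_uncurry (hu : IsRegularVelocity K M u) :
    Continuous fun z : ℝ × R3 => u z.1 z.2 := by
  refine continuous_iff_continuousAt.2 fun z => Metric.continuousAt_iff.2 fun ε hε => ?_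
  obtain ⟨δ, hδ, h⟩ := hu.unif (ε / 4) (by positivity)
  refine ⟨min δ (ε / (4 * (K + 1))), by positivity, fun w hw => ?_⟩
  rw [Prod.dist_eq, max_lt_iff, lt_min_iff, lt_min_iff] at hw
  rw [dist_eq_norm]
  have h1 := h w.1 z.1 (by simpa [Real.dist_eq] using hw.1.1) w.2
  have h2 := hu.norm_sub_le z.1 w.2 z.2
  have h3 : ‖w.2 - z.2‖ < ε / (4 * (K + 1)) := by simpa [dist_eq_norm] using hw.2.2
  have h4 : (K : ℝ) * ‖w.2 - z.2‖ ≤ ε / 4 := by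
    rw [lt_div_iff₀ (by positivity)] at h3
    nlinarith [norm_nonneg (w.2 - z.2), K.coe_nonneg]
  calc ‖u w.1 w.2 - u z.1 z.2‖ = ‖(u w.1 w.2 - u z.1 w.2) + (u z.1 w.2 - u z.1 z.2)‖ := by
        congr 1; abel
    _ ≤ ε / 4 + ε / 4 := (norm_add_le _ _).trans (add_le_add h1 (h2.trans h4))
    _ < ε := by linarith

/-- The global bound `M` lets Picard–Lindelöf run on `[t₀ - (n + 1), t₀ + (n + 1)]` with a ball of
radius `M (n + 1)`, with no loss of time. The solutions for different `n` agree by uniqueness and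
are glued. -/
lemma exists_trajectory (hu : IsRegularVelocity K M u) (t₀ : ℝ) (x₀ : R3) :
    ∃ γ : ℝ → R3, γ t₀ = x₀ ∧ ∀ t, HasDerivAt γ (u t (γ t)) t := by
  have hM := hu.bound_nonneg
  have hloc : ∀ n : ℕ, ∃ γ : ℝ → R3, γ t₀ = x₀ ∧
      ∀ t ∈ Ioo (t₀ - (n + 1)) (t₀ + (n + 1)), HasDerivAt γ (u t (γ t)) t := by
    intro n
    have hmem : t₀ ∈ Icc (t₀ - (n + 1 : ℝ)) (t₀ + (n + 1)) := by
      constructor <;> linarith [n.cast_nonneg (α := ℝ)]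
    have hPL : IsPicardLindelof u (⟨t₀, hmem⟩ : Icc (t₀ - (n + 1 : ℝ)) (t₀ + (n + 1))) x₀
        (⟨M * (n + 1), by positivity⟩ : ℝ≥0) 0 ⟨M, hM⟩ K :=
      { lipschitzOnWith := fun t _ => (hu.lip t).lipschitzOnWith
        continuousOn := fun x _ =>
          (hu.continuous_uncurry.comp (Continuous.prodMk_left x)).continuousOn
        norm_le := fun t _ x _ => hu.bound t x
        mul_max_le := by simp; exact le_rfl }
    obtain ⟨γ, h0, h⟩ := hPL.exists_eq_forall_mem_Icc_hasDerivWithinAt₀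
    exact ⟨γ, h0, fun t ht => (h t (Ioo_subset_Icc_self ht)).hasDerivAt (Icc_mem_nhds ht.1 ht.2)⟩
  choose γ h0 hd using hloc
  have hagree : ∀ n m : ℕ, n ≤ m → EqOn (γ n) (γ m) (Ioo (t₀ - (n + 1)) (t₀ + (n + 1))) := by
    intro n m hnm
    have hnm' : (n : ℝ) ≤ m := by exact_mod_cast hnm
    refine ODE_solution_unique_of_mem_Ioo (v := u) (s := fun _ => univ) (K := K) (t₀ := t₀)
      (fun t _ => (hu.lip t).lipschitzOnWith) ?_ (fun t ht => ⟨hd n t ht, trivial⟩)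
      (fun t ht => ⟨hd m t ⟨by linarith [ht.1], by linarith [ht.2]⟩, trivial⟩) (by rw [h0, h0])
    constructor <;> linarith [n.cast_nonneg (α := ℝ)]
  have hagree' : ∀ n m : ℕ, ∀ t, |t - t₀| < n + 1 → |t - t₀| < m + 1 → γ n t = γ m t := by
    intro n m t hn hm
    rw [abs_lt] at hn hm
    rcases le_total n m with h | h
    · exact hagree n m h ⟨by linarith, by linarith⟩
    · exact (hagree m n h ⟨by linarith, by linarith⟩).symm
  have hfl : ∀ t : ℝ, |t - t₀| < ⌊|t - t₀|⌋₊ + 1 := fun t => Nat.lt_floor_add_one _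
  -- With `n = ⌊|t - t₀|⌋₊` the time `t` is interior to the interval of `γ n`, so the glued curve
  -- coincides with `γ n` near `t`.
  refine ⟨fun t => γ ⌊|t - t₀|⌋₊ t, by simp [h0], fun t => ?_⟩
  set n := ⌊|t - t₀|⌋₊ with hn
  have ht := hfl t
  rw [← hn] at ht
  have key := hd n t (by rw [abs_lt] at ht; exact ⟨by linarith, by linarith⟩)
  refine key.congr_of_eventuallyEq ?_
  have : ∀ᶠ s in 𝓝 t, |s - t₀| < n + 1 :=
    (continuous_abs.comp (continuous_id.sub continuous_const)).continuousAt.eventually_lt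
      continuousAt_const ht
  filter_upwards [this] with s hs
  exact hagree' _ _ s (hfl s) hs

lemma dist_trajectory_le_forward (hu : IsRegularVelocity K M u) {γ γ' : ℝ → R3}
    (h : ∀ t, HasDerivAt γ (u t (γ t)) t) (h' : ∀ t, HasDerivAt γ' (u t (γ' t)) t) {s t : ℝ}
    (hst : s ≤ t) : dist (γ t) (γ' t) ≤ dist (γ s) (γ' s) * Real.exp (K * (t - s)) :=
  dist_le_of_trajectories_ODE (v := u) hu.lip
    (fun r _ => (h r).continuousAt.continuousWithinAt) (fun r _ => (h r).hasDerivWithinAt)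
    (fun r _ => (h' r).continuousAt.continuousWithinAt) (fun r _ => (h' r).hasDerivWithinAt)
    le_rfl t ⟨hst, le_rfl⟩

lemma reverse (hu : IsRegularVelocity K M u) :
    IsRegularVelocity K M (fun t x => -u (-t) x) where
  lip t := (hu.lip (-t)).neg
  bound t x := by rw [norm_neg]; exact hu.bound _ _
  unif ε hε := by
    obtain ⟨δ, hδ, h⟩ := hu.unif ε hε
    refine ⟨δ, hδ, fun s t hst x => ?_⟩
    have := h (-t) (-s) (by rw [abs_lt] at hst ⊢; constructor <;> linarith) x
    rwa [neg_sub_neg]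

/-- Grönwall's inequality in both time directions; backward times are reduced to forward ones by
`reverse`. -/
lemma dist_trajectory_le (hu : IsRegularVelocity K M u) {γ γ' : ℝ → R3}
    (h : ∀ t, HasDerivAt γ (u t (γ t)) t) (h' : ∀ t, HasDerivAt γ' (u t (γ' t)) t) (s t : ℝ) :
    dist (γ t) (γ' t) ≤ dist (γ s) (γ' s) * Real.exp (K * |t - s|) := by
  rcases le_total s t with hst | hst
  · rw [abs_of_nonneg (by linarith)]; exact hu.dist_trajectory_le_forward h h' hst
  · have hr : ∀ {γ : ℝ → R3}, (∀ t, HasDerivAt γ (u t (γ t)) t) →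
        ∀ t, HasDerivAt (fun r => γ (-r)) (-u (-t) (γ (-t))) t := by
      intro γ h t
      have := (h (-t)).scomp t (hasDerivAt_neg t)
      rw [neg_one_smul] at this
      exact this
    have := hu.reverse.dist_trajectory_le_forward (hr h) (hr h') (s := -s) (t := -t) (by linarith)
    simp only [neg_neg] at this
    rwa [abs_of_nonpos (by linarith), show -(t - s) = -t - -s by ring]

lemma trajectory_unique (hu : IsRegularVelocity K M u) {γ γ' : ℝ → R3}
    (h : ∀ t, HasDerivAt γ (u t (γ t)) t) (h' : ∀ t, HasDerivAt γ' (u t (γ' t)) t) {s : ℝ}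
    (hs : γ s = γ' s) (t : ℝ) : γ t = γ' t := by
  have := hu.dist_trajectory_le h h' s t
  rw [hs, dist_self, zero_mul] at this
  exact dist_le_zero.1 this

end IsRegularVelocity

/-- `Y` is the flow, for all times, of the velocity `u`, started at time `0`. -/
structure IsFlow (u : ℝ → R3 → R3) (Y : ℝ → R3 ≃ₜ R3) : Prop where
  zero : ∀ x, Y 0 x = x
  hasDerivAt : ∀ x t, HasDerivAt (fun s => Y s x) (u t (Y t x)) t

/-- Continuity in each variable separately becomes joint continuity because the Lipschitz constant
in space is locally bounded in time. -/
lemma continuous_uncurry_of_lipschitz {f : ℝ → R3 → R3} {C : ℝ → ℝ} (hC : Continuous C)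
    (h : ∀ t x y, ‖f t x - f t y‖ ≤ C t * ‖x - y‖) (hc : ∀ x, Continuous fun t => f t x) :
    Continuous fun z : ℝ × R3 => f z.1 z.2 := by
  refine continuous_iff_continuousAt.2 fun z => ?_
  rw [ContinuousAt, tendsto_iff_norm_sub_tendsto_zero]
  have h1 : Tendsto (fun w : ℝ × R3 => C w.1 * ‖w.2 - z.2‖ + ‖f w.1 z.2 - f z.1 z.2‖) (𝓝 z)
      (𝓝 0) := by
    have hcont : Continuous fun w : ℝ × R3 => C w.1 * ‖w.2 - z.2‖ + ‖f w.1 z.2 - f z.1 z.2‖ := by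
      have := (hc z.2).comp (continuous_fst (X := ℝ) (Y := R3))
      have h2 := hC.comp (continuous_fst (X := ℝ) (Y := R3))
      exact (h2.mul (continuous_snd.sub continuous_const).norm).add
        (this.sub continuous_const).norm
    have := hcont.tendsto z
    simpa using this
  refine squeeze_zero (fun _ => norm_nonneg _) (fun w => ?_) h1
  calc ‖f w.1 w.2 - f z.1 z.2‖ = ‖(f w.1 w.2 - f w.1 z.2) + (f w.1 z.2 - f z.1 z.2)‖ := by
        congr 1; abel
    _ ≤ _ := (norm_add_le _ _).trans (add_le_add (h _ _ _) le_rfl)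

namespace IsRegularVelocity

variable {K : ℝ≥0} {M : ℝ} {u : ℝ → R3 → R3}

/-- The inverse of the time-`t` map is the trajectory through `x` at time `t`, followed back to time
`0`. Grönwall's inequality makes both maps continuous. -/
theorem exists_flow (hu : IsRegularVelocity K M u) : ∃ Y : ℝ → R3 ≃ₜ R3, IsFlow u Y := by
  choose γ h0 hd using hu.exists_trajectory
  have hlip : ∀ s t x y, ‖γ s x t - γ s y t‖ ≤ Real.exp (K * |t - s|) * ‖x - y‖ := by
    intro s t x y
    have := hu.dist_trajectory_le (hd s x) (hd s y) s t
    rwa [h0, h0, dist_eq_norm, dist_eq_norm, mul_comm] at this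
  have hcont : ∀ s t, Continuous fun x => γ s x t := by
    intro s t
    refine (LipschitzWith.of_dist_le_mul (K := ⟨Real.exp (K * |t - s|), (Real.exp_pos _).le⟩)
      fun x y => ?_).continuous
    rw [dist_eq_norm, dist_eq_norm]
    exact hlip s t x y
  have hinv : ∀ s t x, γ t (γ s x t) s = x := by
    intro s t x
    rw [hu.trajectory_unique (hd t (γ s x t)) (hd s x) (h0 t _) s, h0]
  refine ⟨fun t => ⟨⟨fun x => γ 0 x t, fun x => γ t x 0, fun x => hinv 0 t x,
    fun x => hinv t 0 x⟩, hcont 0 t, hcont t 0⟩, fun x => h0 0 x, fun x t => hd 0 x t⟩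

end IsRegularVelocity

namespace IsFlow

variable {K : ℝ≥0} {M : ℝ} {u : ℝ → R3 → R3} {Y : ℝ → R3 ≃ₜ R3}

lemma norm_sub_le (hu : IsRegularVelocity K M u) (hY : IsFlow u Y) (s t : ℝ) (x y : R3) :
    ‖Y t x - Y t y‖ ≤ Real.exp (K * |t - s|) * ‖Y s x - Y s y‖ := by
  have := hu.dist_trajectory_le (hY.hasDerivAt x) (hY.hasDerivAt y) s t
  rwa [dist_eq_norm, dist_eq_norm, mul_comm] at this

lemma norm_sub_le_zero (hu : IsRegularVelocity K M u) (hY : IsFlow u Y) (t : ℝ) (x y : R3) :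
    ‖Y t x - Y t y‖ ≤ Real.exp (K * |t|) * ‖x - y‖ := by
  simpa [hY.zero] using hY.norm_sub_le hu 0 t x y

lemma norm_symm_sub_le (hu : IsRegularVelocity K M u) (hY : IsFlow u Y) (t : ℝ) (x y : R3) :
    ‖(Y t).symm x - (Y t).symm y‖ ≤ Real.exp (K * |t|) * ‖x - y‖ := by
  simpa [hY.zero] using hY.norm_sub_le hu t 0 ((Y t).symm x) ((Y t).symm y)

lemma norm_time_sub_le (hu : IsRegularVelocity K M u) (hY : IsFlow u Y) (s t : ℝ) (x : R3) :
    ‖Y t x - Y s x‖ ≤ M * |t - s| := by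
  have := Convex.norm_image_sub_le_of_norm_hasDerivWithin_le (s := univ) (x := s) (y := t)
    (f := fun r => Y r x) (C := M) (fun r _ => (hY.hasDerivAt x r).hasDerivWithinAt)
    (fun r _ => hu.bound _ _) convex_univ trivial trivial
  simpa using this

/-- Write `Y_s⁻¹ x = Y_t⁻¹ (Y_t Y_s⁻¹ x)`: the point `Y_t Y_s⁻¹ x` is within `M |t - s|` of `x`, and
`Y_t⁻¹` is Lipschitz. -/
lemma norm_symm_time_sub_le (hu : IsRegularVelocity K M u) (hY : IsFlow u Y) (s t : ℝ) (x : R3) :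
    ‖(Y t).symm x - (Y s).symm x‖ ≤ Real.exp (K * |t|) * (M * |t - s|) := by
  have h1 := hY.norm_symm_sub_le hu t x (Y t ((Y s).symm x))
  rw [Homeomorph.symm_apply_apply] at h1
  refine h1.trans ?_
  gcongr
  have := hY.norm_time_sub_le hu t s ((Y s).symm x)
  rwa [Homeomorph.apply_symm_apply, abs_sub_comm] at this

lemma continuous_uncurry (hu : IsRegularVelocity K M u) (hY : IsFlow u Y) :
    Continuous fun z : ℝ × R3 => Y z.1 z.2 :=
  continuous_uncurry_of_lipschitz (f := fun t x => Y t x) (C := fun t => Real.exp (K * |t|))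
    (by fun_prop) (fun t x y => hY.norm_sub_le_zero hu t x y)
    fun x => continuous_iff_continuousAt.2 fun t => (hY.hasDerivAt x t).continuousAt

lemma continuous_symm_uncurry (hu : IsRegularVelocity K M u) (hY : IsFlow u Y) :
    Continuous fun z : ℝ × R3 => (Y z.1).symm z.2 := by
  refine continuous_uncurry_of_lipschitz (f := fun t x => (Y t).symm x)
    (C := fun t => Real.exp (K * |t|))
    (by fun_prop) (fun t x y => hY.norm_symm_sub_le hu t x y) fun x => ?_
  refine continuous_iff_continuousAt.2 fun s => ?_
  rw [ContinuousAt, tendsto_iff_norm_sub_tendsto_zero]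
  refine squeeze_zero (fun _ => norm_nonneg _) (fun t => hY.norm_symm_time_sub_le hu s t x) ?_
  have : Continuous fun t : ℝ => Real.exp (K * |t|) * (M * |t - s|) := by fun_prop
  simpa using this.tendsto s

lemma eq_add_integral (hu : IsRegularVelocity K M u) (hY : IsFlow u Y) (t : ℝ) (x : R3) :
    Y t x = x + ∫ s in (0 : ℝ)..t, u s (Y s x) := by
  have hc : Continuous fun s => u s (Y s x) :=
    hu.continuous_uncurry.comp (continuous_id.prodMk
      ((hY.continuous_uncurry hu).comp (Continuous.prodMk_left x)))
  rw [intervalIntegral.integral_eq_sub_of_hasDerivAt (f := fun s => Y s x)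
    (fun s _ => hY.hasDerivAt x s) (hc.intervalIntegrable _ _), hY.zero]
  abel

/-- Trajectories on a time interval `[0, T]` in integral form are trajectories of the flow. -/
lemma eq_of_integral_eq (hu : IsRegularVelocity K M u) (hY : IsFlow u Y) {T : ℝ} {γ : ℝ → R3}
    {x : R3} (hγ : ContinuousOn γ (Icc 0 T))
    (h : ∀ t ∈ Icc 0 T, γ t = x + ∫ s in (0 : ℝ)..t, u s (γ s)) :
    ∀ t ∈ Icc 0 T, γ t = Y t x := by
  intro t ht
  have hT : 0 ≤ T := ht.1.trans ht.2
  have hYc : ∀ t, ContinuousAt (fun s => Y s x) t := fun t => (hY.hasDerivAt x t).continuousAt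
  have hc : ContinuousOn (fun s => u s (γ s)) (Icc 0 T) :=
    hu.continuous_uncurry.comp_continuousOn (continuousOn_id.prodMk hγ)
  refine ODE_solution_unique (v := u) (K := K) hu.lip hγ (fun s hs => ?_)
    (fun s _ => (hYc s).continuousWithinAt) (fun s _ => (hY.hasDerivAt x s).hasDerivWithinAt) ?_ ht
  · have hs' : s ∈ Icc 0 T := Ico_subset_Icc_self hs
    have hcs : ContinuousWithinAt (fun s => u s (γ s)) (Icc s T) s :=
      (hc s hs').mono (Icc_subset_Icc_left hs.1)
    have hint : IntervalIntegrable (fun s => u s (γ s)) volume 0 s :=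
      (hc.mono (by rw [uIcc_of_le hs.1]; exact Icc_subset_Icc_right hs.2.le)).intervalIntegrable
    -- The curve `γ` is controlled on `[0, T]` only, so right derivatives are used; they suffice for
    -- uniqueness.
    have hd : HasDerivWithinAt (fun t => ∫ r in (0 : ℝ)..t, u r (γ r)) (u s (γ s)) (Ici s) s := by
      refine intervalIntegral.integral_hasDerivWithinAt_right hint (t := Ioi s)
        (s := Ici s) ?_ ?_
      · refine ⟨Icc 0 T, ?_, hc.aestronglyMeasurable measurableSet_Icc⟩
        exact mem_nhdsWithin.2 ⟨Iio T, isOpen_Iio, hs.2, fun r hr =>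
          ⟨hs.1.trans (le_of_lt (mem_Ioi.1 hr.2)), le_of_lt hr.1⟩⟩
      · exact hcs.mono_of_mem_nhdsWithin ((nhdsWithin_mono s Ioi_subset_Ici_self) (Icc_mem_nhdsGE hs.2))
    refine ((hd.const_add x).congr_of_eventuallyEq ?_ (h s hs'))
    filter_upwards [Icc_mem_nhdsGE hs.2] with r hr
    exact h r ⟨hs.1.trans hr.1, hr.2⟩
  · rw [h 0 ⟨le_rfl, hT⟩, hY.zero]; simp

end IsFlow

/-! ### Transport of integrals along the flow -/

/-- A compactly supported function that is uniformly differentiable along the field `X`, with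
derivative `B`, is approximated by smooth functions whose derivatives along `X` converge
uniformly. -/
lemma exists_contDiff_fderiv_sub_le {E : Type*} [NormedAddCommGroup E] [NormedSpace ℝ E]
    [FiniteDimensional ℝ E] [MeasurableSpace E] [BorelSpace E] (μ : Measure E)
    [μ.IsAddHaarMeasure] {Φ : E → ℝ} (hΦ : Continuous Φ) {X : E → E} {B : E → ℝ}
    (H : ∀ e > 0, ∃ ε > 0, ∀ z z', ‖z - z'‖ ≤ ε → ∀ h, 0 < h → h < ε →
      |h⁻¹ * (Φ (z' + h • X z) - Φ z') - B z| ≤ e) {e r : ℝ} (he : 0 < e) (hr : 0 < r) :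
    ∃ φ : E → ℝ, ContDiff ℝ ∞ φ ∧ Function.support φ ⊆ Metric.cthickening r (tsupport Φ) ∧
      ∀ z, |fderiv ℝ φ z (X z) - B z| ≤ e := by
  obtain ⟨ε, hε, hclaim⟩ := H e he
  -- The mollification radius: below `ε` for the quality of the approximation, below `r` for the
  -- support.
  set ρ := min ε r with hρ
  have hρ0 : 0 < ρ := lt_min hε hr
  let f : ContDiffBump (0 : E) := ⟨ρ / 2, ρ, by positivity, by linarith⟩
  set k := f.normed μ with hk
  have hkc : Continuous k := f.continuous_normed
  have hks : HasCompactSupport k := f.hasCompactSupport_normed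
  have hkz : ∀ w, k w ≠ 0 → ‖w‖ < ρ := fun w hw => by
    have : w ∈ Function.support (f.normed μ) := hw
    rw [f.support_normed_eq] at this
    simpa using this
  set φ : E → ℝ := convolution k Φ (ContinuousLinearMap.lsmul ℝ ℝ) μ with hφ
  have hφe : ∀ z, φ z = ∫ w, k w * Φ (z - w) ∂μ := fun z => rfl
  have hφs : ContDiff ℝ ∞ φ :=
    hks.contDiff_convolution_left _ f.contDiff_normed hΦ.locallyIntegrable
  have hint : ∀ z, Integrable (fun w => k w * Φ (z - w)) μ := fun z =>
    (hkc.mul (hΦ.comp (continuous_const.sub continuous_id))).integrable_of_hasCompactSupport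
      hks.mul_right
  refine ⟨φ, hφs, fun z hz => ?_, fun z => ?_⟩
  · obtain ⟨a, ha, b, hb, rfl⟩ := Set.mem_add.1 (support_convolution_subset _ hz)
    refine Metric.mem_cthickening_of_dist_le _ b _ _ (subset_tsupport _ hb) ?_
    rw [dist_eq_norm, add_sub_cancel_right]
    exact (hkz a ha).le.trans (min_le_right _ _)
  · have hlim := ((hφs.differentiable (by simp)).differentiableAt (x := z)).hasFDerivAt.lim_real
      (X z)
    have hlim2 : Tendsto (fun c : ℝ => |c • (φ (z + c⁻¹ • X z) - φ z) - B z|) atTop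
        (𝓝 |fderiv ℝ φ z (X z) - B z|) := (hlim.sub_const _).abs
    refine le_of_tendsto hlim2 ?_
    filter_upwards [eventually_gt_atTop (0 : ℝ), eventually_gt_atTop ε⁻¹] with c hc hcε
    have hh : c⁻¹ < ε := inv_lt_of_inv_lt₀ hε hcε
    have hone : ∫ w, k w ∂μ = 1 := f.integral_normed
    have hki : Integrable k μ := hkc.integrable_of_hasCompactSupport hks
    -- The difference quotient of the mollification is an average of difference quotients of `Φ` at
    -- the nearby points `z - w`, all in the frozen direction `X z`. The hypothesis `H` compares two
    -- points for exactly this reason, and so no commutator with `X` appears.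
    have e1 : c • (φ (z + c⁻¹ • X z) - φ z) - B z =
        ∫ w, k w * (c * (Φ ((z - w) + c⁻¹ • X z) - Φ (z - w)) - B z) ∂μ := by
      have : ∀ w, k w * (c * (Φ ((z - w) + c⁻¹ • X z) - Φ (z - w)) - B z) =
          c * (k w * Φ (z + c⁻¹ • X z - w)) - c * (k w * Φ (z - w)) - k w * B z := by
        intro w
        rw [show (z - w) + c⁻¹ • X z = z + c⁻¹ • X z - w by abel]; ring
      simp_rw [this]
      have hi2 : ∀ z', Integrable (fun w => c * (k w * Φ (z' - w))) μ :=
        fun z' => (hint z').const_mul c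
      have hi3 : Integrable (fun w => c * (k w * Φ (z + c⁻¹ • X z - w)) -
        c * (k w * Φ (z - w))) μ := (hi2 _).sub (hi2 _)
      rw [integral_sub hi3 (hki.mul_const _), integral_sub ((hint _).const_mul c) ((hint _).const_mul c), integral_const_mul,
        integral_const_mul, integral_mul_const, hone, hφe, hφe, smul_eq_mul]
      ring
    rw [e1, ← Real.norm_eq_abs]
    refine (norm_integral_le_of_norm_le (hki.mul_const e) (ae_of_all _ fun w => ?_)).trans_eq
      (by rw [integral_mul_const, hone, one_mul])
    rw [norm_mul, Real.norm_of_nonneg (f.nonneg_normed w)]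
    by_cases hw : k w = 0
    · rw [← hk, hw]; simp
    · refine mul_le_mul_of_nonneg_left ?_ (f.nonneg_normed w)
      have := hclaim z (z - w) (by simpa using ((hkz w hw).trans_le (min_le_left _ _)).le) c⁻¹
        (by positivity) hh
      rwa [inv_inv] at this

variable {K : ℝ≥0} {M T : ℝ} {u : ℝ → R3 → R3} {Y : ℝ → R3 ≃ₜ R3}

/-- Functions of the form `η(t) φ(Y_t⁻¹ x)` are uniformly differentiable along `(1, u)`. -/
lemma IsFlow.uniform_deriv_along (hu : IsRegularVelocity K M u) (hY : IsFlow u Y)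
    {η : ℝ → ℝ} (hη : ContDiff ℝ ∞ η) (hηs : tsupport η ⊆ Ioo 0 T) {φ : R3 → ℝ} {L : ℝ≥0}
    (hφ : LipschitzWith L φ) {N₀ : ℝ} (hN₀ : ∀ x, |φ x| ≤ N₀) (e : ℝ) (he : 0 < e) :
    ∃ ε > 0, ∀ z z' : ℝ × R3, ‖z - z'‖ ≤ ε → ∀ h, 0 < h → h < ε →
      |h⁻¹ * ((fun z : ℝ × R3 => η z.1 * φ ((Y z.1).symm z.2)) (z' + h • (1, u z.1 z.2)) -
        (fun z : ℝ × R3 => η z.1 * φ ((Y z.1).symm z.2)) z') -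
          deriv η z.1 * φ ((Y z.1).symm z.2)| ≤ e := by
  have hηc : HasCompactSupport η :=
    HasCompactSupport.of_support_subset_isCompact isCompact_Icc
      ((subset_tsupport η).trans (hηs.trans Ioo_subset_Icc_self))
  have hη1 : ContDiff ℝ ∞ (deriv η) := (contDiff_infty_iff_deriv.1 hη).2
  obtain ⟨N₃, hN₃⟩ := hη.continuous.bounded_above_of_compact_support hηc
  obtain ⟨N₁, hN₁⟩ := hη1.continuous.bounded_above_of_compact_support hηc.deriv
  obtain ⟨N₂, hN₂⟩ := ((contDiff_infty_iff_deriv.1 hη1).2.continuous).bounded_above_of_compact_support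
    hηc.deriv.deriv
  have hM := hu.bound_nonneg
  have hN₀' : 0 ≤ N₀ := (abs_nonneg _).trans (hN₀ 0)
  have hN₁' : 0 ≤ N₁ := (norm_nonneg _).trans (hN₁ 0)
  have hN₂' : 0 ≤ N₂ := (norm_nonneg _).trans (hN₂ 0)
  have hN₃' : 0 ≤ N₃ := (norm_nonneg _).trans (hN₃ 0)
  have hderiv : ∀ s, HasDerivAt η (deriv η s) s := fun s =>
    (hη.differentiable (by simp) s).hasDerivAt
  have lip0 : ∀ a b, |η a - η b| ≤ N₁ * |a - b| := fun a b => by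
    simpa using Convex.norm_image_sub_le_of_norm_deriv_le (s := univ) (f := η) (C := N₁)
      (fun s _ => hη.differentiable (by simp) s) (fun s _ => hN₁ s) convex_univ
      (mem_univ b) (mem_univ a)
  have lip1 : ∀ a b, |deriv η a - deriv η b| ≤ N₂ * |a - b| := fun a b => by
    simpa using Convex.norm_image_sub_le_of_norm_deriv_le (s := univ) (f := deriv η) (C := N₂)
      (fun s _ => hη1.differentiable (by simp) s) (fun s _ => hN₂ s) convex_univ
      (mem_univ b) (mem_univ a)
  have hφ' : ∀ a b, |φ a - φ b| ≤ L * ‖a - b‖ := fun a b => by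
    simpa [dist_eq_norm] using hφ.dist_le_mul a b
  set C := Real.exp (K * (|T| + 2)) with hC
  have hC0 : 0 < C := Real.exp_pos _
  have hCt : ∀ t : ℝ, |t| ≤ |T| + 2 → Real.exp (K * |t|) ≤ C := fun t ht => by
    rw [hC]; gcongr
  -- `A` collects the coefficients of `ε` in the final estimate and `A'` the coefficient of the
  -- modulus of continuity of `u` in time. Each is allotted `e / 2`.
  set A := N₁ * L * C * (1 + M) + 2 * N₂ * N₀ + N₃ * L * C * (K * (M + 1)) with hA
  have hA0 : 0 ≤ A := by positivity
  set A' := N₃ * L * C with hA'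
  have hA'0 : 0 ≤ A' := by positivity
  obtain ⟨δ, hδ, hunif⟩ := hu.unif (e / (2 * (A' + 1))) (by positivity)
  refine ⟨min (min (δ / 3) (1 / 4)) (e / (2 * (A + 1))), by positivity, ?_⟩
  set ε := min (min (δ / 3) (1 / 4)) (e / (2 * (A + 1))) with hεdef
  have hε0 : 0 < ε := by positivity
  have hε1 : ε ≤ δ / 3 := (min_le_left _ _).trans (min_le_left _ _)
  have hε2 : ε ≤ 1 / 4 := (min_le_left _ _).trans (min_le_right _ _)
  have hε3 : ε ≤ e / (2 * (A + 1)) := min_le_right _ _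
  rintro ⟨t, x⟩ ⟨t', x'⟩ hz h hh hhε
  rw [Prod.norm_def, max_le_iff] at hz
  have hz1 : |t - t'| ≤ ε := hz.1
  have hz2 : ‖x - x'‖ ≤ ε := hz.2
  simp only [Prod.fst_add, Prod.snd_add, Prod.smul_fst, Prod.smul_snd, smul_eq_mul, mul_one]
  have hz1' := abs_le.1 hz1
  have hzero : ∀ s, s ∉ Ioo 0 T → η s = 0 := fun s hs =>
    image_eq_zero_of_notMem_tsupport fun h => hs (hηs h)
  have hzero' : ∀ s, s ∉ Ioo 0 T → deriv η s = 0 := fun s hs => by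
    have : s ∉ tsupport (deriv η) := fun h => hs (hηs (tsupport_deriv_subset h))
    exact image_eq_zero_of_notMem_tsupport this
  -- Far from `[0, T]` the three values of `η` and its derivative vanish. What remains is a bounded
  -- range of times, on which the exponentially growing Lipschitz constants of `Y_t⁻¹` are at most
  -- `C`.
  by_cases ht : t < -1 ∨ |T| + 1 < t
  · have hT := le_abs_self T
    rw [hzero (t' + h), hzero t', hzero' t]
    · simpa using he.le
    all_goals
      rintro ⟨h1, h2⟩
      rcases ht with ht | ht <;> linarith
  push Not at ht
  have habs : ∀ s, |s - t| ≤ 2 * ε → |s| ≤ |T| + 2 := fun s hs => by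
    have hT := abs_nonneg T
    rw [abs_le] at hs ⊢
    constructor <;> linarith
  have ht' : |t'| ≤ |T| + 2 := habs t' (by rw [abs_sub_comm]; linarith)
  have hth : |t' + h - t| ≤ 2 * ε := by rw [abs_le]; constructor <;> linarith
  have ht'h : |t' + h| ≤ |T| + 2 := habs _ hth
  set p := (Y t').symm x' with hp
  set p₀ := (Y t).symm x with hp₀
  have hYp : Y t' p = x' := (Y t').apply_symm_apply x'
  have hpp : ‖p - p₀‖ ≤ C * (1 + M) * ε := by
    have h1 := hY.norm_symm_sub_le hu t' x' x
    have h2 := hY.norm_symm_time_sub_le hu t t' x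
    calc ‖p - p₀‖ = ‖((Y t').symm x' - (Y t').symm x) + ((Y t').symm x - (Y t).symm x)‖ := by
          rw [hp, hp₀]; congr 1; abel
      _ ≤ C * ε + C * (M * ε) := by
          refine (norm_add_le _ _).trans (add_le_add (h1.trans ?_) (h2.trans ?_))
          · rw [norm_sub_rev]; gcongr; exact hCt t' ht'
          · rw [abs_sub_comm]; gcongr; exact hCt t' ht'
      _ = _ := by ring
  have T2 : |η (t' + h) - η t' - h * deriv η t| ≤ h * (N₂ * (2 * ε)) := by
    have := Convex.norm_image_sub_le_of_norm_hasDerivWithin_le (s := Icc t' (t' + h))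
      (f := fun s => η s - s * deriv η t) (f' := fun s => deriv η s - deriv η t)
      (C := N₂ * (2 * ε)) (x := t') (y := t' + h)
      (fun s _ => by
        simpa using ((hderiv s).fun_sub ((hasDerivAt_id s).mul_const (deriv η t))).hasDerivWithinAt)
      (fun s hs => by
        refine (lip1 s t).trans ?_
        gcongr
        rw [abs_le]; constructor <;> linarith [hs.1, hs.2])
      (convex_Icc _ _) ⟨le_rfl, by linarith⟩ ⟨by linarith, le_rfl⟩
    rw [Real.norm_eq_abs, Real.norm_eq_abs, add_sub_cancel_left, abs_of_pos hh] at this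
    calc _ = |η (t' + h) - (t' + h) * deriv η t - (η t' - t' * deriv η t)| := by congr 1; ring
      _ ≤ _ := by linarith
  -- The straight step in the direction `u t x` follows the trajectory through `x'` up to an error
  -- small relative to `h`, so `φ ∘ Y⁻¹` is almost constant along it.
  have T3 : ‖x' + h • u t x - Y (t' + h) p‖ ≤ h * (e / (2 * (A' + 1)) + K * ((M + 1) * ε)) := by
    have := Convex.norm_image_sub_le_of_norm_hasDerivWithin_le (s := Icc t' (t' + h))
      (f := fun s => Y s p - s • u t x) (f' := fun s => u s (Y s p) - u t x)
      (C := e / (2 * (A' + 1)) + K * ((M + 1) * ε)) (x := t') (y := t' + h)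
      (fun s _ => by
        simpa using ((hY.hasDerivAt p s).fun_sub ((hasDerivAt_id s).smul_const (u t x))).hasDerivWithinAt)
      (fun s hs => by
        have h1 := hunif s t (by rw [abs_lt]; constructor <;> linarith [hs.1, hs.2]) (Y s p)
        have h2 := hu.norm_sub_le t (Y s p) x
        have h3 : ‖Y s p - x‖ ≤ (M + 1) * ε := by
          have h4 := hY.norm_time_sub_le hu t' s p
          rw [hYp] at h4
          calc ‖Y s p - x‖ = ‖(Y s p - x') - (x - x')‖ := by congr 1; abel
            _ ≤ M * ε + ε := by
              refine (_root_.norm_sub_le _ _).trans (add_le_add (h4.trans ?_) hz2)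
              gcongr
              rw [abs_of_nonneg (by linarith [hs.1])]; linarith [hs.2]
            _ = _ := by ring
        calc ‖u s (Y s p) - u t x‖ = ‖(u s (Y s p) - u t (Y s p)) + (u t (Y s p) - u t x)‖ := by
              congr 1; abel
          _ ≤ _ := (norm_add_le _ _).trans (add_le_add h1 (h2.trans (by gcongr))))
      (convex_Icc _ _) ⟨le_rfl, by linarith⟩ ⟨by linarith, le_rfl⟩
    rw [Real.norm_eq_abs, add_sub_cancel_left, abs_of_pos hh, hYp] at this
    rw [norm_sub_rev]
    calc _ = ‖Y (t' + h) p - (t' + h) • u t x - (x' - t' • u t x)‖ := by congr 1; module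
      _ ≤ _ := by linarith
  have T4 : |φ ((Y (t' + h)).symm (x' + h • u t x)) - φ p| ≤
      L * (C * (h * (e / (2 * (A' + 1)) + K * ((M + 1) * ε)))) := by
    refine (hφ' _ _).trans ?_
    gcongr
    have h1 := hY.norm_symm_sub_le hu (t' + h) (x' + h • u t x) (Y (t' + h) p)
    rw [Homeomorph.symm_apply_apply] at h1
    refine h1.trans (mul_le_mul (hCt _ ht'h) T3 (norm_nonneg _) hC0.le)
  -- Three errors: the displacement of the label from `p₀` to `p`, the Taylor remainder of `η`, and
  -- the drift of the label during the step.
  have split : h⁻¹ * (η (t' + h) * φ ((Y (t' + h)).symm (x' + h • u t x)) - η t' * φ p) -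
      deriv η t * φ p₀ = h⁻¹ * ((η (t' + h) - η t') * (φ p - φ p₀) +
        (η (t' + h) - η t' - h * deriv η t) * φ p₀ +
        η (t' + h) * (φ ((Y (t' + h)).symm (x' + h • u t x)) - φ p)) := by
    field_simp; ring
  rw [split, abs_mul, abs_of_pos (inv_pos.2 hh), inv_mul_le_iff₀ hh]
  have b1 : |(η (t' + h) - η t') * (φ p - φ p₀)| ≤ (N₁ * h) * (L * (C * (1 + M) * ε)) := by
    rw [abs_mul]
    have := lip0 (t' + h) t'
    rw [add_sub_cancel_left, abs_of_pos hh] at this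
    exact mul_le_mul this ((hφ' _ _).trans (by gcongr)) (abs_nonneg _) (by positivity)
  have b2 : |(η (t' + h) - η t' - h * deriv η t) * φ p₀| ≤ (h * (N₂ * (2 * ε))) * N₀ := by
    rw [abs_mul]; exact mul_le_mul T2 (hN₀ _) (abs_nonneg _) (by positivity)
  have b3 : |η (t' + h) * (φ ((Y (t' + h)).symm (x' + h • u t x)) - φ p)| ≤
      N₃ * (L * (C * (h * (e / (2 * (A' + 1)) + K * ((M + 1) * ε))))) := by
    rw [abs_mul]; exact mul_le_mul (hN₃ _) T4 (abs_nonneg _) hN₃'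
  calc _ ≤ (N₁ * h) * (L * (C * (1 + M) * ε)) + (h * (N₂ * (2 * ε))) * N₀ +
        N₃ * (L * (C * (h * (e / (2 * (A' + 1)) + K * ((M + 1) * ε))))) :=
        (abs_add_three _ _ _).trans (by gcongr)
    _ = h * (A * ε + A' * (e / (2 * (A' + 1)))) := by rw [hA, hA']; ring
    _ ≤ h * e := by
        gcongr
        have e1 : A * ε ≤ e / 2 := by
          calc A * ε ≤ (A + 1) * (e / (2 * (A + 1))) := by gcongr; linarith
            _ = e / 2 := by field_simp
        have e2 : A' * (e / (2 * (A' + 1))) ≤ e / 2 := by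
          calc _ ≤ (A' + 1) * (e / (2 * (A' + 1))) := by gcongr; linarith
            _ = e / 2 := by field_simp
        linarith

instance isAddHaarMeasure_volume_prod : (volume : Measure (ℝ × R3)).IsAddHaarMeasure := by
  rw [Measure.volume_eq_prod]; infer_instance

/-- **Du Bois-Reymond**: a function with vanishing weak derivative is constant. -/
lemma ae_eq_const_of_forall_integral_deriv_eq_zero {T : ℝ} (hT : 0 < T) {c : ℝ → ℝ}
    (hc : IntegrableOn c (Ioo 0 T))
    (h : ∀ η : ℝ → ℝ, ContDiff ℝ ∞ η → tsupport η ⊆ Ioo 0 T →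
      ∫ t in Ioo 0 T, deriv η t * c t = 0) :
    ∃ k, ∀ᵐ t ∂volume.restrict (Ioo 0 T), c t = k := by
  obtain ⟨f, hf1, hf2, hf3, hf4, hf5⟩ := exists_contDiff_tsupport_subset (n := (⊤ : ℕ∞))
    (Ioo_mem_nhds (show 0 < T / 2 by linarith) (show T / 2 < T by linarith))
  have hfc : Continuous f := hf3.continuous
  have hfpos : 0 < ∫ t, f t :=
    hfc.integral_pos_of_hasCompactSupport_nonneg_nonzero hf2 (fun x => (hf4 ⟨x, rfl⟩).1)
      (x := T / 2) (by rw [hf5]; exact one_ne_zero)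
  set I := ∫ t, f t with hI
  -- The constant can only be the mean of `c` weighted by the bump `f`.
  set k := I⁻¹ * ∫ t in Ioo 0 T, f t * c t with hk
  refine ⟨k, ?_⟩
  have hloc : LocallyIntegrableOn (fun t => c t - k) (Ioo 0 T) :=
    (hc.sub (integrableOn_const (by simp))).locallyIntegrableOn
  have key := isOpen_Ioo.ae_eq_zero_of_integral_contDiff_smul_eq_zero hloc (μ := volume) ?_
  · rw [ae_restrict_iff' measurableSet_Ioo]
    filter_upwards [key] with t ht hmem
    linarith [ht hmem]
  · intro g hg hgc hgs
    have hout : ∀ ψ : ℝ → ℝ, tsupport ψ ⊆ Ioo 0 T → ∀ F : ℝ → ℝ,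
        ∫ t in Ioo 0 T, ψ t * F t = ∫ t, ψ t * F t := fun ψ hψ F =>
      setIntegral_eq_integral_of_forall_compl_eq_zero fun t ht => by
        rw [image_eq_zero_of_notMem_tsupport fun h => ht (hψ h), zero_mul]
    set J := ∫ t, g t with hJ
    -- Subtracting a multiple of `f` makes the integral zero, so the primitive of `ψ` has compact
    -- support and is an admissible `η`.
    let ψ : ℝ → ℝ := fun t => g t - J * I⁻¹ * f t
    have hψ : ContDiff ℝ ∞ ψ := hg.sub (contDiff_const.mul hf3)
    have hψc : Continuous ψ := hψ.continuous
    have hgI : Integrable g := hg.continuous.integrable_of_hasCompactSupport hgc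
    have hfI : Integrable f := hfc.integrable_of_hasCompactSupport hf2
    have hψ0 : ∫ t, ψ t = 0 := by
      rw [integral_sub hgI (hfI.const_mul _), integral_const_mul]
      field_simp; ring
    obtain ⟨a, b, ha, hb, hab, hsub⟩ : ∃ a b, 0 < a ∧ b < T ∧ a ≤ b ∧
        ∀ t, t ∉ Icc a b → ψ t = 0 := by
      have hcomp : IsCompact (tsupport g ∪ tsupport f) := hgc.isCompact.union hf2.isCompact
      have hne : (tsupport g ∪ tsupport f).Nonempty :=
        ⟨T / 2, Or.inr (subset_tsupport _ (by simp [hf5]))⟩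
      have hsubs : tsupport g ∪ tsupport f ⊆ Ioo 0 T := union_subset hgs hf1
      refine ⟨sInf _, sSup _, (hsubs (hcomp.sInf_mem hne)).1, (hsubs (hcomp.sSup_mem hne)).2,
        Real.sInf_le_sSup _ hcomp.bddBelow hcomp.bddAbove, fun t ht => ?_⟩
      have ht' : t ∉ tsupport g ∪ tsupport f := fun hm =>
        ht ⟨csInf_le hcomp.bddBelow hm, le_csSup hcomp.bddAbove hm⟩
      rw [mem_union, not_or] at ht'
      simp [ψ, image_eq_zero_of_notMem_tsupport ht'.1, image_eq_zero_of_notMem_tsupport ht'.2]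
    let η : ℝ → ℝ := fun t => ∫ s in (0 : ℝ)..t, ψ s
    have hηd : ∀ t, HasDerivAt η (ψ t) t := fun t => hψc.integral_hasStrictDerivAt 0 t |>.hasDerivAt
    have hηd' : deriv η = ψ := funext fun t => (hηd t).deriv
    have hη : ContDiff ℝ ∞ η :=
      contDiff_infty_iff_deriv.2 ⟨fun t => (hηd t).differentiableAt, by rw [hηd']; exact hψ⟩
    have hηsupp : tsupport η ⊆ Icc a b := by
      refine closure_minimal (fun t ht => ?_) isClosed_Icc
      by_contra hn
      apply ht
      change ∫ s in (0 : ℝ)..t, ψ s = 0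
      rw [mem_Icc, not_and_or, not_le, not_le] at hn
      rcases hn with hn | hn
      · refine (intervalIntegral.integral_congr (g := fun _ => (0 : ℝ)) fun s hs => ?_).trans
          (by simp)
        refine hsub s fun hs' => ?_
        have := (mem_uIcc.1 hs)
        rcases this with h | h <;> linarith [h.1, h.2, hs'.1]
      · rw [← hψ0, intervalIntegral.integral_of_le (by linarith)]
        refine setIntegral_eq_integral_of_forall_compl_eq_zero fun s hs => ?_
        refine hsub s fun hs' => hs ⟨by linarith [hs'.1], by linarith [hs'.2]⟩
    have h0 := h η hη (hηsupp.trans fun t ht => ⟨ha.trans_le ht.1, ht.2.trans_lt hb⟩)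
    rw [hηd'] at h0
    obtain ⟨Cg, hCg⟩ := hg.continuous.bounded_above_of_compact_support hgc
    obtain ⟨Cf, hCf⟩ := hfc.bounded_above_of_compact_support hf2
    have hgcI : IntegrableOn (fun t => g t * c t) (Ioo 0 T) :=
      hc.bdd_mul hg.continuous.aestronglyMeasurable (ae_of_all _ hCg)
    have hfcI : IntegrableOn (fun t => f t * c t) (Ioo 0 T) :=
      hc.bdd_mul hfc.aestronglyMeasurable (ae_of_all _ hCf)
    have e1 : ∫ t in Ioo 0 T, ψ t * c t =
        (∫ t in Ioo 0 T, g t * c t) - J * I⁻¹ * ∫ t in Ioo 0 T, f t * c t := by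
      rw [← integral_const_mul, ← integral_sub hgcI (hfcI.const_mul _)]
      refine integral_congr_ae (ae_of_all _ fun t => ?_)
      simp only [ψ]; ring
    have e2 : ∫ t, g t • (c t - k) = ∫ t in Ioo 0 T, (g t * c t - g t * k) := by
      simp_rw [smul_eq_mul]
      rw [← hout g hgs (fun t => c t - k)]
      refine integral_congr_ae (ae_of_all _ fun t => ?_)
      simp only; ring
    rw [e2, integral_sub hgcI (hgI.integrableOn.mul_const k), integral_mul_const]
    have e3 : ∫ t in Ioo 0 T, g t = J := by
      simpa using hout g hgs (fun _ => 1)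
    rw [e3, hk]
    rw [e1] at h0
    linarith

variable {K : ℝ≥0} {M T : ℝ} {u : ℝ → R3 → R3} {Y : ℝ → R3 ≃ₜ R3}

/-- A transported compact set is compact in space-time. -/
lemma IsFlow.hasCompactSupport_comp_symm (hu : IsRegularVelocity K M u) (hY : IsFlow u Y)
    {S : Set ℝ} (hS : IsCompact S) {φ : R3 → ℝ} (hφ : HasCompactSupport φ) :
    ∃ A : Set (ℝ × R3), IsCompact A ∧ A ⊆ S ×ˢ univ ∧
      ∀ z : ℝ × R3, z.1 ∈ S → φ ((Y z.1).symm z.2) ≠ 0 → z ∈ A := by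
  refine ⟨(fun z : ℝ × R3 => (z.1, Y z.1 z.2)) '' (S ×ˢ tsupport φ),
    (hS.prod hφ.isCompact).image (continuous_fst.prodMk (hY.continuous_uncurry hu)), ?_, ?_⟩
  · rintro _ ⟨z, hz, rfl⟩
    exact ⟨hz.1, trivial⟩
  · intro z hz hne
    exact ⟨(z.1, (Y z.1).symm z.2), ⟨hz, subset_tsupport _ hne⟩, by simp⟩

/-- The weak transport equation tested with `η(t) φ(Y_t⁻¹ x)`. -/
lemma IsFlow.integral_deriv_mul_eq_zero (hu : IsRegularVelocity K M u) (hY : IsFlow u Y)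
    {h : ℝ → R3 → ℝ}
    (hint : LocallyIntegrableOn (fun z : ℝ × R3 => h z.1 z.2) (Icc 0 T ×ˢ univ))
    (htr : IsWeaklyTransported T u h)
    {η : ℝ → ℝ} (hη : ContDiff ℝ ∞ η) (hηs : tsupport η ⊆ Ioo 0 T) {φ : R3 → ℝ} {L : ℝ≥0}
    (hφ : LipschitzWith L φ) (hφc : HasCompactSupport φ) :
    ∫ z in Ioo 0 T ×ˢ (univ : Set R3), deriv η z.1 * φ ((Y z.1).symm z.2) * h z.1 z.2 = 0 := by
  obtain ⟨N₀, hN₀⟩ := hφ.continuous.bounded_above_of_compact_support hφc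
  set Φ : ℝ × R3 → ℝ := fun z => η z.1 * φ ((Y z.1).symm z.2) with hΦ
  set B : ℝ × R3 → ℝ := fun z => deriv η z.1 * φ ((Y z.1).symm z.2) with hB
  have hφY : Continuous fun z : ℝ × R3 => φ ((Y z.1).symm z.2) :=
    hφ.continuous.comp (hY.continuous_symm_uncurry hu)
  have hΦc : Continuous Φ := (hη.continuous.comp continuous_fst).mul hφY
  have hη1 : ContDiff ℝ ∞ (deriv η) := (contDiff_infty_iff_deriv.1 hη).2
  have hBc : Continuous B := (hη1.continuous.comp continuous_fst).mul hφY
  have hηcomp : IsCompact (tsupport η) :=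
    HasCompactSupport.of_support_subset_isCompact isCompact_Icc
      ((subset_tsupport η).trans (hηs.trans Ioo_subset_Icc_self))
  obtain ⟨A, hAc, hAs, hA⟩ := hY.hasCompactSupport_comp_symm hu hηcomp hφc
  have hΦA : tsupport Φ ⊆ A := closure_minimal (fun z hz => hA z
    (subset_tsupport _ (left_ne_zero_of_mul hz)) (right_ne_zero_of_mul hz)) hAc.isClosed
  have hBA : Function.support B ⊆ A := fun z hz => hA z
    (tsupport_deriv_subset (subset_tsupport _ (left_ne_zero_of_mul hz))) (right_ne_zero_of_mul hz)
  have hopen : IsOpen (Ioo 0 T ×ˢ (univ : Set R3)) := isOpen_Ioo.prod isOpen_univ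
  -- The margin `r` keeps the mollified test functions supported in a fixed compact set `S` inside
  -- the open time slab.
  obtain ⟨r, hr, hrs⟩ := hAc.exists_cthickening_subset_open hopen
    (hAs.trans (prod_mono hηs subset_rfl))
  set S := Metric.cthickening r A with hS
  have hSc : IsCompact S := hAc.cthickening
  have hAS : A ⊆ S := Metric.self_subset_cthickening A
  have hSI : S ⊆ Icc 0 T ×ˢ univ := hrs.trans (prod_mono Ioo_subset_Icc_self subset_rfl)
  have hhS : IntegrableOn (fun z : ℝ × R3 => h z.1 z.2) S :=
    hint.integrableOn_compact_subset hSI hSc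
  have hred : ∀ F : ℝ × R3 → ℝ, Function.support F ⊆ S →
      ∫ z in Ioo 0 T ×ˢ (univ : Set R3), F z * h z.1 z.2 = ∫ z in S, F z * h z.1 z.2 := by
    intro F hF
    refine setIntegral_eq_of_subset_of_forall_sdiff_eq_zero hopen.measurableSet hrs fun z hz => ?_
    have : F z = 0 := by
      by_contra hne; exact hz.2 (hF hne)
    rw [this, zero_mul]
  have hFint : ∀ F : ℝ × R3 → ℝ, Continuous F → IntegrableOn (fun z => F z * h z.1 z.2) S := by
    intro F hF
    exact hhS.continuousOn_mul hF.continuousOn hSc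
  rw [hred B (hBA.trans hAS)]
  set I := ∫ z in S, |h z.1 z.2| with hI
  have hI0 : 0 ≤ I := integral_nonneg fun z => abs_nonneg _
  -- The transport equation kills the contribution of the smooth test function. As `h` is merely
  -- integrable on `S`, the replacement must be uniform, and then it costs at most `e * I`.
  have hle : ∀ e > 0, |∫ z in S, B z * h z.1 z.2| ≤ e * I := by
    intro e he
    obtain ⟨ψ, hψ, hψs, hψd⟩ := exists_contDiff_fderiv_sub_le volume hΦc
      (X := fun z => (1, u z.1 z.2)) (B := B)
      (fun e he => hY.uniform_deriv_along hu hη hηs hφ hN₀ e he) he hr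
    have hψS : Function.support ψ ⊆ S := hψs.trans (Metric.cthickening_subset_of_subset r hΦA)
    have hψt : tsupport ψ ⊆ S := closure_minimal hψS hSc.isClosed
    have h0 := htr ψ hψ (HasCompactSupport.of_support_subset_isCompact hSc hψS) (hψt.trans hrs)
    have hDc : Continuous fun z : ℝ × R3 => fderiv ℝ ψ z (1, u z.1 z.2) :=
      (hψ.continuous_fderiv (by simp)).clm_apply
        (continuous_const.prodMk hu.continuous_uncurry)
    have hDs : Function.support (fun z : ℝ × R3 => fderiv ℝ ψ z (1, u z.1 z.2)) ⊆ S := by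
      intro z hz
      refine hψt (support_fderiv_subset ℝ (f := ψ) fun h0 => hz ?_)
      simp only
      rw [h0]; simp
    rw [hred _ hDs] at h0
    have e1 : ∫ z in S, B z * h z.1 z.2 =
        ∫ z in S, (B z - fderiv ℝ ψ z (1, u z.1 z.2)) * h z.1 z.2 := by
      simp_rw [sub_mul]
      rw [integral_sub (hFint B hBc) (hFint _ hDc), h0, sub_zero]
    rw [e1, hI, ← integral_const_mul, ← Real.norm_eq_abs]
    refine norm_integral_le_of_norm_le (hhS.abs.const_mul e) (ae_of_all _ fun z => ?_)
    rw [norm_mul, Real.norm_eq_abs, Real.norm_eq_abs, abs_sub_comm]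
    exact mul_le_mul_of_nonneg_right (hψd z) (abs_nonneg _)
  have : |∫ z in S, B z * h z.1 z.2| ≤ 0 := by
    refine le_of_forall_pos_le_add fun e he => ?_
    have := hle (e / (I + 1)) (by positivity)
    refine this.trans ?_
    rw [zero_add, div_mul_eq_mul_div, div_le_iff₀ (by positivity)]
    nlinarith
  exact abs_eq_zero.1 (le_antisymm this (abs_nonneg _))

lemma volume_restrict_prod (S : Set ℝ) :
    (volume : Measure (ℝ × R3)).restrict (S ×ˢ univ) =
      (volume.restrict S).prod (volume : Measure R3) := by
  rw [Measure.volume_eq_prod, ← Measure.prod_restrict, Measure.restrict_univ]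

/-- Local integrability up to the closed ends of `[0, T]` is used: the transported support over the
whole closed interval is compact. -/
lemma IsFlow.integrable_comp_symm_mul (hu : IsRegularVelocity K M u) (hY : IsFlow u Y)
    {h : ℝ → R3 → ℝ}
    (hint : LocallyIntegrableOn (fun z : ℝ × R3 => h z.1 z.2) (Icc 0 T ×ˢ univ))
    {φ : R3 → ℝ} (hφ : Continuous φ) (hφc : HasCompactSupport φ) :
    Integrable (fun z : ℝ × R3 => φ ((Y z.1).symm z.2) * h z.1 z.2)
      ((volume.restrict (Ioo 0 T)).prod volume) := by
  rw [← volume_restrict_prod]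
  obtain ⟨A, hAc, hAs, hA⟩ := hY.hasCompactSupport_comp_symm hu (isCompact_Icc (a := 0) (b := T)) hφc
  have hφY : Continuous fun z : ℝ × R3 => φ ((Y z.1).symm z.2) :=
    hφ.comp (hY.continuous_symm_uncurry hu)
  have h1 : IntegrableOn (fun z : ℝ × R3 => φ ((Y z.1).symm z.2) * h z.1 z.2) A :=
    (hint.integrableOn_compact_subset hAs hAc).continuousOn_mul hφY.continuousOn hAc
  have hsub : Ioo 0 T ×ˢ (univ : Set R3) ⊆ Icc 0 T ×ˢ univ :=
    prod_mono Ioo_subset_Icc_self subset_rfl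
  refine IntegrableOn.mono_set ?_ hsub
  refine h1.of_forall_sdiff_eq_zero (measurableSet_Icc.prod MeasurableSet.univ) fun z hz => ?_
  by_contra hne
  exact hz.2 (hA z hz.1.1 (left_ne_zero_of_mul hne))

/-- Integrals of a weakly transported function against transported test functions are constant in
time. -/
theorem IsFlow.ae_integral_comp_symm_mul_eq_const (hu : IsRegularVelocity K M u) (hY : IsFlow u Y)
    (hT : 0 < T) {h : ℝ → R3 → ℝ}
    (hint : LocallyIntegrableOn (fun z : ℝ × R3 => h z.1 z.2) (Icc 0 T ×ˢ univ))
    (htr : IsWeaklyTransported T u h) {φ : R3 → ℝ} {L : ℝ≥0}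
    (hφ : LipschitzWith L φ) (hφc : HasCompactSupport φ) :
    ∃ k, ∀ᵐ t ∂volume.restrict (Ioo 0 T), ∫ x, φ ((Y t).symm x) * h t x = k := by
  have hF := hY.integrable_comp_symm_mul hu hint hφ.continuous hφc
  refine ae_eq_const_of_forall_integral_deriv_eq_zero hT hF.integral_prod_left
    fun η hη hηs => ?_
  have h0 := hY.integral_deriv_mul_eq_zero hu hint htr hη hηs hφ hφc
  have hη1 : ContDiff ℝ ∞ (deriv η) := (contDiff_infty_iff_deriv.1 hη).2
  have hηc : HasCompactSupport η :=
    HasCompactSupport.of_support_subset_isCompact isCompact_Icc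
      ((subset_tsupport η).trans (hηs.trans Ioo_subset_Icc_self))
  obtain ⟨N₁, hN₁⟩ := hη1.continuous.bounded_above_of_compact_support hηc.deriv
  have hG : Integrable (fun z : ℝ × R3 => deriv η z.1 * (φ ((Y z.1).symm z.2) * h z.1 z.2))
      ((volume.restrict (Ioo 0 T)).prod volume) :=
    hF.bdd_mul (hη1.continuous.comp continuous_fst).aestronglyMeasurable
      (ae_of_all _ fun z => hN₁ z.1)
  rw [volume_restrict_prod] at h0
  simp_rw [mul_assoc] at h0
  rw [integral_prod _ hG] at h0
  simpa only [integral_const_mul] using h0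

/-! ### Divergence free velocities have volume preserving flows -/

lemma exists_lipschitzWith_of_contDiff {E F : Type*} [NormedAddCommGroup E] [NormedSpace ℝ E]
    [NormedAddCommGroup F] [NormedSpace ℝ F]
    {φ : E → F} (hφ : ContDiff ℝ ∞ φ) (hc : HasCompactSupport φ) :
    ∃ L : ℝ≥0, LipschitzWith L φ :=
  hφ.lipschitzWith_of_hasCompactSupport hc (by simp)

lemma integral_fderiv_apply_eq_zero {E : Type*} [NormedAddCommGroup E] [NormedSpace ℝ E]
    [FiniteDimensional ℝ E] [MeasurableSpace E] [BorelSpace E] (μ : Measure E)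
    [μ.IsAddHaarMeasure] {φ : E → ℝ} (hφ : ContDiff ℝ ∞ φ) (hc : HasCompactSupport φ) (v : E) :
    ∫ x, fderiv ℝ φ x v ∂μ = 0 := by
  have hd : Integrable (fun x => fderiv ℝ φ x v) μ :=
    ((hφ.continuous_fderiv (by simp)).clm_apply continuous_const).integrable_of_hasCompactSupport
      (hc.fderiv_apply ℝ v)
  have hi : Integrable φ μ := hφ.continuous.integrable_of_hasCompactSupport hc
  have := integral_mul_fderiv_eq_neg_fderiv_mul_of_integrable (μ := μ) (f := fun _ : E => (1 : ℝ))
    (g := φ) (v := v) (by simp) (by simpa using hd) (by simpa using hi)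
    (fun x _ => differentiableAt_const _) (fun x _ => hφ.differentiable (by simp) x)
  simpa using this

/-- Two measures that agree on smooth compactly supported functions are equal. -/
lemma measure_eq_of_forall_integral_contDiff_eq {μ ν : Measure R3} [μ.Regular] [ν.Regular]
    (h : ∀ φ : R3 → ℝ, ContDiff ℝ ∞ φ → HasCompactSupport φ → ∫ x, φ x ∂μ = ∫ x, φ x ∂ν) :
    μ = ν := by
  refine Measure.ext_of_integral_eq_on_compactlySupported fun f => ?_
  have hfc : HasCompactSupport f := f.hasCompactSupport
  have hfcont : Continuous f := map_continuous f
  have hS : IsCompact (tsupport f) := hfc.isCompact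
  set C := μ.real (tsupport f) + ν.real (tsupport f) with hC
  have hC0 : 0 ≤ C := by positivity
  have key : ∀ e > 0, |∫ x, f x ∂μ - ∫ x, f x ∂ν| ≤ e * C := by
    intro e he
    obtain ⟨g, hg1, hg2, hg3⟩ := hfcont.exists_contDiff_approx ⊤ (ε := fun _ => e)
      continuous_const (fun _ => he)
    have hgc : HasCompactSupport g := hfc.mono hg3
    have aux : ∀ (κ : Measure R3) [κ.Regular],
        |∫ x, f x ∂κ - ∫ x, g x ∂κ| ≤ e * κ.real (tsupport f) := by
      intro κ _
      rw [← integral_sub (hfcont.integrable_of_hasCompactSupport (μ := κ) hfc)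
        (hg1.continuous.integrable_of_hasCompactSupport (μ := κ) hgc)]
      rw [← setIntegral_eq_integral_of_forall_compl_eq_zero (s := tsupport f)]
      · rw [← Real.norm_eq_abs]
        refine norm_setIntegral_le_of_norm_le_const (μ := κ) hS.measure_lt_top (fun x _ => ?_)
        have := hg2 x
        rw [dist_eq_norm, norm_sub_rev] at this
        exact this.le
      · intro x hx
        have h1 : f x = 0 := image_eq_zero_of_notMem_tsupport hx
        have h2 : g x = 0 := by
          by_contra hne
          exact hx (subset_tsupport _ (hg3 hne))
        rw [h1, h2, sub_zero]
    have h1 := aux μ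
    have h2 := aux ν
    rw [h g hg1 hgc] at h1
    calc _ = |(∫ x, f x ∂μ - ∫ x, g x ∂ν) - (∫ x, f x ∂ν - ∫ x, g x ∂ν)| := by congr 1; ring
      _ ≤ _ := (abs_sub _ _).trans (by rw [hC]; linarith)
  have : |∫ x, f x ∂μ - ∫ x, f x ∂ν| ≤ 0 := by
    refine le_of_forall_pos_le_add fun e he => ?_
    refine (key (e / (C + 1)) (by positivity)).trans ?_
    rw [zero_add, div_mul_eq_mul_div, div_le_iff₀ (by positivity)]
    nlinarith
  exact sub_eq_zero.1 (abs_eq_zero.1 (le_antisymm this (abs_nonneg _)))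

variable {K : ℝ≥0} {M T : ℝ} {u : ℝ → R3 → R3} {Y : ℝ → R3 ≃ₜ R3}

/-- The time derivative of a test function integrates to zero over space-time, and on each time
slice the spatial part is the divergence condition. With the density `1`, Liouville's theorem
becomes a case of the general transport statement. -/
lemma isWeaklyTransported_one (hu : IsRegularVelocity K M u)
    (hdiv : ∀ t ∈ Icc 0 T, IsWeaklyDivFree (u t)) : IsWeaklyTransported T u (fun _ _ => 1) := by
  intro φ hφ hφc hφs
  simp only [mul_one]
  have hfd : Continuous (fderiv ℝ φ) := hφ.continuous_fderiv (by simp)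
  have hsplit : ∀ z : ℝ × R3, fderiv ℝ φ z (1, u z.1 z.2) =
      fderiv ℝ φ z (1, 0) + fderiv ℝ φ z (0, u z.1 z.2) := fun z => by
    rw [← map_add]; simp
  have hc1 : Continuous fun z : ℝ × R3 => fderiv ℝ φ z (1, 0) := hfd.clm_apply continuous_const
  have hc2 : Continuous fun z : ℝ × R3 => fderiv ℝ φ z (0, u z.1 z.2) :=
    hfd.clm_apply (continuous_const.prodMk hu.continuous_uncurry)
  have hs : ∀ z w : ℝ × R3, fderiv ℝ φ z w ≠ 0 → z ∈ tsupport φ := by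
    intro z w hz
    refine support_fderiv_subset ℝ (f := φ) fun h0 => hz ?_
    rw [h0]; simp
  have hcs : ∀ w : ℝ × R3 → ℝ × R3, HasCompactSupport (fun z => fderiv ℝ φ z (w z)) := fun w =>
    HasCompactSupport.of_support_subset_isCompact hφc.isCompact fun z hz => hs z _ hz
  have hi1 := hc1.integrable_of_hasCompactSupport (μ := volume) (hcs fun _ => (1, 0))
  have hi2 := hc2.integrable_of_hasCompactSupport (μ := volume) (hcs fun z => (0, u z.1 z.2))
  rw [setIntegral_eq_integral_of_forall_compl_eq_zero (fun z hz => by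
    by_contra hne; exact hz (hφs (hs z _ hne)))]
  simp_rw [hsplit]
  rw [integral_add hi1 hi2, integral_fderiv_apply_eq_zero volume hφ hφc, zero_add]
  rw [Measure.volume_eq_prod] at hi2 ⊢
  rw [integral_prod _ hi2]
  refine (integral_congr_ae (ae_of_all _ fun t => ?_)).trans (integral_zero _ _)
  simp only
  by_cases ht : t ∈ Icc 0 T
  · have hslice : ContDiff ℝ ∞ fun x => φ (t, x) := hφ.comp (contDiff_const.prodMk contDiff_id)
    have hsc : HasCompactSupport fun x => φ (t, x) := by
      refine HasCompactSupport.of_support_subset_isCompact (hφc.isCompact.image continuous_snd)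
        fun x hx => ⟨(t, x), subset_tsupport _ hx, rfl⟩
    have := hdiv t ht _ hslice hsc
    refine Eq.trans ?_ this
    refine integral_congr_ae (ae_of_all _ fun x => ?_)
    simp only
    have hd : HasFDerivAt (fun x => φ (t, x))
        ((fderiv ℝ φ (t, x)).comp (ContinuousLinearMap.inr ℝ ℝ R3)) x :=
      ((hφ.differentiable (by simp) (t, x)).hasFDerivAt).comp x
        ((hasFDerivAt_const t x).prodMk (hasFDerivAt_id x))
    rw [hd.fderiv]; simp
  · refine (integral_congr_ae (ae_of_all _ fun x => ?_)).trans (integral_zero _ _)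
    by_contra hne
    exact ht (Ioo_subset_Icc_self (hφs (hs (t, x) _ hne)).1)

/-- **Liouville's theorem** for the flow of a Lipschitz, weakly divergence free velocity. -/
theorem IsFlow.measurePreserving (hu : IsRegularVelocity K M u) (hY : IsFlow u Y) (hT : 0 < T)
    (hdiv : ∀ t ∈ Icc 0 T, IsWeaklyDivFree (u t)) {t : ℝ} (ht : t ∈ Icc 0 T) :
    MeasurePreserving (Y t) volume volume := by
  suffices h : Measure.map (Y t).symm (volume : Measure R3) = volume by
    have : MeasurePreserving (Y t).symm volume volume := ⟨(Y t).symm.continuous.measurable, h⟩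
    exact this.symm (e := (Y t).symm.toMeasurableEquiv)
  have : (Measure.map (Y t).symm (volume : Measure R3)).Regular := Measure.Regular.map (Y t).symm
  refine measure_eq_of_forall_integral_contDiff_eq fun φ hφ hφc => ?_
  rw [integral_map (Y t).symm.continuous.aemeasurable hφ.continuous.aestronglyMeasurable]
  obtain ⟨L, hL⟩ := exists_lipschitzWith_of_contDiff hφ hφc
  obtain ⟨k, hk⟩ := hY.ae_integral_comp_symm_mul_eq_const hu hT (h := fun _ _ => 1)
    ((continuous_const.locallyIntegrable).locallyIntegrableOn _)
    (isWeaklyTransported_one hu hdiv) hL hφc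
  simp only [mul_one] at hk
  obtain ⟨A, hAc, hAs, hA⟩ :=
    hY.hasCompactSupport_comp_symm hu (isCompact_Icc (a := 0) (b := T)) hφc
  have hcont : ContinuousOn (fun t => ∫ x, φ ((Y t).symm x)) (Icc 0 T) := by
    refine continuousOn_integral_of_compact_support (k := Prod.snd '' A)
      (hAc.image continuous_snd) ?_ ?_
    · exact (hφ.continuous.comp (hY.continuous_symm_uncurry hu)).continuousOn
    · intro s x hs hx
      by_contra hne
      exact hx ⟨(s, x), hA (s, x) hs hne, rfl⟩
  -- Continuity in time turns constancy for almost every `t` into equality with the value at `t =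
  -- 0`, where the flow is the identity.
  have heq := Measure.eqOn_Icc_of_ae_eq volume hT.ne
    (f := fun t => ∫ x, φ ((Y t).symm x)) (g := fun _ => k)
    (by rw [Measure.restrict_congr_set Ioo_ae_eq_Icc.symm]; exact hk) hcont continuousOn_const
  have h0 := heq (x := 0) ⟨le_rfl, hT.le⟩
  have h1 := heq ht
  simp only at h0 h1
  rw [h1, ← h0]
  congr 1
  ext x
  congr 1
  exact (Y 0).symm_apply_eq.2 (hY.zero x).symm

/-! ### Partial derivatives of smooth functions -/

variable {F : Type*} [NormedAddCommGroup F] [NormedSpace ℝ F]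

/-- The partial derivative `∂_i f`. -/
def pd (i : Fin 3) (f : R3 → F) (x : R3) : F := fderiv ℝ f x (EuclideanSpace.single i 1)

lemma contDiff_pd (i : Fin 3) {f : R3 → F} (hf : ContDiff ℝ ∞ f) : ContDiff ℝ ∞ (pd i f) :=
  (hf.fderiv_right (m := ∞) (by simp)).clm_apply contDiff_const

lemma hasCompactSupport_pd (i : Fin 3) {f : R3 → F} (hf : HasCompactSupport f) :
    HasCompactSupport (pd i f) := hf.fderiv_apply ℝ _

lemma differentiableAt_of_contDiff {f : R3 → F} (hf : ContDiff ℝ ∞ f) (x : R3) :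
    DifferentiableAt ℝ f x := hf.differentiable (by simp) x

lemma pd_add (i : Fin 3) {f g : R3 → F} (hf : ContDiff ℝ ∞ f) (hg : ContDiff ℝ ∞ g) :
    pd i (fun x => f x + g x) = fun x => pd i f x + pd i g x := by
  ext x
  simp only [pd]
  rw [fderiv_fun_add (differentiableAt_of_contDiff hf x) (differentiableAt_of_contDiff hg x)]; rfl

lemma pd_sub (i : Fin 3) {f g : R3 → F} (hf : ContDiff ℝ ∞ f) (hg : ContDiff ℝ ∞ g) :
    pd i (fun x => f x - g x) = fun x => pd i f x - pd i g x := by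
  ext x
  simp only [pd]
  rw [fderiv_fun_sub (differentiableAt_of_contDiff hf x) (differentiableAt_of_contDiff hg x)]; rfl

lemma pd_const_mul (i : Fin 3) (c : ℝ) {f : R3 → ℝ} (hf : ContDiff ℝ ∞ f) :
    pd i (fun x => c * f x) = fun x => c * pd i f x := by
  ext x
  simp only [pd]
  rw [fderiv_const_mul (differentiableAt_of_contDiff hf x)]; rfl

lemma pd_clm_comp {G : Type*} [NormedAddCommGroup G] [NormedSpace ℝ G] (A : F →L[ℝ] G) (i : Fin 3)
    {f : R3 → F} (hf : ContDiff ℝ ∞ f) (x : R3) : pd i (fun y => A (f y)) x = A (pd i f x) := by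
  have := A.hasFDerivAt.comp x (differentiableAt_of_contDiff hf x).hasFDerivAt
  simp only [pd]
  rw [show (fun y => A (f y)) = A ∘ f from rfl, this.fderiv]; rfl

lemma pd_comm (i j : Fin 3) {f : R3 → F} (hf : ContDiff ℝ ∞ f) :
    pd i (pd j f) = pd j (pd i f) := by
  have key : ∀ i j, ∀ x, pd i (pd j f) x = fderiv ℝ (fderiv ℝ f) x (EuclideanSpace.single i 1)
      (EuclideanSpace.single j 1) := by
    intro i j x
    have h : DifferentiableAt ℝ (fderiv ℝ f) x :=
      (hf.fderiv_right (m := ∞) (by simp)).differentiable (by simp) x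
    have := (h.hasFDerivAt.clm_apply (hasFDerivAt_const (EuclideanSpace.single j (1 : ℝ)) x))
    change fderiv ℝ (fun y => fderiv ℝ f y (EuclideanSpace.single j 1)) x _ = _
    rw [this.fderiv]; simp
  ext x
  rw [key, key]
  have hs : IsSymmSndFDerivAt ℝ f x := by
    refine hf.contDiffAt.isSymmSndFDerivAt ?_
    rw [minSmoothness_of_isRCLikeNormedField]
    exact WithTop.coe_le_coe.2 (le_top : (2 : ℕ∞) ≤ ⊤)
  exact hs _ _

lemma laplacian_eq_sum_pd {f : R3 → F} (hf : ContDiff ℝ ∞ f) :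
    Laplacian.laplacian f = fun x => pd 0 (pd 0 f) x + pd 1 (pd 1 f) x + pd 2 (pd 2 f) x := by
  have key : ∀ (i : Fin 3) (x : R3), pd i (pd i f) x =
      fderiv ℝ (fderiv ℝ f) x (EuclideanSpace.single i 1) (EuclideanSpace.single i 1) := by
    intro i x
    have h : DifferentiableAt ℝ (fderiv ℝ f) x :=
      (hf.fderiv_right (m := ∞) (by simp)).differentiable (by simp) x
    have := (h.hasFDerivAt.clm_apply (hasFDerivAt_const (EuclideanSpace.single i (1 : ℝ)) x))
    change fderiv ℝ (fun y => fderiv ℝ f y (EuclideanSpace.single i 1)) x _ = _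
    rw [this.fderiv]; simp
  rw [InnerProductSpace.laplacian_eq_iteratedFDeriv_orthonormalBasis f
    (EuclideanSpace.basisFun (Fin 3) ℝ)]
  ext x
  rw [Fin.sum_univ_three, key, key, key]
  simp [iteratedFDeriv_two_apply]

lemma contDiff_laplacian {f : R3 → F} (hf : ContDiff ℝ ∞ f) :
    ContDiff ℝ ∞ (Laplacian.laplacian f) := by
  rw [laplacian_eq_sum_pd hf]
  exact ((contDiff_pd 0 (contDiff_pd 0 hf)).add (contDiff_pd 1 (contDiff_pd 1 hf))).add
    (contDiff_pd 2 (contDiff_pd 2 hf))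

lemma hasCompactSupport_laplacian {f : R3 → F} (hf : ContDiff ℝ ∞ f) (hc : HasCompactSupport f) :
    HasCompactSupport (Laplacian.laplacian f) := by
  rw [laplacian_eq_sum_pd hf]
  exact ((hasCompactSupport_pd 0 (hasCompactSupport_pd 0 hc)).add
    (hasCompactSupport_pd 1 (hasCompactSupport_pd 1 hc))).add
    (hasCompactSupport_pd 2 (hasCompactSupport_pd 2 hc))

lemma pd_laplacian (i : Fin 3) {f : R3 → F} (hf : ContDiff ℝ ∞ f) :
    pd i (Laplacian.laplacian f) = Laplacian.laplacian (pd i f) := by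
  have h : ∀ j, ContDiff ℝ ∞ (pd j (pd j f)) := fun j => contDiff_pd j (contDiff_pd j hf)
  rw [laplacian_eq_sum_pd hf, laplacian_eq_sum_pd (contDiff_pd i hf),
    pd_add i ((h 0).add (h 1)) (h 2), pd_add i (h 0) (h 1)]
  have : ∀ j, pd i (pd j (pd j f)) = pd j (pd j (pd i f)) := fun j => by
    rw [pd_comm i j (contDiff_pd j hf), pd_comm i j hf]
  rw [this, this, this]

lemma laplacian_clm_comp {G : Type*} [NormedAddCommGroup G] [NormedSpace ℝ G] (A : F →L[ℝ] G)
    {f : R3 → F} (hf : ContDiff ℝ ∞ f) (x : R3) :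
    Laplacian.laplacian (fun y => A (f y)) x = A (Laplacian.laplacian f x) := by
  have hAf : ContDiff ℝ ∞ fun y => A (f y) := A.contDiff.comp hf
  rw [laplacian_eq_sum_pd hf, laplacian_eq_sum_pd hAf]
  have : ∀ i, pd i (pd i fun y => A (f y)) x = A (pd i (pd i f) x) := fun i => by
    have : pd i (fun y => A (f y)) = fun y => A (pd i f y) := funext fun y => pd_clm_comp A i hf y
    rw [this, pd_clm_comp A i (contDiff_pd i hf)]
  simp only [this, map_add]

/-- The coordinate functionals. -/
def coord (i : Fin 3) : R3 →L[ℝ] ℝ := EuclideanSpace.proj i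

@[simp] lemma coord_apply (i : Fin 3) (x : R3) : coord i x = x i := rfl

lemma contDiff_coord (i : Fin 3) {f : R3 → R3} (hf : ContDiff ℝ ∞ f) :
    ContDiff ℝ ∞ fun x => f x i := (coord i).contDiff.comp hf

lemma hasCompactSupport_coord (i : Fin 3) {f : R3 → R3} (hf : HasCompactSupport f) :
    HasCompactSupport fun x => f x i := hf.comp_left (g := fun y : R3 => y i) rfl

lemma pd_apply (i j : Fin 3) {f : R3 → R3} (hf : ContDiff ℝ ∞ f) (x : R3) :
    (pd i f x) j = pd i (fun y => f y j) x := (pd_clm_comp (coord j) i hf x).symm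

lemma laplacian_apply (j : Fin 3) {f : R3 → R3} (hf : ContDiff ℝ ∞ f) (x : R3) :
    (Laplacian.laplacian f x) j = Laplacian.laplacian (fun y => f y j) x :=
  (laplacian_clm_comp (coord j) hf x).symm

lemma curl_eq {f : R3 → R3} (hf : ContDiff ℝ ∞ f) (x : R3) :
    curl f x = !₂[pd 1 (fun y => f y 2) x - pd 2 (fun y => f y 1) x,
      pd 2 (fun y => f y 0) x - pd 0 (fun y => f y 2) x,
      pd 0 (fun y => f y 1) x - pd 1 (fun y => f y 0) x] := by
  simp only [← pd_apply _ _ hf]; rfl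

lemma contDiff_vec {a b c : R3 → ℝ} (ha : ContDiff ℝ ∞ a) (hb : ContDiff ℝ ∞ b)
    (hc : ContDiff ℝ ∞ c) : ContDiff ℝ ∞ fun x => (!₂[a x, b x, c x] : R3) := by
  rw [contDiff_euclidean]
  intro i; fin_cases i <;> simpa

lemma hasCompactSupport_vec {a b c : R3 → ℝ} (ha : HasCompactSupport a) (hb : HasCompactSupport b)
    (hc : HasCompactSupport c) : HasCompactSupport fun x => (!₂[a x, b x, c x] : R3) := by
  refine HasCompactSupport.of_support_subset_isCompact
    ((ha.isCompact.union hb.isCompact).union hc.isCompact) fun x hx => ?_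
  by_contra hn
  simp only [mem_union, not_or] at hn
  apply hx
  apply r3_ext <;> simp [image_eq_zero_of_notMem_tsupport hn.1.1,
    image_eq_zero_of_notMem_tsupport hn.1.2, image_eq_zero_of_notMem_tsupport hn.2]

lemma contDiff_curl {f : R3 → R3} (hf : ContDiff ℝ ∞ f) : ContDiff ℝ ∞ (curl f) := by
  have h : ∀ i j, ContDiff ℝ ∞ (pd i fun y => f y j) := fun i j => contDiff_pd i (contDiff_coord j hf)
  rw [funext (curl_eq hf)]
  exact contDiff_vec ((h _ _).sub (h _ _)) ((h _ _).sub (h _ _)) ((h _ _).sub (h _ _))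

lemma hasCompactSupport_curl {f : R3 → R3} (hf : ContDiff ℝ ∞ f) (hc : HasCompactSupport f) :
    HasCompactSupport (curl f) := by
  have h : ∀ i j, HasCompactSupport (pd i fun y => f y j) := fun i j =>
    hasCompactSupport_pd i (hasCompactSupport_coord j hc)
  rw [funext (curl_eq hf)]
  exact hasCompactSupport_vec ((h _ _).sub (h _ _)) ((h _ _).sub (h _ _)) ((h _ _).sub (h _ _))

lemma laplacian_sub' {f g : R3 → ℝ} (hf : ContDiff ℝ ∞ f) (hg : ContDiff ℝ ∞ g) (x : R3) :
    Laplacian.laplacian (fun y => f y - g y) x =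
      Laplacian.laplacian f x - Laplacian.laplacian g x := by
  rw [laplacian_eq_sum_pd hf, laplacian_eq_sum_pd hg, laplacian_eq_sum_pd (hf.sub hg)]
  have : ∀ i, pd i (pd i fun y => f y - g y) = fun y => pd i (pd i f) y - pd i (pd i g) y :=
    fun i => by rw [pd_sub i hf hg, pd_sub i (contDiff_pd i hf) (contDiff_pd i hg)]
  simp only [this]; ring

/-- The curl commutes with the Laplacian. -/
lemma laplacian_curl {f : R3 → R3} (hf : ContDiff ℝ ∞ f) :
    Laplacian.laplacian (curl f) = curl (Laplacian.laplacian f) := by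
  have hc := fun j => contDiff_coord j hf
  have h : ∀ i j, ContDiff ℝ ∞ (pd i fun y => f y j) := fun i j => contDiff_pd i (hc j)
  have hl : ∀ j, (fun y => Laplacian.laplacian f y j) = Laplacian.laplacian (fun y => f y j) :=
    fun j => funext fun y => laplacian_apply j hf y
  ext x j
  rw [laplacian_apply j (contDiff_curl hf), curl_eq (contDiff_laplacian hf)]
  simp only [hl, pd_laplacian _ (hc _), curl_eq hf]
  fin_cases j <;> simp [laplacian_sub' (h _ _) (h _ _)]

/-- Integration by parts. -/
lemma integral_mul_pd (i : Fin 3) {f g : R3 → ℝ} (hf : ContDiff ℝ ∞ f) (hg : ContDiff ℝ ∞ g)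
    (hc : HasCompactSupport f) : ∫ x, pd i f x * g x = -∫ x, f x * pd i g x := by
  have h1 : Integrable fun x => pd i f x * g x :=
    ((contDiff_pd i hf).continuous.mul hg.continuous).integrable_of_hasCompactSupport
      (hasCompactSupport_pd i hc).mul_right
  have h2 : Integrable fun x => f x * pd i g x :=
    (hf.continuous.mul (contDiff_pd i hg).continuous).integrable_of_hasCompactSupport hc.mul_right
  have h3 : Integrable fun x => f x * g x :=
    (hf.continuous.mul hg.continuous).integrable_of_hasCompactSupport hc.mul_right
  have := integral_mul_fderiv_eq_neg_fderiv_mul_of_integrable (v := EuclideanSpace.single i (1:ℝ))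
    h1 h2 h3 (fun x _ => differentiableAt_of_contDiff hf x)
    (fun x _ => differentiableAt_of_contDiff hg x)
  exact (neg_eq_iff_eq_neg.2 this).symm

/-- `(1 - α² Δ) f`. -/
def helmholtz (α : ℝ) (f : R3 → ℝ) (x : R3) : ℝ := f x - α ^ 2 * Laplacian.laplacian f x

lemma contDiff_helmholtz (α : ℝ) {f : R3 → ℝ} (hf : ContDiff ℝ ∞ f) :
    ContDiff ℝ ∞ (helmholtz α f) := hf.sub (contDiff_const.mul (contDiff_laplacian hf))

lemma hasCompactSupport_helmholtz (α : ℝ) {f : R3 → ℝ} (hf : ContDiff ℝ ∞ f)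
    (hc : HasCompactSupport f) : HasCompactSupport (helmholtz α f) :=
  hc.sub (hasCompactSupport_laplacian hf hc).mul_left

lemma pd_helmholtz (α : ℝ) (i : Fin 3) {f : R3 → ℝ} (hf : ContDiff ℝ ∞ f) :
    pd i (helmholtz α f) = helmholtz α (pd i f) := by
  have h := contDiff_laplacian hf
  have : helmholtz α f = fun x => f x - α ^ 2 * Laplacian.laplacian f x := rfl
  rw [this, pd_sub i hf (contDiff_const.mul h), pd_const_mul i _ h, pd_laplacian i hf]; rfl

/-! ### Smooth regularisation of radial functions -/

/-- The smooth substitute `(|x|² + ε²)^{1/2}` for the norm. -/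
def soft (ε : ℝ) (x : R3) : ℝ := Real.sqrt (‖x‖ ^ 2 + ε ^ 2)

variable {ε : ℝ}

lemma soft_pos (hε : 0 < ε) (x : R3) : 0 < soft ε x := Real.sqrt_pos.2 (by positivity)

lemma soft_sq (ε : ℝ) (x : R3) : soft ε x ^ 2 = ‖x‖ ^ 2 + ε ^ 2 := Real.sq_sqrt (by positivity)

lemma norm_le_soft (ε : ℝ) (x : R3) : ‖x‖ ≤ soft ε x :=
  Real.le_sqrt_of_sq_le (by nlinarith [sq_nonneg ε])

lemma contDiff_soft (hε : 0 < ε) : ContDiff ℝ ∞ (soft ε) := by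
  refine ContDiff.sqrt ((contDiff_norm_sq ℝ).add contDiff_const) fun x => ?_
  positivity

lemma continuous_soft (x : R3) : Continuous fun ε => soft ε x := by unfold soft; fun_prop

lemma soft_zero (x : R3) : soft 0 x = ‖x‖ := by simp [soft, Real.sqrt_sq (norm_nonneg x)]

lemma soft_smul (hε : 0 < ε) (w : R3) : soft ε (ε • w) = ε * soft 1 w := by
  unfold soft
  rw [norm_smul, Real.norm_of_nonneg hε.le, mul_pow, one_pow,
    show ε ^ 2 * ‖w‖ ^ 2 + ε ^ 2 = ε ^ 2 * (‖w‖ ^ 2 + 1) by ring,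
    Real.sqrt_mul (by positivity), Real.sqrt_sq hε.le]

lemma pd_comp_soft (hε : 0 < ε) (i : Fin 3) {g : ℝ → ℝ} {g' : ℝ} (x : R3)
    (hg : HasDerivAt g g' (soft ε x)) :
    pd i (fun y => g (soft ε y)) x = g' * (x i / soft ε x) := by
  have h1 : HasFDerivAt (fun y : R3 => ‖y‖ ^ 2 + ε ^ 2) (2 • innerSL ℝ x) x :=
    (hasStrictFDerivAt_norm_sq x).hasFDerivAt.add_const _
  have h2 := h1.sqrt (by positivity)
  have h3 := hg.comp_hasFDerivAt x h2
  unfold pd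
  rw [show (fun y => g (soft ε y)) = g ∘ soft ε from rfl, h3.fderiv]
  have : innerSL ℝ x (EuclideanSpace.single i (1 : ℝ)) = x i := by
    rw [innerSL_apply_apply, EuclideanSpace.inner_single_right]; simp
  simp only [smul_apply, this, smul_eq_mul, nsmul_eq_mul]
  change g' * (1 / (2 * soft ε x) * (((2 : ℕ) : ℝ) * x i)) = _
  have := (soft_pos hε x).ne'
  push_cast
  field_simp

lemma contDiff_comp_soft (hε : 0 < ε) {g : ℝ → ℝ} (hg : ∀ s, 0 < s → ContDiffAt ℝ ∞ g s) :
    ContDiff ℝ ∞ fun x => g (soft ε x) :=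
  contDiff_iff_contDiffAt.2 fun x =>
    (hg _ (soft_pos hε x)).comp x (contDiff_soft hε).contDiffAt

lemma pd_coord (i : Fin 3) (x : R3) : pd i (fun y => y i) x = 1 := by
  unfold pd
  rw [show (fun y : R3 => y i) = coord i from rfl, (coord i).fderiv]; simp

section radial

variable {g h h' : ℝ → ℝ}

/-- The radial derivative is written as `h s * s`, so that the gradient is `h (soft ε x)` times `x`
and stays smooth at the origin. -/
lemma pd_radial (hε : 0 < ε) (hg' : ∀ s, 0 < s → HasDerivAt g (h s * s) s) (i : Fin 3) (x : R3) :
    pd i (fun y => g (soft ε y)) x = h (soft ε x) * x i := by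
  rw [pd_comp_soft hε i x (hg' _ (soft_pos hε x))]
  have := (soft_pos hε x).ne'
  field_simp

/-- With `s = soft ε x` one has `|x|² = s² - ε²`. The resulting term `-ε² h'(s) / s` is the only
departure from the true radial Laplacian, and for the Yukawa potential it concentrates into a Dirac
mass. -/
lemma laplacian_radial (hε : 0 < ε) (hg : ∀ s, 0 < s → ContDiffAt ℝ ∞ g s)
    (hh : ∀ s, 0 < s → ContDiffAt ℝ ∞ h s)
    (hg' : ∀ s, 0 < s → HasDerivAt g (h s * s) s) (hh' : ∀ s, 0 < s → HasDerivAt h (h' s) s)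
    (x : R3) : Laplacian.laplacian (fun y => g (soft ε y)) x =
      h' (soft ε x) * (soft ε x - ε ^ 2 / soft ε x) + 3 * h (soft ε x) := by
  rw [laplacian_eq_sum_pd (contDiff_comp_soft hε hg)]
  have key : ∀ i, pd i (pd i fun y => g (soft ε y)) x =
      h' (soft ε x) * (x i / soft ε x) * x i + h (soft ε x) := by
    intro i
    rw [show pd i (fun y => g (soft ε y)) = fun y => h (soft ε y) * y i from
      funext fun y => pd_radial hε hg' i y]
    have d1 := differentiableAt_of_contDiff (contDiff_comp_soft hε hh) x
    have d2 := differentiableAt_of_contDiff (contDiff_coord i contDiff_id) x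
    have e1 := pd_comp_soft hε i x (hh' _ (soft_pos hε x))
    have e2 := pd_coord i x
    unfold pd at e1 e2 ⊢
    have := (d1.hasFDerivAt.mul d2.hasFDerivAt).fderiv
    simp only [id] at this e2
    change fderiv ℝ ((fun y => h (soft ε y)) * fun y : R3 => y i) x _ = _
    rw [this]
    simp only [add_apply, smul_apply, e1, e2, smul_eq_mul]
    ring
  simp only [key]
  have hs := (soft_pos hε x).ne'
  have h2 := soft_sq ε x
  rw [norm_sq_r3] at h2
  have h3 : x 0 ^ 2 + x 1 ^ 2 + x 2 ^ 2 = soft ε x ^ 2 - ε ^ 2 := by linarith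
  calc _ = h' (soft ε x) * ((x 0 ^ 2 + x 1 ^ 2 + x 2 ^ 2) / soft ε x) + 3 * h (soft ε x) := by ring
    _ = _ := by rw [h3]; field_simp

end radial

/-- Green's first identity against a smooth function. -/
lemma integral_sum_pd_mul_pd {Φ R : R3 → ℝ} (hΦ : ContDiff ℝ ∞ Φ) (hc : HasCompactSupport Φ)
    (hR : ContDiff ℝ ∞ R) :
    ∫ x, (pd 0 Φ x * pd 0 R x + pd 1 Φ x * pd 1 R x + pd 2 Φ x * pd 2 R x) =
      -∫ x, Φ x * Laplacian.laplacian R x := by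
  have hi : ∀ i, Integrable fun x => pd i Φ x * pd i R x := fun i =>
    ((contDiff_pd i hΦ).continuous.mul (contDiff_pd i hR).continuous).integrable_of_hasCompactSupport
      (hasCompactSupport_pd i hc).mul_right
  have hj : ∀ i, Integrable fun x => Φ x * pd i (pd i R) x := fun i =>
    (hΦ.continuous.mul (contDiff_pd i (contDiff_pd i hR)).continuous).integrable_of_hasCompactSupport
      hc.mul_right
  have h01 : Integrable fun x => pd 0 Φ x * pd 0 R x + pd 1 Φ x * pd 1 R x := (hi 0).add (hi 1)
  have hj01 : Integrable fun x => Φ x * pd 0 (pd 0 R) x + Φ x * pd 1 (pd 1 R) x := (hj 0).add (hj 1)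
  rw [integral_add h01 (hi 2), integral_add (hi 0) (hi 1)]
  have : ∀ i, ∫ x, pd i Φ x * pd i R x = -∫ x, Φ x * pd i (pd i R) x := fun i =>
    integral_mul_pd i hΦ (contDiff_pd i hR) hc
  rw [this, this, this, laplacian_eq_sum_pd hR]
  simp only [mul_add]
  rw [integral_add hj01 (hj 2), integral_add (hj 0) (hj 1)]
  ring

/-- Green's second identity against a smooth function. -/
lemma integral_laplacian_mul {Φ R : R3 → ℝ} (hΦ : ContDiff ℝ ∞ Φ) (hc : HasCompactSupport Φ)
    (hR : ContDiff ℝ ∞ R) :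
    ∫ x, Laplacian.laplacian Φ x * R x = ∫ x, Φ x * Laplacian.laplacian R x := by
  have hi : ∀ i, Integrable fun x => pd i (pd i Φ) x * R x := fun i =>
    ((contDiff_pd i (contDiff_pd i hΦ)).continuous.mul hR.continuous).integrable_of_hasCompactSupport
      (hasCompactSupport_pd i (hasCompactSupport_pd i hc)).mul_right
  have h01 : Integrable fun x => pd 0 (pd 0 Φ) x * R x + pd 1 (pd 1 Φ) x * R x := (hi 0).add (hi 1)
  have hj : ∀ i, Integrable fun x => pd i Φ x * pd i R x := fun i =>
    ((contDiff_pd i hΦ).continuous.mul (contDiff_pd i hR).continuous).integrable_of_hasCompactSupport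
      (hasCompactSupport_pd i hc).mul_right
  have hj01 : Integrable fun x => pd 0 Φ x * pd 0 R x + pd 1 Φ x * pd 1 R x := (hj 0).add (hj 1)
  have h1 := integral_sum_pd_mul_pd hΦ hc hR
  rw [integral_add hj01 (hj 2), integral_add (hj 0) (hj 1)] at h1
  rw [laplacian_eq_sum_pd hΦ]
  simp only [add_mul]
  rw [integral_add h01 (hi 2), integral_add (hi 0) (hi 1)]
  have : ∀ i, ∫ x, pd i (pd i Φ) x * R x = -∫ x, pd i Φ x * pd i R x := fun i =>
    integral_mul_pd i (contDiff_pd i hΦ) hR (hasCompactSupport_pd i hc)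
  rw [this, this, this]
  linarith

/-! ### The radial profiles -/

section profiles

variable {α : ℝ}

lemma contDiffAt_exp_neg_div (α : ℝ) (s : ℝ) : ContDiffAt ℝ ∞ (fun s : ℝ => Real.exp (-s / α)) s := by
  fun_prop

lemma hasDerivAt_exp_neg_div (α : ℝ) (s : ℝ) :
    HasDerivAt (fun s : ℝ => Real.exp (-s / α)) (Real.exp (-s / α) * (-1 / α)) s :=
  ((hasDerivAt_id s).fun_neg.div_const α).exp

/-- `G_α'(s) / s`. -/
def greenSlope (α s : ℝ) : ℝ := ((1 + s / α) * Real.exp (-s / α) - 1) / (4 * Real.pi * s ^ 3)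

lemma greenSlope_eq (hα : 0 < α) {s : ℝ} (hs : 0 < s) : greenSlope α s = profileAlpha α s / s := by
  have := Real.pi_pos
  unfold greenSlope profileAlpha profile
  rw [neg_div]
  field_simp

/-- The derivative is arranged so that `3 h` cancels in `laplacian_radial`: up to the `ε²` term, `-Δ
G_α` is the Yukawa potential divided by `4 π α²`. -/
lemma hasDerivAt_greenSlope (hα : 0 < α) {s : ℝ} (hs : 0 < s) :
    HasDerivAt (greenSlope α)
      (-(Real.exp (-s / α) / (4 * Real.pi * α ^ 2 * s ^ 2)) - 3 * greenSlope α s / s) s := by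
  have hpi := Real.pi_pos
  have h1 : HasDerivAt (fun s : ℝ => 1 + s / α) (1 / α) s :=
    ((hasDerivAt_id s).div_const α).const_add 1
  have h2 := ((h1.fun_mul (hasDerivAt_exp_neg_div α s)).sub_const 1).fun_div
    ((hasDerivAt_pow 3 s).const_mul (4 * Real.pi)) (by positivity)
  refine h2.congr_deriv ?_
  unfold greenSlope
  field_simp
  push_cast
  ring

lemma contDiffAt_greenSlope (α : ℝ) {s : ℝ} (hs : 0 < s) : ContDiffAt ℝ ∞ (greenSlope α) s := by
  have hpi := Real.pi_pos
  unfold greenSlope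
  refine ContDiffAt.div ?_ (by fun_prop) (by positivity)
  fun_prop

lemma hasDerivAt_green (hα : 0 < α) {s : ℝ} (hs : 0 < s) :
    HasDerivAt (fun s => (1 - Real.exp (-s / α)) / (4 * Real.pi * s)) (greenSlope α s * s) s := by
  have hpi := Real.pi_pos
  have h2 := ((hasDerivAt_exp_neg_div α s).const_sub 1).fun_div
    ((hasDerivAt_id s).const_mul (4 * Real.pi)) (by simp only [id]; positivity)
  refine h2.congr_deriv ?_
  unfold greenSlope
  simp only [id]
  field_simp
  ring

lemma contDiffAt_green (α : ℝ) {s : ℝ} (hs : 0 < s) :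
    ContDiffAt ℝ ∞ (fun s => (1 - Real.exp (-s / α)) / (4 * Real.pi * s)) s := by
  have hpi := Real.pi_pos
  refine ContDiffAt.div ?_ (by fun_prop) (by positivity)
  fun_prop

/-- The slope of the Yukawa potential `e^{-s/α}/s`, divided by `s`. -/
def yukawaSlope (α s : ℝ) : ℝ := -(Real.exp (-s / α) * (1 / (α * s ^ 2) + 1 / s ^ 3))

lemma hasDerivAt_yukawa (hα : 0 < α) {s : ℝ} (hs : 0 < s) :
    HasDerivAt (fun s => Real.exp (-s / α) / s) (yukawaSlope α s * s) s := by
  have h2 := (hasDerivAt_exp_neg_div α s).fun_div (hasDerivAt_id s) hs.ne'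
  refine h2.congr_deriv ?_
  unfold yukawaSlope
  simp only [id]
  field_simp
  ring

lemma contDiffAt_yukawa (α : ℝ) {s : ℝ} (hs : 0 < s) :
    ContDiffAt ℝ ∞ (fun s => Real.exp (-s / α) / s) s :=
  ContDiffAt.div (by fun_prop) (by fun_prop) hs.ne'

lemma contDiffAt_yukawaSlope (hα : 0 < α) {s : ℝ} (hs : 0 < s) :
    ContDiffAt ℝ ∞ (yukawaSlope α) s := by
  unfold yukawaSlope
  refine ((contDiffAt_exp_neg_div α s).mul ((ContDiffAt.div (by fun_prop) (by fun_prop) ?_).add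
    (ContDiffAt.div (by fun_prop) (by fun_prop) ?_))).neg <;> positivity

/-- Here `h' s + 3 h = e^{-s/α} / (α² s)`, so `1 - α² Δ` annihilates the regularised Yukawa
potential except for the `ε²` term, which is the approximate Dirac mass of `tendsto_integral_dirac`.
-/
lemma hasDerivAt_yukawaSlope (hα : 0 < α) {s : ℝ} (hs : 0 < s) :
    HasDerivAt (yukawaSlope α)
      (Real.exp (-s / α) * (1 / (α ^ 2 * s ^ 2) + 3 / (α * s ^ 3) + 3 / s ^ 4)) s := by
  have h1 := (hasDerivAt_const s (1 : ℝ)).fun_div ((hasDerivAt_pow 2 s).const_mul α)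
    (by positivity)
  have h2 := (hasDerivAt_const s (1 : ℝ)).fun_div (hasDerivAt_pow 3 s) (by positivity)
  have h3 := ((hasDerivAt_exp_neg_div α s).fun_mul (h1.fun_add h2)).fun_neg
  refine h3.congr_deriv ?_
  field_simp
  push_cast
  ring

end profiles

/-! ### The fundamental solution -/

lemma integrable_soft_pow_four_inv : Integrable fun w : R3 => (soft 1 w ^ 4)⁻¹ := by
  have h := integrable_rpow_neg_one_add_norm_sq (E := R3) (μ := volume) (r := 4) (by norm_num)
  refine h.congr (ae_of_all _ fun w => ?_)
  simp only
  rw [show (-4 / 2 : ℝ) = -2 by norm_num, Real.rpow_neg (by positivity),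
    show soft 1 w ^ 4 = (soft 1 w ^ 2) ^ 2 by ring, soft_sq]
  norm_num
  ring_nf

/-- The total mass of the Dirac profile. In polar coordinates the primitive `(ρ / √(ρ² + 1))³ / 3`
rises from `0` to `1/3`, and the unit sphere has area `4 π`. -/
lemma integral_soft_pow_five_inv : ∫ w : R3, (soft 1 w ^ 5)⁻¹ = 4 * Real.pi / 3 := by
  have h := integral_fun_norm_addHaar (volume : Measure R3)
    (fun ρ : ℝ => (Real.sqrt (ρ ^ 2 + 1) ^ 5)⁻¹)
  have e0 : ∫ w : R3, (soft 1 w ^ 5)⁻¹ = ∫ w : R3, (Real.sqrt (‖w‖ ^ 2 + 1) ^ 5)⁻¹ := by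
    simp [soft]
  rw [e0, h]
  have hfin : Module.finrank ℝ R3 = 3 := by simp
  have hvol : (volume : Measure R3).real (Metric.ball 0 1) = Real.pi * 4 / 3 := by
    rw [Measure.real, EuclideanSpace.volume_ball_fin_three]
    simp; positivity
  rw [hfin, hvol]
  have hderiv : ∀ ρ : ℝ, HasDerivAt (fun ρ => (ρ / Real.sqrt (ρ ^ 2 + 1)) ^ 3 / 3)
      (ρ ^ 2 * (Real.sqrt (ρ ^ 2 + 1) ^ 5)⁻¹) ρ := by
    intro ρ
    have hpos : 0 < ρ ^ 2 + 1 := by positivity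
    have hs := Real.sqrt_pos.2 hpos
    have hsq := Real.sq_sqrt hpos.le
    have h1 : HasDerivAt (fun ρ : ℝ => Real.sqrt (ρ ^ 2 + 1)) (ρ / Real.sqrt (ρ ^ 2 + 1)) ρ := by
      refine (((hasDerivAt_pow 2 ρ).add_const 1).sqrt hpos.ne').congr_deriv ?_
      field_simp; push_cast; ring
    refine ((((hasDerivAt_id ρ).fun_div h1 hs.ne').fun_pow 3).div_const 3).congr_deriv ?_
    simp only [id]
    generalize Real.sqrt (ρ ^ 2 + 1) = s at hs hsq ⊢
    have hs' := hs.ne'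
    have h2 : s - ρ * (ρ / s) = 1 / s := by
      field_simp; linarith
    rw [one_mul, h2]
    simp only [Nat.cast_ofNat, show 3 - 1 = 2 from rfl]
    field_simp
  have hlim : Tendsto (fun ρ : ℝ => (ρ / Real.sqrt (ρ ^ 2 + 1)) ^ 3 / 3) atTop (𝓝 (1 / 3)) := by
    have h1 : Tendsto (fun ρ : ℝ => (Real.sqrt (1 + (ρ ^ 2)⁻¹))⁻¹) atTop (𝓝 1) := by
      have h0 : Tendsto (fun ρ : ℝ => (ρ ^ 2)⁻¹) atTop (𝓝 0) :=
        (tendsto_pow_atTop two_ne_zero).inv_tendsto_atTop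
      have := ((h0.const_add 1).sqrt).inv₀ (by simp)
      simpa using this
    have h2 : Tendsto (fun ρ : ℝ => ρ / Real.sqrt (ρ ^ 2 + 1)) atTop (𝓝 1) := by
      refine h1.congr' ?_
      filter_upwards [eventually_gt_atTop 0] with ρ hρ
      have : ρ ^ 2 + 1 = ρ ^ 2 * (1 + (ρ ^ 2)⁻¹) := by field_simp
      rw [this, Real.sqrt_mul (by positivity), Real.sqrt_sq hρ.le]
      have := (Real.sqrt_pos.2 (show 0 < 1 + (ρ ^ 2)⁻¹ by positivity)).ne'
      field_simp
    simpa using (h2.pow 3).div_const 3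
  have hI := integral_Ioi_of_hasDerivAt_of_nonneg (a := 0)
    (hderiv 0).continuousAt.continuousWithinAt (fun x _ => hderiv x)
    (fun x _ => by positivity) hlim
  simp only [smul_eq_mul, nsmul_eq_mul, show 3 - 1 = 2 from rfl]
  rw [hI]
  simp; ring

/-- The regularised Dirac mass. -/
lemma tendsto_integral_dirac {α : ℝ} (hα : 0 < α) {f : R3 → ℝ} (hf : Continuous f)
    (hc : HasCompactSupport f) :
    Tendsto (fun ε : ℝ => ∫ x, f x * (α ^ 2 * (ε ^ 2 * (Real.exp (-soft ε x / α) *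
      (1 / (α ^ 2 * soft ε x ^ 3) + 3 / (α * soft ε x ^ 4) + 3 / soft ε x ^ 5)))))
      (𝓝[>] 0) (𝓝 (4 * Real.pi * α ^ 2 * f 0)) := by
  obtain ⟨N, hN⟩ := hf.bounded_above_of_compact_support hc
  have hN0 : 0 ≤ N := (norm_nonneg _).trans (hN 0)
  -- Substituting `x = ε w` fixes the profile; in the limit only the term with `soft 1 w ^ 5`
  -- survives.
  have hscale : ∀ᶠ ε : ℝ in 𝓝[>] 0, ∫ w, f (ε • w) * (Real.exp (-(ε * soft 1 w) / α) *
      (ε ^ 2 / soft 1 w ^ 3 + 3 * α * ε / soft 1 w ^ 4 + 3 * α ^ 2 / soft 1 w ^ 5)) =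
      ∫ x, f x * (α ^ 2 * (ε ^ 2 * (Real.exp (-soft ε x / α) *
      (1 / (α ^ 2 * soft ε x ^ 3) + 3 / (α * soft ε x ^ 4) + 3 / soft ε x ^ 5)))) := by
    filter_upwards [self_mem_nhdsWithin] with ε hε
    have hε : 0 < ε := hε
    have h := Measure.integral_comp_smul (volume : Measure R3)
      (fun x => f x * (α ^ 2 * (ε ^ 2 * (Real.exp (-soft ε x / α) *
      (1 / (α ^ 2 * soft ε x ^ 3) + 3 / (α * soft ε x ^ 4) + 3 / soft ε x ^ 5))))) ε
    have hfin : Module.finrank ℝ R3 = 3 := by simp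
    rw [hfin, abs_of_pos (by positivity), smul_eq_mul, eq_inv_mul_iff_mul_eq₀ (by positivity)] at h
    rw [← h, ← integral_const_mul]
    refine integral_congr_ae (ae_of_all _ fun w => ?_)
    simp only
    rw [soft_smul hε]
    have := soft_pos one_pos w
    field_simp
  refine Tendsto.congr' hscale ?_
  have hlim : ∫ w, f 0 * (3 * α ^ 2 * (soft 1 w ^ 5)⁻¹) = 4 * Real.pi * α ^ 2 * f 0 := by
    rw [integral_const_mul, integral_const_mul, integral_soft_pow_five_inv]; ring
  rw [← hlim]
  have hs1 : Continuous (soft 1) := (contDiff_soft one_pos).continuous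
  refine tendsto_integral_filter_of_dominated_convergence
    (fun w => N * (α + 3 * α + 3 * α ^ 2) * (soft 1 w ^ 4)⁻¹) ?_ ?_
    (integrable_soft_pow_four_inv.const_mul _) ?_
  · refine Eventually.of_forall fun ε => Continuous.aestronglyMeasurable ?_
    have h1 : ∀ w : R3, soft 1 w ≠ 0 := fun w => (soft_pos one_pos w).ne'
    refine (hf.comp (continuous_const_smul ε)).mul (Continuous.mul (by fun_prop) ?_)
    refine ((continuous_const.div (hs1.pow 3) fun w => pow_ne_zero _ (h1 w)).add
      (continuous_const.div (hs1.pow 4) fun w => pow_ne_zero _ (h1 w))).add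
      (continuous_const.div (hs1.pow 5) fun w => pow_ne_zero _ (h1 w))
  · filter_upwards [self_mem_nhdsWithin, nhdsWithin_le_nhds (gt_mem_nhds (one_pos (α := ℝ)))]
      with ε hε hε1
    have hε : 0 < ε := hε
    refine ae_of_all _ fun w => ?_
    have hs := soft_pos one_pos w
    have hs1 : 1 ≤ soft 1 w := by
      have := soft_sq 1 w
      nlinarith [sq_nonneg ‖w‖]
    set s := soft 1 w
    set E := Real.exp (-(ε * s) / α) with hE
    have hE0 : 0 < E := Real.exp_pos _
    have hE1 : E ≤ 1 := by
      rw [hE, Real.exp_le_one_iff, neg_div]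
      have : 0 < ε * s / α := by positivity
      linarith
    -- From `τ e^{-τ} ≤ 1`. It trades exponential decay for one more power of `s`: `s⁻³` is not
    -- integrable on space, but `s⁻⁴` is.
    have hE2 : E * (ε * s) ≤ α := by
      have h1 := Real.add_one_le_exp (ε * s / α)
      have h2 : E * Real.exp (ε * s / α) = 1 := by
        rw [hE, ← Real.exp_add, neg_div, neg_add_cancel, Real.exp_zero]
      have h3 : E * (ε * s / α) ≤ 1 := by nlinarith
      rw [← mul_div_assoc, div_le_one hα] at h3
      exact h3
    rw [norm_mul, Real.norm_of_nonneg (r := E * _) (by positivity), mul_assoc N]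
    have hf := hN (ε • w)
    refine mul_le_mul hf ?_ (by positivity) hN0
    have a1 : E * (ε ^ 2 / s ^ 3) ≤ α * (s ^ 4)⁻¹ := by
      have : E * (ε ^ 2 / s ^ 3) = (E * (ε * s)) * ε * (s ^ 4)⁻¹ := by field_simp
      rw [this]
      gcongr
      nlinarith
    have a2 : E * (3 * α * ε / s ^ 4) ≤ 3 * α * (s ^ 4)⁻¹ := by
      have : E * (3 * α * ε / s ^ 4) = (E * ε) * (3 * α * (s ^ 4)⁻¹) := by field_simp
      rw [this]
      have : E * ε ≤ 1 := by nlinarith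
      exact mul_le_of_le_one_left (by positivity) this
    have a3 : E * (3 * α ^ 2 / s ^ 5) ≤ 3 * α ^ 2 * (s ^ 4)⁻¹ := by
      have : E * (3 * α ^ 2 / s ^ 5) = (E * s⁻¹) * (3 * α ^ 2 * (s ^ 4)⁻¹) := by field_simp
      rw [this]
      have h3 : s⁻¹ ≤ 1 := inv_le_one_of_one_le₀ hs1
      have : E * s⁻¹ ≤ 1 := mul_le_one₀ hE1 (by positivity) h3
      exact mul_le_of_le_one_left (by positivity) this
    nlinarith
  · refine ae_of_all _ fun w => ?_
    have hcont : Continuous fun ε : ℝ => f (ε • w) * (Real.exp (-(ε * soft 1 w) / α) *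
      (ε ^ 2 / soft 1 w ^ 3 + 3 * α * ε / soft 1 w ^ 4 + 3 * α ^ 2 / soft 1 w ^ 5)) := by
      have : Continuous fun ε : ℝ => f (ε • w) := hf.comp (by fun_prop)
      fun_prop
    have := (hcont.tendsto 0).mono_left (nhdsWithin_le_nhds (s := Ioi 0))
    refine this.trans_eq ?_
    simp [div_eq_mul_inv]

lemma integrable_mul_inv_norm {Φ : R3 → ℝ} (hΦ : Continuous Φ) (hc : HasCompactSupport Φ) :
    Integrable fun x => |Φ x| * ‖x‖⁻¹ := by
  have hc2 : HasCompactSupport fun x => |Φ x| ^ (2 : ℝ) :=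
    hc.comp_left (g := fun y : ℝ => |y| ^ (2 : ℝ)) (by simp)
  have := (integrable_mul_inv_norm_sub (p := 2) (by norm_num)
    (hΦ.integrable_of_hasCompactSupport hc)
    ((hΦ.abs.rpow_const fun x => Or.inr (by norm_num)).integrable_of_hasCompactSupport hc2)
    (MeasurePreserving.id volume) 0).1
  simpa using this

lemma gradGreen_apply (α : ℝ) (x : R3) (i : Fin 3) :
    gradGreen α x i = profileAlpha α ‖x‖ / ‖x‖ * x i := by simp [gradGreen]

/-- The regularised kernel converges to the kernel, with a bound. -/
lemma abs_greenSlope_mul_le {α ε : ℝ} (hα : 0 < α) (hε : 0 < ε) (x : R3) (i : Fin 3) :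
    |greenSlope α (soft ε x) * x i| ≤ kernelBound α := by
  have hs := soft_pos hε x
  rw [greenSlope_eq hα hs, abs_mul, abs_div, abs_of_pos hs, div_mul_eq_mul_div,
    div_le_iff₀ hs]
  exact mul_le_mul (abs_profileAlpha_le hα hs.le)
    ((abs_apply_le_norm x i).trans (norm_le_soft ε x)) (abs_nonneg _) (kernelBound_pos hα).le

lemma tendsto_greenSlope_mul {α : ℝ} (hα : 0 < α) {x : R3} (hx : x ≠ 0) (i : Fin 3) :
    Tendsto (fun ε => greenSlope α (soft ε x) * x i) (𝓝[>] 0) (𝓝 (gradGreen α x i)) := by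
  have hx' := norm_pos_iff.2 hx
  rw [gradGreen_apply, ← greenSlope_eq hα hx']
  have h1 : ContinuousAt (greenSlope α) (soft 0 x) := by
    rw [soft_zero]; exact (hasDerivAt_greenSlope hα hx').continuousAt
  have h2 : Tendsto (fun ε => greenSlope α (soft ε x)) (𝓝 0) (𝓝 (greenSlope α (soft 0 x))) :=
    h1.tendsto.comp ((continuous_soft x).tendsto 0)
  rw [soft_zero] at h2
  exact (h2.mono_left nhdsWithin_le_nhds).mul_const _

lemma tendsto_integral_mul_greenSlope {α : ℝ} (hα : 0 < α) {Ψ : R3 → ℝ} (hΨ : Continuous Ψ)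
    (hc : HasCompactSupport Ψ) (i : Fin 3) :
    Tendsto (fun ε => ∫ x, Ψ x * (greenSlope α (soft ε x) * x i)) (𝓝[>] 0)
      (𝓝 (∫ x, Ψ x * gradGreen α x i)) := by
  refine tendsto_integral_filter_of_dominated_convergence (fun x => |Ψ x| * kernelBound α) ?_ ?_
    ((hΨ.integrable_of_hasCompactSupport hc).abs.mul_const _) ?_
  · filter_upwards [self_mem_nhdsWithin] with ε hε
    have h := (contDiff_comp_soft hε fun s hs => contDiffAt_greenSlope α hs).continuous
    exact (hΨ.mul (h.mul (coord i).continuous)).aestronglyMeasurable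
  · filter_upwards [self_mem_nhdsWithin] with ε hε
    refine ae_of_all _ fun x => ?_
    rw [norm_mul, Real.norm_eq_abs, Real.norm_eq_abs]
    exact mul_le_mul_of_nonneg_left (abs_greenSlope_mul_le hα hε x i) (abs_nonneg _)
  · filter_upwards [Measure.ae_ne volume 0] with x hx
    exact (tendsto_greenSlope_mul hα hx i).const_mul _

lemma pd_green {α ε : ℝ} (hα : 0 < α) (hε : 0 < ε) (i : Fin 3) :
    pd i (fun y : R3 => (1 - Real.exp (-soft ε y / α)) / (4 * Real.pi * soft ε y)) =
      fun x => greenSlope α (soft ε x) * x i :=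
  funext fun x => pd_radial hε (fun _ hs => hasDerivAt_green hα hs) i x

/-- The kernel is curl free. -/
lemma integral_pd_mul_gradGreen_comm {α : ℝ} (hα : 0 < α) {φ : R3 → ℝ} (hφ : ContDiff ℝ ∞ φ)
    (hc : HasCompactSupport φ) (i j : Fin 3) :
    ∫ x, pd i φ x * gradGreen α x j = ∫ x, pd j φ x * gradGreen α x i := by
  -- For `ε > 0` the regularised kernel is the gradient of a smooth function, so the symmetry of
  -- second derivatives applies; then `ε → 0`.
  have h := fun i j => tendsto_integral_mul_greenSlope hα (contDiff_pd i hφ).continuous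
    (hasCompactSupport_pd i hc) j
  refine tendsto_nhds_unique (h i j) ((h j i).congr' ?_)
  filter_upwards [self_mem_nhdsWithin] with ε hε
  have hR : ContDiff ℝ ∞ fun y : R3 => (1 - Real.exp (-soft ε y / α)) / (4 * Real.pi * soft ε y) :=
    contDiff_comp_soft hε fun s hs => contDiffAt_green α hs
  have key : ∀ i j, ∫ x, pd i φ x * (greenSlope α (soft ε x) * x j) =
      -∫ x, φ x * pd i (pd j fun y : R3 =>
        (1 - Real.exp (-soft ε y / α)) / (4 * Real.pi * soft ε y)) x := fun i j => by
    rw [← integral_mul_pd i hφ (contDiff_pd j hR) hc]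
    rw [pd_green hα hε j]
  rw [key, key, pd_comm i j hR]

/-- `(1 - α² Δ)(-Δ) G_α = δ`, where `∇ G_α = gradGreen α`. -/
theorem integral_pd_helmholtz_mul_gradGreen {α : ℝ} (hα : 0 < α) {f : R3 → ℝ}
    (hf : ContDiff ℝ ∞ f) (hc : HasCompactSupport f) :
    ∫ x, (pd 0 (helmholtz α f) x * gradGreen α x 0 + pd 1 (helmholtz α f) x * gradGreen α x 1 +
      pd 2 (helmholtz α f) x * gradGreen α x 2) = f 0 := by
  have hpi := Real.pi_pos
  set Φ := helmholtz α f with hΦdef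
  have hΦ : ContDiff ℝ ∞ Φ := contDiff_helmholtz α hf
  have hΦc : HasCompactSupport Φ := hasCompactSupport_helmholtz α hf hc
  have hC := (kernelBound_pos hα).le
  -- the error term
  have hE : Tendsto (fun ε : ℝ => ∫ x, Φ x * (ε ^ 2 * (Real.exp (-soft ε x / α) /
      (4 * Real.pi * α ^ 2 * soft ε x ^ 3) + 3 * greenSlope α (soft ε x) / soft ε x ^ 2)))
      (𝓝[>] 0) (𝓝 0) := by
    have hbd : ∀ ε : ℝ, 0 < ε → ∀ x : R3, |ε ^ 2 * (Real.exp (-soft ε x / α) /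
        (4 * Real.pi * α ^ 2 * soft ε x ^ 3) + 3 * greenSlope α (soft ε x) / soft ε x ^ 2)| ≤
        ε ^ 2 / soft ε x ^ 3 * (1 / (4 * Real.pi * α ^ 2) + 3 * kernelBound α) := by
      intro ε hε x
      have hs := soft_pos hε x
      have h1 : Real.exp (-soft ε x / α) ≤ 1 := by
        rw [Real.exp_le_one_iff, neg_div]
        have : 0 < soft ε x / α := by positivity
        linarith
      have h2 := abs_profileAlpha_le hα hs.le
      rw [greenSlope_eq hα hs]
      have e : ε ^ 2 * (Real.exp (-soft ε x / α) / (4 * Real.pi * α ^ 2 * soft ε x ^ 3) +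
          3 * (profileAlpha α (soft ε x) / soft ε x) / soft ε x ^ 2) =
          ε ^ 2 / soft ε x ^ 3 * (Real.exp (-soft ε x / α) / (4 * Real.pi * α ^ 2) +
            3 * profileAlpha α (soft ε x)) := by field_simp
      rw [e, abs_mul, abs_of_nonneg (by positivity)]
      gcongr
      refine (abs_add_le _ _).trans (add_le_add ?_ ?_)
      · rw [abs_of_pos (by positivity)]; gcongr
      · rw [abs_mul, abs_of_pos (by norm_num : (0 : ℝ) < 3)]; gcongr
    have hlim0 : (0 : ℝ) = ∫ x : R3, (0 : ℝ) := by simp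
    suffices h : Tendsto (fun ε : ℝ => ∫ x, Φ x * (ε ^ 2 * (Real.exp (-soft ε x / α) /
      (4 * Real.pi * α ^ 2 * soft ε x ^ 3) + 3 * greenSlope α (soft ε x) / soft ε x ^ 2)))
      (𝓝[>] 0) (𝓝 (∫ x : R3, (0 : ℝ))) by rwa [← hlim0] at h
    refine tendsto_integral_filter_of_dominated_convergence
      (fun x => (1 / (4 * Real.pi * α ^ 2) + 3 * kernelBound α) * (|Φ x| * ‖x‖⁻¹)) ?_ ?_
      ((integrable_mul_inv_norm hΦ.continuous hΦc).const_mul _) ?_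
    · filter_upwards [self_mem_nhdsWithin] with ε hε
      have hs : Continuous (soft ε) := (contDiff_soft hε).continuous
      have h := (contDiff_comp_soft hε fun s hs => contDiffAt_greenSlope α hs).continuous
      have hp : ∀ x, soft ε x ≠ 0 := fun x => (soft_pos hε x).ne'
      refine (hΦ.continuous.mul (continuous_const.mul (Continuous.add ?_ ?_))).aestronglyMeasurable
      · exact Continuous.div (by fun_prop) (by fun_prop) fun x => by
          have := soft_pos hε x; positivity
      · exact Continuous.div (by fun_prop) (by fun_prop) fun x => pow_ne_zero _ (hp x)
    · filter_upwards [self_mem_nhdsWithin] with ε hε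
      filter_upwards [Measure.ae_ne volume 0] with x hx
      have hx' := norm_pos_iff.2 hx
      have hs := soft_pos hε x
      rw [norm_mul, Real.norm_eq_abs, Real.norm_eq_abs]
      -- A dominating function independent of `ε`, integrable against the bounded, compactly
      -- supported `Φ`.
      have h1 : ε ^ 2 / soft ε x ^ 3 ≤ ‖x‖⁻¹ := by
        have h2 : ε ^ 2 ≤ soft ε x ^ 2 := by rw [soft_sq]; nlinarith [sq_nonneg ‖x‖]
        rw [div_le_iff₀ (by positivity), inv_mul_eq_div, le_div_iff₀ hx']
        calc ε ^ 2 * ‖x‖ ≤ soft ε x ^ 2 * soft ε x := by gcongr; exact norm_le_soft ε x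
          _ = _ := by ring
      calc _ ≤ |Φ x| * (‖x‖⁻¹ * (1 / (4 * Real.pi * α ^ 2) + 3 * kernelBound α)) := by
            gcongr; exact (hbd ε hε x).trans (by gcongr)
        _ = _ := by ring
    · filter_upwards [Measure.ae_ne volume 0] with x hx
      have hx' := norm_pos_iff.2 hx
      have h1 : Tendsto (fun ε : ℝ => ε ^ 2 / soft ε x ^ 3 *
          (1 / (4 * Real.pi * α ^ 2) + 3 * kernelBound α)) (𝓝[>] 0) (𝓝 0) := by
        have h2 : ContinuousAt (fun ε : ℝ => ε ^ 2 / soft ε x ^ 3 *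
          (1 / (4 * Real.pi * α ^ 2) + 3 * kernelBound α)) 0 := by
          refine ContinuousAt.mul (ContinuousAt.div (by fun_prop)
            ((continuous_soft x).pow 3).continuousAt ?_) continuousAt_const
          rw [soft_zero]; positivity
        have := h2.tendsto.mono_left (nhdsWithin_le_nhds (s := Ioi 0))
        simpa using this
      have h3 := squeeze_zero_norm' (f := fun ε : ℝ => ε ^ 2 * (Real.exp (-soft ε x / α) /
        (4 * Real.pi * α ^ 2 * soft ε x ^ 3) + 3 * greenSlope α (soft ε x) / soft ε x ^ 2))
        (by filter_upwards [self_mem_nhdsWithin] with ε hε using hbd ε hε x) h1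
      simpa using h3.const_mul (Φ x)
  have hD := (tendsto_integral_dirac hα hf.continuous hc).div_const (4 * Real.pi * α ^ 2)
  have hsum := hD.sub hE
  rw [sub_zero, mul_div_cancel_left₀ _ (by positivity)] at hsum
  have hA := ((tendsto_integral_mul_greenSlope hα (contDiff_pd 0 hΦ).continuous
    (hasCompactSupport_pd 0 hΦc) 0).add (tendsto_integral_mul_greenSlope hα
    (contDiff_pd 1 hΦ).continuous (hasCompactSupport_pd 1 hΦc) 1)).add
    (tendsto_integral_mul_greenSlope hα (contDiff_pd 2 hΦ).continuous
    (hasCompactSupport_pd 2 hΦc) 2)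
  have hgi : ∀ i, Integrable fun x => pd i Φ x * gradGreen α x i := fun i => by
    refine (((contDiff_pd i hΦ).continuous.integrable_of_hasCompactSupport
      (hasCompactSupport_pd i hΦc)).abs.mul_const (kernelBound α)).mono' ?_ (ae_of_all _ fun x => ?_)
    · exact (contDiff_pd i hΦ).continuous.aestronglyMeasurable.mul
        ((coord i).continuous.measurable.comp (measurable_gradGreen α)).aestronglyMeasurable
    · rw [norm_mul]
      exact mul_le_mul_of_nonneg_left ((abs_apply_le_norm _ i).trans (norm_gradGreen_le hα x))
        (norm_nonneg _)
  have hg01 : Integrable fun x => pd 0 Φ x * gradGreen α x 0 + pd 1 Φ x * gradGreen α x 1 :=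
    (hgi 0).add (hgi 1)
  rw [integral_add hg01 (hgi 2), integral_add (hgi 0) (hgi 1)]
  refine tendsto_nhds_unique hA (hsum.congr' ?_)
  filter_upwards [self_mem_nhdsWithin] with ε hε
  have hε : 0 < ε := hε
  have hR1 : ContDiff ℝ ∞ fun y : R3 => (1 - Real.exp (-soft ε y / α)) / (4 * Real.pi * soft ε y) :=
    contDiff_comp_soft hε fun s hs => contDiffAt_green α hs
  have hR2 : ContDiff ℝ ∞ fun y : R3 => Real.exp (-soft ε y / α) / soft ε y :=
    contDiff_comp_soft hε fun s hs => contDiffAt_yukawa α hs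
  have hL1 := laplacian_radial hε (fun s hs => contDiffAt_green α hs)
    (fun s hs => contDiffAt_greenSlope α hs) (fun s hs => hasDerivAt_green hα hs)
    (fun s hs => hasDerivAt_greenSlope hα hs)
  have hL2 := laplacian_radial hε (fun s hs => contDiffAt_yukawa α hs)
    (fun s hs => contDiffAt_yukawaSlope hα hs) (fun s hs => hasDerivAt_yukawa hα hs)
    (fun s hs => hasDerivAt_yukawaSlope hα hs)
  have hG := integral_sum_pd_mul_pd hΦ hΦc hR1
  rw [pd_green hα hε, pd_green hα hε, pd_green hα hε] at hG
  have hsi : ∀ i, Integrable fun x => pd i Φ x * (greenSlope α (soft ε x) * x i) := fun i =>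
    ((contDiff_pd i hΦ).continuous.mul
      ((contDiff_comp_soft hε fun s hs => contDiffAt_greenSlope α hs).continuous.mul
        (coord i).continuous)).integrable_of_hasCompactSupport (hasCompactSupport_pd i hΦc).mul_right
  have hs01 : Integrable fun x => pd 0 Φ x * (greenSlope α (soft ε x) * x 0) +
      pd 1 Φ x * (greenSlope α (soft ε x) * x 1) := (hsi 0).add (hsi 1)
  rw [integral_add hs01 (hsi 2), integral_add (hsi 0) (hsi 1)] at hG
  rw [hG]
  -- Green's second identity moves `1 - α² Δ` from `f` to the Yukawa potential, leaving only the
  -- approximate Dirac mass.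
  have hGr := integral_laplacian_mul hf hc hR2
  have hfi : ∀ {a b : R3 → ℝ}, ContDiff ℝ ∞ a → HasCompactSupport a → ContDiff ℝ ∞ b →
      Integrable fun x => a x * b x := fun ha hac hb =>
    (ha.continuous.mul hb.continuous).integrable_of_hasCompactSupport hac.mul_right
  have hΦR : ∫ x, Φ x * (Real.exp (-soft ε x / α) / soft ε x) =
      ∫ x, f x * (α ^ 2 * (ε ^ 2 * (Real.exp (-soft ε x / α) *
      (1 / (α ^ 2 * soft ε x ^ 3) + 3 / (α * soft ε x ^ 4) + 3 / soft ε x ^ 5)))) := by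
    have e1 : ∀ x, Φ x * (Real.exp (-soft ε x / α) / soft ε x) =
        f x * (Real.exp (-soft ε x / α) / soft ε x) -
          α ^ 2 * (Laplacian.laplacian f x * (Real.exp (-soft ε x / α) / soft ε x)) := fun x => by
      simp only [hΦdef, helmholtz]; ring
    simp_rw [e1]
    rw [integral_sub (hfi hf hc hR2) ((hfi (contDiff_laplacian hf)
      (hasCompactSupport_laplacian hf hc) hR2).const_mul _), integral_const_mul, hGr,
      ← integral_const_mul, ← integral_sub (hfi hf hc hR2)
        ((hfi hf hc (contDiff_laplacian hR2)).const_mul _)]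
    refine integral_congr_ae (ae_of_all _ fun x => ?_)
    simp only
    rw [hL2]
    have hs := soft_pos hε x
    unfold yukawaSlope
    field_simp
    ring
  rw [← hΦR, ← integral_div, ← integral_sub, ← integral_neg]
  · refine integral_congr_ae (ae_of_all _ fun x => ?_)
    simp only
    rw [hL1]
    have hs := soft_pos hε x
    field_simp
    ring
  · exact (hfi hΦ hΦc hR2).div_const _
  · have hs : Continuous (soft ε) := (contDiff_soft hε).continuous
    have h := (contDiff_comp_soft hε fun s hs => contDiffAt_greenSlope α hs).continuous
    have hp : ∀ x, soft ε x ≠ 0 := fun x => (soft_pos hε x).ne'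
    refine (hΦ.continuous.mul (continuous_const.mul
      (Continuous.add ?_ ?_))).integrable_of_hasCompactSupport hΦc.mul_right
    · exact Continuous.div (by fun_prop) (by fun_prop) fun x => by
        have := soft_pos hε x; positivity
    · exact Continuous.div (by fun_prop) (by fun_prop) fun x => pow_ne_zero _ (hp x)

/-! ### Convolution with the kernel -/

section

variable {α : ℝ} {q : R3 → R3}

/-- `K_α * q`. -/
def kernelConv (α : ℝ) (q : R3 → R3) (x : R3) : R3 := ∫ y, cross (gradGreen α (x - y)) (q y)

lemma inner_cross (a b c : R3) : ⟪c, cross a b⟫ = ⟪b, cross c a⟫ := by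
  simp only [inner_r3, cross_zero_apply, cross_one_apply, cross_two_apply]; ring

lemma norm_cross_gradGreen_le (hα : 0 < α) (x b : R3) :
    ‖cross (gradGreen α x) b‖ ≤ kernelBound α * ‖b‖ :=
  (norm_cross_le _ _).trans
    (mul_le_mul_of_nonneg_right (norm_gradGreen_le hα x) (norm_nonneg _))

lemma norm_cross_gradGreen_le' (hα : 0 < α) (x b : R3) :
    ‖cross b (gradGreen α x)‖ ≤ kernelBound α * ‖b‖ :=
  (norm_cross_le _ _).trans <| (mul_le_mul_of_nonneg_left (norm_gradGreen_le hα x)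
    (norm_nonneg _)).trans_eq (mul_comm _ _)

lemma integrable_cross_gradGreen (hα : 0 < α) (hq : Integrable q) (x : R3) :
    Integrable fun y => cross (gradGreen α (x - y)) (q y) := by
  refine (hq.norm.const_mul (kernelBound α)).mono' ?_
    (ae_of_all _ fun y => norm_cross_gradGreen_le hα _ _)
  exact crossL.aestronglyMeasurable_comp₂
    ((measurable_gradGreen α).comp (measurable_const.sub measurable_id)).aestronglyMeasurable
    hq.aestronglyMeasurable

lemma isKernelConvolution_kernelConv (hα : 0 < α) (hq : Integrable q) :
    IsKernelConvolution α q (kernelConv α q) :=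
  fun x => ⟨integrable_cross_gradGreen hα hq x, rfl⟩

lemma kernelConv_congr {q' : R3 → R3} (h : q =ᵐ[volume] q') :
    kernelConv α q = kernelConv α q' := by
  funext x
  refine integral_congr_ae ?_
  filter_upwards [h] with y hy
  rw [hy]

lemma tendsto_kernelConv_cocompact (hα : 0 < α) (hq : Integrable q) :
    Tendsto (kernelConv α q) (cocompact R3) (𝓝 0) := by
  have : (cocompact R3).IsCountablyGenerated := by
    rw [← Metric.cobounded_eq_cocompact, ← comap_norm_atTop]; infer_instance
  have h0 : (0 : R3) = ∫ y : R3, (0 : R3) := by simp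
  suffices h : Tendsto (kernelConv α q) (cocompact R3) (𝓝 (∫ y : R3, (0 : R3))) by rwa [← h0] at h
  refine tendsto_integral_filter_of_dominated_convergence (fun y => kernelBound α * ‖q y‖)
    (Eventually.of_forall fun x => (integrable_cross_gradGreen hα hq x).aestronglyMeasurable)
    (Eventually.of_forall fun x => ae_of_all _ fun y => norm_cross_gradGreen_le hα _ _)
    (hq.norm.const_mul _) (ae_of_all _ fun y => ?_)
  have h1 : Tendsto (fun x : R3 => gradGreen α (x - y)) (cocompact R3) (𝓝 0) :=
    (tendsto_gradGreen_cocompact hα).comp (Homeomorph.subRight y).isClosedEmbedding.tendsto_cocompact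
  have h2 : Continuous fun a : R3 => crossL a (q y) := by fun_prop
  have h3 := (h2.tendsto 0).comp h1
  rwa [show crossL 0 (q y) = 0 by simp] at h3

/-- The adjoint of convolution with the kernel. -/
lemma integral_inner_kernelConv (hα : 0 < α) (hq : Integrable q) {Ψ : R3 → R3}
    (hΨ : Continuous Ψ) (hc : HasCompactSupport Ψ) :
    ∫ x, ⟪Ψ x, kernelConv α q x⟫ = ∫ y, ⟪q y, ∫ x, cross (Ψ (x + y)) (gradGreen α x)⟫ := by
  have hΨi := hΨ.integrable_of_hasCompactSupport (μ := volume) hc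
  have e1 : ∀ x, ⟪Ψ x, kernelConv α q x⟫ = ∫ y, ⟪Ψ x, cross (gradGreen α (x - y)) (q y)⟫ :=
    fun x => (integral_inner (integrable_cross_gradGreen hα hq x) _).symm
  simp_rw [e1]
  have hm : AEStronglyMeasurable (fun z : R3 × R3 => cross (gradGreen α (z.1 - z.2)) (q z.2))
      (volume.prod volume) :=
    crossL.aestronglyMeasurable_comp₂
      ((measurable_gradGreen α).comp (measurable_fst.sub measurable_snd)).aestronglyMeasurable
      (hq.aestronglyMeasurable.comp_snd)
  rw [integral_integral_swap]
  · refine integral_congr_ae (ae_of_all _ fun y => ?_)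
    simp only
    simp_rw [inner_cross (gradGreen α _) (q y)]
    have hi : Integrable fun x => cross (Ψ x) (gradGreen α (x - y)) := by
      refine (hΨi.norm.const_mul (kernelBound α)).mono' ?_
        (ae_of_all _ fun x => norm_cross_gradGreen_le' hα _ _)
      exact crossL.aestronglyMeasurable_comp₂ hΨ.aestronglyMeasurable
        ((measurable_gradGreen α).comp (measurable_id.sub measurable_const)).aestronglyMeasurable
    rw [integral_inner hi, ← integral_add_right_eq_self _ y]
    simp
  · refine ((hΨi.norm.mul_prod hq.norm).const_mul (kernelBound α)).mono' ?_
      (ae_of_all _ fun z => ?_)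
    · exact (hΨ.aestronglyMeasurable.comp_fst).inner hm
    · simp only [Function.uncurry]
      refine (norm_inner_le_norm _ _).trans ?_
      calc _ ≤ ‖Ψ z.1‖ * (kernelBound α * ‖q z.2‖) := by
            gcongr; exact norm_cross_gradGreen_le hα _ _
        _ = _ := by ring

lemma integrable_comp_add_mul_gradGreen (hα : 0 < α) {f : R3 → ℝ} (hf : Continuous f)
    (hc : HasCompactSupport f) (y : R3) (k : Fin 3) :
    Integrable fun x => f (x + y) * gradGreen α x k := by
  have hi : Integrable fun x => f (x + y) :=
    (hf.integrable_of_hasCompactSupport hc).comp_add_right y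
  refine (hi.abs.mul_const (kernelBound α)).mono' ?_ (ae_of_all _ fun x => ?_)
  · exact hi.aestronglyMeasurable.mul
      ((coord k).continuous.measurable.comp (measurable_gradGreen α)).aestronglyMeasurable
  · rw [norm_mul]
    exact mul_le_mul_of_nonneg_left ((abs_apply_le_norm _ k).trans (norm_gradGreen_le hα x))
      (norm_nonneg _)

lemma integral_cross_apply (hα : 0 < α) {Ψ : R3 → R3} (hΨ : Continuous Ψ)
    (hc : HasCompactSupport Ψ) (y : R3) :
    ∫ x, cross (Ψ (x + y)) (gradGreen α x) =
      !₂[(∫ x, Ψ (x + y) 1 * gradGreen α x 2) - ∫ x, Ψ (x + y) 2 * gradGreen α x 1,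
        (∫ x, Ψ (x + y) 2 * gradGreen α x 0) - ∫ x, Ψ (x + y) 0 * gradGreen α x 2,
        (∫ x, Ψ (x + y) 0 * gradGreen α x 1) - ∫ x, Ψ (x + y) 1 * gradGreen α x 0] := by
  have hΨi := (hΨ.integrable_of_hasCompactSupport (μ := volume) hc).comp_add_right y
  have hi : Integrable fun x => cross (Ψ (x + y)) (gradGreen α x) := by
    refine (hΨi.norm.const_mul (kernelBound α)).mono' ?_
      (ae_of_all _ fun x => norm_cross_gradGreen_le' hα _ _)
    exact crossL.aestronglyMeasurable_comp₂ hΨi.aestronglyMeasurable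
      (measurable_gradGreen α).aestronglyMeasurable
  have hij : ∀ i k, Integrable fun x => Ψ (x + y) i * gradGreen α x k := fun i k =>
    integrable_comp_add_mul_gradGreen hα (f := fun x => Ψ x i) ((coord i).continuous.comp hΨ)
      (hasCompactSupport_coord i hc) y k
  have e : ∀ j, (∫ x, cross (Ψ (x + y)) (gradGreen α x)) j =
      ∫ x, cross (Ψ (x + y)) (gradGreen α x) j := fun j =>
    ((coord j).integral_comp_comm hi).symm
  apply r3_ext <;> rw [e] <;> simp [integral_sub (hij _ _) (hij _ _)]

lemma pd_comp_add (i : Fin 3) (f : R3 → ℝ) (y x : R3) :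
    pd i (fun z => f (z + y)) x = pd i f (x + y) := by
  simp only [pd]; rw [fderiv_comp_add_right]

lemma inner_gradient (φ : R3 → ℝ) (x v : R3) :
    fderiv ℝ φ x v = ⟪(!₂[pd 0 φ x, pd 1 φ x, pd 2 φ x] : R3), v⟫ := by
  have : v = v 0 • EuclideanSpace.single 0 1 + v 1 • EuclideanSpace.single 1 1 +
      v 2 • EuclideanSpace.single 2 (1 : ℝ) := by
    apply r3_ext <;> simp
  conv_lhs => rw [this]
  simp only [map_add, map_smul, smul_eq_mul, inner_r3, pd]
  simp; ring

lemma hasCompactSupport_comp_add {f : R3 → ℝ} (hc : HasCompactSupport f) (y : R3) :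
    HasCompactSupport fun z => f (z + y) :=
  hc.comp_homeomorph (Homeomorph.addRight y)

/-- `K_α * q` is divergence free. -/
lemma isWeaklyDivFree_kernelConv (hα : 0 < α) (hq : Integrable q) :
    IsWeaklyDivFree (kernelConv α q) := by
  intro φ hφ hc
  simp_rw [inner_gradient φ]
  have hΨ := contDiff_vec (contDiff_pd 0 hφ) (contDiff_pd 1 hφ) (contDiff_pd 2 hφ)
  have hΨc := hasCompactSupport_vec (hasCompactSupport_pd 0 hc) (hasCompactSupport_pd 1 hc)
    (hasCompactSupport_pd 2 hc)
  rw [integral_inner_kernelConv hα hq hΨ.continuous hΨc]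
  refine integral_eq_zero_of_ae (ae_of_all _ fun y => ?_)
  simp only [Pi.zero_apply]
  rw [integral_cross_apply hα hΨ.continuous hΨc]
  -- The inner integral is that of `∇φ × ∇G_α`, whose components cancel in pairs because the kernel
  -- is curl free.
  have h : ∀ i j, ∫ x, pd i φ (x + y) * gradGreen α x j =
      ∫ x, pd j φ (x + y) * gradGreen α x i := fun i j => by
    have := integral_pd_mul_gradGreen_comm hα (φ := fun z => φ (z + y))
      (hφ.comp (contDiff_id.add contDiff_const)) (hasCompactSupport_comp_add hc y) i j
    simpa only [pd_comp_add] using this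
  simp [inner_r3, h 1 2, h 2 0, h 0 1]

end

/-! ### Reflections in planes containing the axis -/

/-- The reflection in the plane containing the axis and `(cos (β / 2), sin (β / 2), 0)`, as a linear
map. -/
def mirrorMap (β : ℝ) : R3 →ₗ[ℝ] R3 where
  toFun x := !₂[Real.cos β * x 0 + Real.sin β * x 1, Real.sin β * x 0 - Real.cos β * x 1, x 2]
  map_add' a b := by apply r3_ext <;> simp <;> ring
  map_smul' c a := by apply r3_ext <;> simp <;> ring

/-- The reflection in the plane containing the axis and `(cos (β / 2), sin (β / 2), 0)`. -/
def mirror (β : ℝ) : R3 ≃ₗᵢ[ℝ] R3 where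
  toLinearEquiv := LinearEquiv.ofInvolutive (mirrorMap β) fun x => by
    have h := Real.sin_sq_add_cos_sq β
    apply r3_ext <;> simp only [mirrorMap, LinearMap.coe_mk, AddHom.coe_mk] <;> simp
    · linear_combination x 0 * h
    · linear_combination x 1 * h
  norm_map' x := by
    have h := Real.sin_sq_add_cos_sq β
    refine (sq_eq_sq₀ (norm_nonneg _) (norm_nonneg _)).1 ?_
    rw [norm_sq_r3, norm_sq_r3]
    simp [mirrorMap]
    linear_combination (x 0 ^ 2 + x 1 ^ 2) * h

section mirror

variable (β : ℝ) (x a b : R3)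

@[simp] lemma mirror_zero_apply : mirror β x 0 = Real.cos β * x 0 + Real.sin β * x 1 := by
  simp [mirror, mirrorMap]

@[simp] lemma mirror_one_apply : mirror β x 1 = Real.sin β * x 0 - Real.cos β * x 1 := by
  simp [mirror, mirrorMap]

@[simp] lemma mirror_two_apply : mirror β x 2 = x 2 := by simp [mirror, mirrorMap]

@[simp] lemma mirror_mirror : mirror β (mirror β x) = x := by
  have h := Real.sin_sq_add_cos_sq β
  apply r3_ext <;> simp
  · linear_combination x 0 * h
  · linear_combination x 1 * h

lemma cross_mirror : cross (mirror β a) (mirror β b) = -mirror β (cross a b) := by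
  have h := Real.sin_sq_add_cos_sq β
  apply r3_ext <;> simp
  · ring
  · ring
  · linear_combination (-(a 0 * b 1 - a 1 * b 0)) * h

lemma angular_mirror : angular (mirror β x) = -mirror β (angular x) := by
  apply r3_ext <;> simp <;> ring

lemma cylRadius_mirror : cylRadius (mirror β x) = cylRadius x := by
  rw [← norm_angular, angular_mirror, norm_neg, LinearIsometryEquiv.norm_map, norm_angular]

lemma eTheta_mirror : eTheta (mirror β x) = -mirror β (eTheta x) := by
  rw [eTheta_eq, eTheta_eq, cylRadius_mirror, angular_mirror, map_smul, smul_neg]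

lemma inner_mirror : ⟪mirror β a, mirror β b⟫ = ⟪a, b⟫ := (mirror β).inner_map_map a b

lemma gradGreen_mirror (α : ℝ) : gradGreen α (mirror β x) = mirror β (gradGreen α x) := by
  rw [gradGreen, gradGreen, LinearIsometryEquiv.norm_map, map_smul]

lemma measurePreserving_mirror : MeasurePreserving (mirror β) volume volume :=
  (mirror β).measurePreserving

end mirror

lemma exists_polar (x : R3) :
    ∃ θ, x 0 = cylRadius x * Real.cos θ ∧ x 1 = cylRadius x * Real.sin θ := by
  set z : ℂ := ⟨x 0, x 1⟩
  have hz : cylRadius x = ‖z‖ := by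
    rw [Complex.norm_eq_sqrt_sq_add_sq]; rfl
  rw [hz]
  exact ⟨z.arg, (Complex.norm_mul_cos_arg z).symm, (Complex.norm_mul_sin_arg z).symm⟩

/-- Every point is the reflection of a point of one meridian half-plane, so a field commuting with
reflections is determined by its values there. -/
lemma exists_mirror_eq (x : R3) : ∃ β, mirror β !₂[cylRadius x, 0, x 2] = x := by
  obtain ⟨θ, h0, h1⟩ := exists_polar x
  refine ⟨θ, ?_⟩
  apply r3_ext <;> simp
  · rw [mul_comm]; exact h0.symm
  · rw [mul_comm]; exact h1.symm

/-- Every point off the axis is fixed by a reflection whose `-1`-eigenspace is spanned by `e_θ`. -/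
lemma exists_mirror_fix {x : R3} (hx : cylRadius x ≠ 0) : ∃ β, mirror β x = x ∧
    ∀ a, mirror β a = -a → a = ⟪a, eTheta x⟫ • eTheta x := by
  obtain ⟨θ, h0, h1⟩ := exists_polar x
  have h2 := Real.sin_sq_add_cos_sq θ
  -- The plane of `mirror β` is at the angle `β / 2`, so the plane through `x` requires `2 * θ`.
  refine ⟨2 * θ, ?_, fun a ha => ?_⟩
  · apply r3_ext <;> simp [Real.cos_two_mul, Real.sin_two_mul]
    · rw [h0, h1]; linear_combination 2 * cylRadius x * Real.cos θ * h2
    · rw [h0, h1]; ring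
  · have e0 : eTheta x 0 = Real.sin θ := by simp [eTheta, h1, hx]
    have e1 : eTheta x 1 = -Real.cos θ := by simp [eTheta, h0, hx, neg_div]
    have e2 : eTheta x 2 = 0 := by simp [eTheta]
    have a0 := congrArg (fun v : R3 => v 0) ha
    have a1 := congrArg (fun v : R3 => v 1) ha
    have a2 := congrArg (fun v : R3 => v 2) ha
    simp only [mirror_zero_apply, mirror_one_apply, mirror_two_apply, Real.cos_two_mul,
      Real.sin_two_mul, PiLp.neg_apply] at a0 a1 a2
    have hk : Real.cos θ * a 0 + Real.sin θ * a 1 = 0 := by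
      linear_combination Real.cos θ / 2 * a0 + Real.sin θ / 2 * a1 -
        (Real.cos θ * a 0 + Real.sin θ * a 1) * h2 + Real.sin θ * a 1 * h2
    apply r3_ext <;> simp only [PiLp.smul_apply, smul_eq_mul, inner_r3, e0, e1, e2]
    · linear_combination Real.cos θ * hk - a 0 * h2
    · linear_combination Real.sin θ * hk - a 1 * h2
    · linarith

/-- Products of two reflections give the rotations about the axis, and the reflection fixing a point
excludes a swirl component there. The equivariant form passes directly through curls, convolutions
and flows. -/
theorem isAxisymmetricNoSwirl_iff {w : R3 → R3} :
    IsAxisymmetricNoSwirl w ↔ ∀ β x, w (mirror β x) = mirror β (w x) := by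
  constructor
  · rintro ⟨a, b, h⟩ β x
    rw [h, h x, cylRadius_mirror, mirror_two_apply, map_add, map_smul, map_smul]
    congr 2
    · apply r3_ext <;> simp [eR, cylRadius_mirror] <;> ring
    · apply r3_ext <;> simp [eZ]
  · intro h
    refine ⟨fun r z => w !₂[r, 0, z] 0, fun r z => w !₂[r, 0, z] 2, fun x => ?_⟩
    obtain ⟨β, hβ⟩ := exists_mirror_eq x
    set p : R3 := !₂[cylRadius x, 0, x 2] with hp
    -- `p` lies in the plane of `mirror 0`, which changes the sign of this component.
    have h1 : w p 1 = 0 := by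
      have e : mirror 0 p = p := by apply r3_ext <;> simp [hp]
      have := congrArg (fun v : R3 => v 1) (h 0 p)
      simp only [e, mirror_one_apply, Real.sin_zero, Real.cos_zero] at this
      linarith
    have hw : w x = mirror β (w p) := by rw [← h, hβ]
    have hβ0 := congrArg (fun v : R3 => v 0) hβ
    have hβ1 := congrArg (fun v : R3 => v 1) hβ
    simp [hp] at hβ0 hβ1
    rw [hw]
    change _ = w p 0 • eR x + w p 2 • eZ
    by_cases hr : cylRadius x = 0
    -- On the axis `eR` is zero by convention, so the horizontal part must vanish; a second
    -- reflection fixing `p` shows this.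
    · have h0 : w p 0 = 0 := by
        have e : mirror Real.pi p = p := by apply r3_ext <;> simp [hp, hr]
        have := congrArg (fun v : R3 => v 0) (h Real.pi p)
        simp only [e, mirror_zero_apply, Real.sin_pi, Real.cos_pi] at this
        linarith
      apply r3_ext <;> simp [h0, h1, eR, eZ]
    · apply r3_ext <;> simp [h1, eR, eZ, ← hβ0, ← hβ1, hr] <;> ring

/-! ### The vorticity of `K_α * q` -/

/-- `mirror 0 ∘ mirror β` is the rotation by `-β` about the axis, and `angular` is its infinitesimal
generator. -/
lemma mirror_zero_mirror_hasDerivAt (x : R3) (β : ℝ) :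
    HasDerivAt (fun β => mirror 0 (mirror β x)) (angular (mirror 0 (mirror β x))) β := by
  have h : (fun β => mirror 0 (mirror β x)) = fun β => (Real.cos β * x 0 + Real.sin β * x 1) •
      EuclideanSpace.single 0 (1 : ℝ) + (-(Real.sin β * x 0 - Real.cos β * x 1)) •
      EuclideanSpace.single 1 (1 : ℝ) + x 2 • EuclideanSpace.single 2 (1 : ℝ) := by
    funext β
    apply r3_ext <;> simp
  rw [h]
  have h1 : HasDerivAt (fun β => Real.cos β * x 0 + Real.sin β * x 1)
      (-Real.sin β * x 0 + Real.cos β * x 1) β :=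
    ((Real.hasDerivAt_cos β).mul_const _).fun_add ((Real.hasDerivAt_sin β).mul_const _)
  have h2 : HasDerivAt (fun β => -(Real.sin β * x 0 - Real.cos β * x 1))
      (-(Real.cos β * x 0 - -Real.sin β * x 1)) β :=
    (((Real.hasDerivAt_sin β).mul_const _).fun_sub ((Real.hasDerivAt_cos β).mul_const _)).fun_neg
  refine (((h1.smul_const _).fun_add (h2.smul_const _)).add_const _).congr_deriv ?_
  apply r3_ext <;> simp
  ring

section vorticity

variable {α : ℝ}

/-- `∫ Φ(x + y) ∂_k G_α(x) dx`. -/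
def kernelPotential (α : ℝ) (k : Fin 3) (Φ : R3 → ℝ) (y : R3) : ℝ :=
  ∫ x, Φ (x + y) * gradGreen α x k

/-- Differentiation under the integral. The derivative falls on the test function, so boundedness of
the kernel is enough. -/
lemma hasFDerivAt_kernelPotential (hα : 0 < α) (k : Fin 3) {Φ : R3 → ℝ} (hΦ : ContDiff ℝ ∞ Φ)
    (hc : HasCompactSupport Φ) (y : R3) : ∃ D : R3 →L[ℝ] ℝ,
    HasFDerivAt (kernelPotential α k Φ) D y ∧
      (∀ v, D v = ∫ x, fderiv ℝ Φ (x + y) v * gradGreen α x k) ∧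
      ‖D‖ ≤ kernelBound α * ∫ x, ‖fderiv ℝ Φ x‖ := by
  obtain ⟨N, hN⟩ := (hΦ.continuous_fderiv (by simp)).bounded_above_of_compact_support
    (hc.fderiv (𝕜 := ℝ))
  have hN0 : 0 ≤ N := (norm_nonneg _).trans (hN 0)
  -- Thickening by `1` gives one integrable majorant for all `z` in the unit ball around `y`.
  have hK : IsCompact (Metric.cthickening 1 (tsupport Φ)) := hc.isCompact.cthickening
  have hgm : AEStronglyMeasurable (fun x => gradGreen α x k) volume :=
    ((coord k).continuous.measurable.comp (measurable_gradGreen α)).aestronglyMeasurable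
  have hgb : ∀ x, ‖gradGreen α x k‖ ≤ kernelBound α := fun x =>
    (abs_apply_le_norm _ k).trans (norm_gradGreen_le hα x)
  have hC := (kernelBound_pos hα).le
  have hfd : ∀ z, Continuous fun x => fderiv ℝ Φ (x + z) := fun z =>
    (hΦ.continuous_fderiv (by simp)).comp (continuous_id.add continuous_const)
  have hF' : ∀ z, AEStronglyMeasurable (fun x => gradGreen α x k • fderiv ℝ Φ (x + z)) volume :=
    fun z => hgm.smul (hfd z).aestronglyMeasurable
  have hbound : ∀ z, dist z y < 1 → ∀ x, ‖gradGreen α x k • fderiv ℝ Φ (x + z)‖ ≤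
      (Metric.cthickening 1 (tsupport Φ)).indicator (fun _ => kernelBound α * N) (x + y) := by
    intro z hz x
    by_cases hx : x + y ∈ Metric.cthickening 1 (tsupport Φ)
    · rw [indicator_of_mem hx, norm_smul]
      exact mul_le_mul (hgb x) (hN _) (norm_nonneg _) hC
    · rw [indicator_of_notMem hx]
      have : x + z ∉ tsupport Φ := fun h => hx <| Metric.mem_cthickening_of_dist_le _ _ _ _ h <| by
        rw [dist_add_left, dist_comm]; exact hz.le
      rw [fderiv_of_notMem_tsupport ℝ this]; simp
  have hbi : Integrable fun x =>
      (Metric.cthickening 1 (tsupport Φ)).indicator (fun _ => kernelBound α * N) (x + y) := by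
    have : Integrable ((Metric.cthickening 1 (tsupport Φ)).indicator
        (fun _ : R3 => kernelBound α * N)) :=
      (integrable_indicator_iff hK.measurableSet).2 (integrableOn_const hK.measure_lt_top.ne)
    exact this.comp_add_right y
  have hball : ∀ z ∈ Metric.ball y 1, dist z y < 1 := fun z hz => hz
  have key := hasFDerivAt_integral_of_dominated_of_fderiv_le (μ := volume)
    (F := fun z x => Φ (x + z) * gradGreen α x k)
    (F' := fun z x => gradGreen α x k • fderiv ℝ Φ (x + z)) (x₀ := y)
    (Metric.ball_mem_nhds y one_pos)
    (Eventually.of_forall fun z =>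
      (integrable_comp_add_mul_gradGreen hα hΦ.continuous hc z k).aestronglyMeasurable)
    (integrable_comp_add_mul_gradGreen hα hΦ.continuous hc y k)
    (hF' y) (ae_of_all _ fun x z hz => hbound z (hball z hz) x) hbi
    (ae_of_all _ fun x z _ => by
      have := (differentiableAt_of_contDiff hΦ (x + z)).hasFDerivAt.comp z
        ((hasFDerivAt_id z).const_add x)
      have h2 := this.mul_const (gradGreen α x k)
      simpa using h2)
  have hi : Integrable fun x => gradGreen α x k • fderiv ℝ Φ (x + y) :=
    hbi.mono' (hF' y) (ae_of_all _ fun x => hbound y (by simp) x)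
  refine ⟨_, key, fun v => ?_, ?_⟩
  swap
  · have hfi : Integrable fun x => ‖fderiv ℝ Φ x‖ :=
      ((hΦ.continuous_fderiv (by simp)).integrable_of_hasCompactSupport (hc.fderiv (𝕜 := ℝ))).norm
    refine (norm_integral_le_of_norm_le ((hfi.comp_add_right y).const_mul (kernelBound α))
      (ae_of_all _ fun x => ?_)).trans_eq ?_
    · rw [norm_smul]
      exact mul_le_mul_of_nonneg_right (hgb x) (norm_nonneg _)
    · rw [integral_const_mul, integral_add_right_eq_self fun x => ‖fderiv ℝ Φ x‖]
  rw [ContinuousLinearMap.integral_apply hi]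
  refine integral_congr_ae (ae_of_all _ fun x => ?_)
  simp [mul_comm]

lemma abs_kernelPotential_le (hα : 0 < α) (k : Fin 3) {Φ : R3 → ℝ} (hΦ : Continuous Φ)
    (hc : HasCompactSupport Φ) (y : R3) :
    |kernelPotential α k Φ y| ≤ kernelBound α * ∫ x, |Φ x| := by
  have hi := (hΦ.integrable_of_hasCompactSupport (μ := volume) hc)
  rw [← Real.norm_eq_abs]
  refine (norm_integral_le_of_norm_le ((hi.comp_add_right y).abs.const_mul (kernelBound α))
    (ae_of_all _ fun x => ?_)).trans_eq ?_
  · rw [norm_mul, mul_comm]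
    exact mul_le_mul_of_nonneg_right ((abs_apply_le_norm _ k).trans (norm_gradGreen_le hα x))
      (norm_nonneg _)
  · rw [integral_const_mul, integral_add_right_eq_self fun x => |Φ x|]

lemma integrable_mul_fderiv_angular {ζ : R3 → ℝ} (hζ : Integrable ζ)
    {B : ℝ} (hB : ∀ᵐ z, ζ z ≠ 0 → ‖z‖ ≤ B) {χ : R3 → ℝ}
    {N : ℝ} (hN : ∀ x, ‖fderiv ℝ χ x‖ ≤ N) :
    Integrable fun x => ζ x * fderiv ℝ χ x (angular x) := by
  have hN0 : 0 ≤ N := (norm_nonneg _).trans (hN 0)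
  refine (hζ.abs.mul_const (N * B)).mono' ?_ ?_
  · refine hζ.aestronglyMeasurable.mul (Measurable.aestronglyMeasurable ?_)
    have h1 : Measurable (fderiv ℝ χ) := measurable_fderiv ℝ χ
    have h2 : Continuous fun p : (R3 →L[ℝ] ℝ) × R3 => p.1 p.2 := by fun_prop
    exact h2.measurable.comp (h1.prodMk angular.continuous.measurable)
  · filter_upwards [hB] with x hx
    rw [norm_mul, Real.norm_eq_abs]
    by_cases h : ζ x = 0
    · simp [h]
    refine mul_le_mul_of_nonneg_left ?_ (abs_nonneg _)
    refine ((fderiv ℝ χ _).le_opNorm _).trans ?_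
    exact mul_le_mul (hN _) ((norm_angular_le _).trans (hx h)) (norm_nonneg _) hN0

/-- The integral of an axisymmetric swirl field against a gradient vanishes. -/
lemma integral_mul_fderiv_angular_eq_zero {ζ : R3 → ℝ} (hζ : Integrable ζ)
    {B : ℝ} (hB : ∀ᵐ z, ζ z ≠ 0 → ‖z‖ ≤ B)
    (hsymm : ∀ β, (fun x => ζ (mirror β x)) =ᵐ[volume] ζ) {χ : R3 → ℝ}
    (hχ : Differentiable ℝ χ) {N : ℝ} (hN : ∀ x, ‖fderiv ℝ χ x‖ ≤ N) {N' : ℝ}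
    (hN' : ∀ x, |χ x| ≤ N') :
    ∫ x, ζ x * fderiv ℝ χ x (angular x) = 0 := by
  have hN0 : 0 ≤ N := (norm_nonneg _).trans (hN 0)
  have hm : ∀ β, MeasurePreserving (fun x => mirror 0 (mirror β x)) volume volume := fun β =>
    (measurePreserving_mirror 0).comp (measurePreserving_mirror β)
  have hinv : ∀ β, (fun x => ζ (mirror 0 (mirror β x))) =ᵐ[volume] ζ := fun β =>
    ((measurePreserving_mirror β).quasiMeasurePreserving.ae_eq_comp (hsymm 0)).trans (hsymm β)
  -- The integral is unchanged when `χ` is rotated, because `ζ` is invariant. Its derivative in the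
  -- angle at `0` is the integral in question.
  have hconst : ∀ β, ∫ x, ζ x * χ (mirror 0 (mirror β x)) = ∫ x, ζ x * χ x := fun β => by
    rw [← (hm β).integral_comp_aestronglyMeasurable (g := fun x => ζ x * χ x)
      (hζ.aestronglyMeasurable.mul hχ.continuous.aestronglyMeasurable)]
    refine integral_congr_ae ?_
    filter_upwards [hinv β] with x hx
    rw [hx]
  have hmir : ∀ β : ℝ, Continuous fun x => mirror 0 (mirror β x) := fun β =>
    (mirror 0).continuous.comp (mirror β).continuous
  have hid : ∀ x, mirror 0 (mirror 0 x) = x := mirror_mirror 0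
  have hderiv := (hasDerivAt_integral_of_dominated_loc_of_deriv_le (μ := volume)
    (F := fun β x => ζ x * χ (mirror 0 (mirror β x)))
    (F' := fun β x => ζ x * fderiv ℝ χ (mirror 0 (mirror β x))
      (angular (mirror 0 (mirror β x)))) (x₀ := 0) (s := univ) (bound := fun x => |ζ x| * (N * B))
    univ_mem (Eventually.of_forall fun β => hζ.aestronglyMeasurable.mul
      (hχ.continuous.comp (hmir β)).aestronglyMeasurable)
    ((hζ.abs.mul_const N').mono' (hζ.aestronglyMeasurable.mul
      (hχ.continuous.comp (hmir 0)).aestronglyMeasurable) (ae_of_all _ fun x => by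
        rw [norm_mul]; exact mul_le_mul_of_nonneg_left (hN' _) (norm_nonneg _)))
    (by simp_rw [hid]; exact (integrable_mul_fderiv_angular hζ hB hN).aestronglyMeasurable)
    (by
      filter_upwards [hB] with x hx β _
      rw [norm_mul, Real.norm_eq_abs]
      by_cases h : ζ x = 0
      · simp [h]
      refine mul_le_mul_of_nonneg_left ?_ (abs_nonneg _)
      refine ((fderiv ℝ χ _).le_opNorm _).trans ?_
      refine mul_le_mul (hN _) ((norm_angular_le _).trans ?_) (norm_nonneg _) hN0
      rw [LinearIsometryEquiv.norm_map, LinearIsometryEquiv.norm_map]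
      exact hx h)
    (hζ.abs.mul_const _)
    (ae_of_all _ fun x β _ =>
      ((hχ _).hasFDerivAt.comp_hasDerivAt β (mirror_zero_mirror_hasDerivAt x β)).const_mul _)).2
  simp_rw [hconst, hid] at hderiv
  exact hderiv.unique (hasDerivAt_const _ _)

lemma curl_sub_laplacian_curl {φ : R3 → R3} (hφ : ContDiff ℝ ∞ φ) (x : R3) :
    curl φ x - α ^ 2 • Laplacian.laplacian (curl φ) x =
      curl (fun y => !₂[helmholtz α (fun y => φ y 0) y, helmholtz α (fun y => φ y 1) y,
        helmholtz α (fun y => φ y 2) y]) x := by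
  have hc := fun j => contDiff_coord j hφ
  have hh := fun j => contDiff_helmholtz α (hc j)
  have h : ∀ i j, ContDiff ℝ ∞ (pd i fun y => φ y j) := fun i j => contDiff_pd i (hc j)
  rw [curl_eq (contDiff_vec (hh 0) (hh 1) (hh 2))]
  have hl := fun j => laplacian_apply j (contDiff_curl hφ) x
  simp only [curl_eq hφ] at hl
  have hpd : ∀ i j, pd i (fun y => helmholtz α (fun y => φ y j) y) =
      helmholtz α (pd i fun y => φ y j) := fun i j => pd_helmholtz α i (hc j)
  apply r3_ext
  all_goals
    simp only [PiLp.sub_apply, PiLp.smul_apply, hl, curl_eq hφ, smul_eq_mul]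
    simp only [Matrix.cons_val, laplacian_sub' (h _ _) (h _ _), hpd]
    simp only [helmholtz]
    ring

/-- The unfiltered vorticity of `K_α * q` is `q`, when `q` is an axisymmetric swirl field. -/
theorem isUnfilteredVorticity_kernelConv (hα : 0 < α) {ζ : R3 → ℝ} (hζ : Integrable ζ)
    {B : ℝ} (hB : ∀ᵐ z, ζ z ≠ 0 → ‖z‖ ≤ B)
    (hsymm : ∀ β, (fun x => ζ (mirror β x)) =ᵐ[volume] ζ) :
    IsUnfilteredVorticity α (kernelConv α fun x => ζ x • angular x) fun x => ζ x • angular x := by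
  intro φ hφ hc
  have hq : Integrable fun x => ζ x • angular x := by
    refine (hζ.abs.mul_const B).mono'
      (hζ.aestronglyMeasurable.smul angular.continuous.aestronglyMeasurable) ?_
    filter_upwards [hB] with x hx
    rw [norm_smul, Real.norm_eq_abs]
    by_cases h : ζ x = 0
    · simp [h]
    exact mul_le_mul_of_nonneg_left ((norm_angular_le x).trans (hx h)) (abs_nonneg _)
  have hcj := fun j => contDiff_coord j hφ
  have hcc := fun j : Fin 3 => hasCompactSupport_coord j hc
  have hh := fun j => contDiff_helmholtz α (hcj j)
  have hhc := fun j => hasCompactSupport_helmholtz α (hcj j) (hcc j)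
  set Φ : Fin 3 → R3 → ℝ := fun j => helmholtz α fun y => φ y j with hΦdef
  have hΨ : ContDiff ℝ ∞ fun x => (!₂[Φ 0 x, Φ 1 x, Φ 2 x] : R3) :=
    contDiff_vec (hh 0) (hh 1) (hh 2)
  have hΨc : HasCompactSupport fun x => (!₂[Φ 0 x, Φ 1 x, Φ 2 x] : R3) := hasCompactSupport_vec (hhc 0) (hhc 1) (hhc 2)
  simp_rw [curl_sub_laplacian_curl hφ, real_inner_comm _ (kernelConv α _ _)]
  rw [integral_inner_kernelConv hα hq (contDiff_curl hΨ).continuous (hasCompactSupport_curl hΨ hΨc)]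
  -- the potential
  choose D hD hDv hDn using fun k y => hasFDerivAt_kernelPotential hα k (hh k) (hhc k) y
  set χ : R3 → ℝ := fun y => kernelPotential α 0 (Φ 0) y + kernelPotential α 1 (Φ 1) y +
    kernelPotential α 2 (Φ 2) y with hχdef
  have hχ : ∀ y, HasFDerivAt χ (D 0 y + D 1 y + D 2 y) y := fun y =>
    ((hD 0 y).add (hD 1 y)).add (hD 2 y)
  have hpdi : ∀ i j k y, Integrable fun x => pd i (Φ j) (x + y) * gradGreen α x k :=
    fun i j k y => integrable_comp_add_mul_gradGreen hα (contDiff_pd i (hh j)).continuous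
      (hasCompactSupport_pd i (hhc j)) y k
  have hpdi' : ∀ i j k i' j' k' y, Integrable fun x => pd i (Φ j) (x + y) * gradGreen α x k +
      pd i' (Φ j') (x + y) * gradGreen α x k' :=
    fun i j k i' j' k' y => (hpdi i j k y).add (hpdi i' j' k' y)
  have hFS : ∀ j y, (∫ x, pd 0 (Φ j) (x + y) * gradGreen α x 0) +
      (∫ x, pd 1 (Φ j) (x + y) * gradGreen α x 1) +
      (∫ x, pd 2 (Φ j) (x + y) * gradGreen α x 2) = φ y j := fun j y => by
    have := integral_pd_helmholtz_mul_gradGreen hα (f := fun z => φ (z + y) j)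
      ((hcj j).comp (contDiff_id.add contDiff_const)) (hasCompactSupport_comp_add (hcc j) y)
    have e : helmholtz α (fun z => φ (z + y) j) = fun z => Φ j (z + y) := by
      funext z
      have h2 : ContDiff ℝ ∞ fun z => φ (z + y) j :=
        (hcj j).comp (contDiff_id.add contDiff_const)
      simp only [hΦdef, helmholtz, laplacian_eq_sum_pd h2, laplacian_eq_sum_pd (hcj j)]
      have e1 : ∀ i, pd i (fun z => φ (z + y) j) = fun z => pd i (fun z => φ z j) (z + y) :=
        fun i => funext fun z => pd_comp_add i (fun z => φ z j) y z
      simp only [e1, pd_comp_add]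
    rw [e] at this
    simp only [pd_comp_add] at this
    rw [integral_add (hpdi' _ _ _ _ _ _ _) (hpdi _ _ _ _),
      integral_add (hpdi _ _ _ _) (hpdi _ _ _ _)] at this
    simpa using this
  have hgrad : ∀ y i, pd i χ y = (∫ x, pd i (Φ 0) (x + y) * gradGreen α x 0) +
      (∫ x, pd i (Φ 1) (x + y) * gradGreen α x 1) +
      (∫ x, pd i (Φ 2) (x + y) * gradGreen α x 2) := fun y i => by
    rw [pd, (hχ y).fderiv]
    simp only [add_apply, hDv]; rfl
  have hcurl : ∀ z, curl (fun y => !₂[Φ 0 y, Φ 1 y, Φ 2 y]) z = !₂[pd 1 (Φ 2) z - pd 2 (Φ 1) z,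
      pd 2 (Φ 0) z - pd 0 (Φ 2) z, pd 0 (Φ 1) z - pd 1 (Φ 0) z] := fun z => curl_eq hΨ z
  -- Expanding the triple product, the terms `∂_k Φ_j ∂_k G_α` sum to `φ_j` by `hFS` and the terms
  -- `∂_j Φ_k ∂_k G_α` sum to `∂_j χ`. The latter is the gradient to be removed by symmetry.
  have hA : ∀ y, ∫ x, cross (curl (fun y => !₂[Φ 0 y, Φ 1 y, Φ 2 y]) (x + y)) (gradGreen α x) =
      φ y - !₂[pd 0 χ y, pd 1 χ y, pd 2 χ y] := fun y => by
    rw [integral_cross_apply hα (contDiff_curl hΨ).continuous (hasCompactSupport_curl hΨ hΨc)]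
    simp only [hcurl]
    have hs : ∀ i j k i' j', ∫ x, (pd i (Φ j) (x + y) - pd i' (Φ j') (x + y)) * gradGreen α x k =
        (∫ x, pd i (Φ j) (x + y) * gradGreen α x k) - ∫ x, pd i' (Φ j') (x + y) * gradGreen α x k :=
      fun i j k i' j' => by
        simp_rw [sub_mul]; exact integral_sub (hpdi _ _ _ _) (hpdi _ _ _ _)
    apply r3_ext <;>
    · simp only [Matrix.cons_val, PiLp.sub_apply, hs, hgrad, ← hFS]
      ring
  have hgradinner : ∀ y, ⟪ζ y • angular y, φ y - !₂[pd 0 χ y, pd 1 χ y, pd 2 χ y]⟫ =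
      ⟪ζ y • angular y, φ y⟫ - ζ y * fderiv ℝ χ y (angular y) := fun y => by
    rw [inner_sub_right, inner_gradient χ, real_inner_smul_left _ (!₂[pd 0 χ y, _, _]),
      real_inner_comm (!₂[pd 0 χ y, _, _])]
  have hN : ∀ y, ‖fderiv ℝ χ y‖ ≤ kernelBound α * (∫ x, ‖fderiv ℝ (Φ 0) x‖) +
      kernelBound α * (∫ x, ‖fderiv ℝ (Φ 1) x‖) + kernelBound α * ∫ x, ‖fderiv ℝ (Φ 2) x‖ :=
    fun y => by
      rw [(hχ y).fderiv]
      exact (norm_add₃_le).trans (add_le_add (add_le_add (hDn 0 y) (hDn 1 y)) (hDn 2 y))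
  obtain ⟨Nφ, hNφ⟩ := hφ.continuous.bounded_above_of_compact_support hc
  have hi1 : Integrable fun y => ⟪ζ y • angular y, φ y⟫ :=
    (hq.norm.mul_const Nφ).mono' (hq.aestronglyMeasurable.inner hφ.continuous.aestronglyMeasurable)
      (ae_of_all _ fun y => (norm_inner_le_norm _ _).trans
        (mul_le_mul_of_nonneg_left (hNφ y) (norm_nonneg _)))
  have hχb : ∀ y, |χ y| ≤ kernelBound α * (∫ x, |Φ 0 x|) + kernelBound α * (∫ x, |Φ 1 x|) +
      kernelBound α * ∫ x, |Φ 2 x| := fun y =>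
    (abs_add_three _ _ _).trans (add_le_add (add_le_add
      (abs_kernelPotential_le hα 0 (hh 0).continuous (hhc 0) y)
      (abs_kernelPotential_le hα 1 (hh 1).continuous (hhc 1) y))
      (abs_kernelPotential_le hα 2 (hh 2).continuous (hhc 2) y))
  refine (integral_congr_ae (ae_of_all _ fun y =>
    (congrArg (fun v => ⟪ζ y • angular y, v⟫) (hA y)).trans (hgradinner y))).trans ?_
  rw [integral_sub hi1 (integrable_mul_fderiv_angular hζ hB hN),
    integral_mul_fderiv_angular_eq_zero hζ hB hsymm (fun y => (hχ y).differentiableAt) hN hχb,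
    sub_zero]

end vorticity

/-! ### A maximum principle -/

/-- Were the second derivative along the line positive, the point would be both a local minimum and
a local maximum on the line. The restriction would then be locally constant, with zero second
derivative. -/
lemma pd_pd_nonpos_of_isLocalMax {f : R3 → ℝ} (hf : ContDiff ℝ ∞ f) {x : R3}
    (hx : IsLocalMax f x) (i : Fin 3) : pd i (pd i f) x ≤ 0 := by
  set e : R3 := EuclideanSpace.single i 1
  have hline : ∀ t : ℝ, HasDerivAt (fun t : ℝ => x + t • e) e t := fun t => by
    simpa using ((hasDerivAt_id t).smul_const e).const_add x
  have hd : ∀ g : R3 → ℝ, ContDiff ℝ ∞ g →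
      deriv (fun t : ℝ => g (x + t • e)) = fun t => pd i g (x + t • e) := fun g hg =>
    funext fun t => ((differentiableAt_of_contDiff hg _).hasFDerivAt.comp_hasDerivAt t
      (hline t)).deriv
  by_contra! h
  have hc : Continuous fun t : ℝ => x + t • e := by fun_prop
  have hmax : IsLocalMax (fun t : ℝ => f (x + t • e)) 0 := by
    have h0 : Tendsto (fun t : ℝ => x + t • e) (𝓝 0) (𝓝 x) := by
      have := hc.tendsto 0; simpa using this
    have := h0.eventually hx
    filter_upwards [this] with t ht
    simpa using ht
  have hdd : deriv (deriv fun t : ℝ => f (x + t • e)) 0 = pd i (pd i f) x := by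
    rw [hd f hf, hd _ (contDiff_pd i hf)]; simp
  have hmin := isLocalMin_of_deriv_deriv_pos (f := fun t : ℝ => f (x + t • e)) (x₀ := 0)
    (by rw [hdd]; exact h) hmax.deriv_eq_zero (hf.continuous.comp hc).continuousAt
  have heq : (fun t : ℝ => f (x + t • e)) =ᶠ[𝓝 0] fun _ => f (x + (0 : ℝ) • e) := by
    filter_upwards [hmax, hmin] with t h1 h2 using le_antisymm h1 h2
  have := heq.deriv.deriv_eq
  rw [hdd] at this
  simp at this
  linarith

lemma laplacian_nonpos_of_isLocalMax {f : R3 → ℝ} (hf : ContDiff ℝ ∞ f) {x : R3}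
    (hx : IsLocalMax f x) : Laplacian.laplacian f x ≤ 0 := by
  rw [laplacian_eq_sum_pd hf]
  have := fun i => pd_pd_nonpos_of_isLocalMax hf hx i
  simp only
  linarith [this 0, this 1, this 2]

lemma laplacian_norm_sq (c : ℝ) (x : R3) :
    Laplacian.laplacian (fun y : R3 => c * ‖y‖ ^ 2) x = 6 * c := by
  have h : ContDiff ℝ ∞ fun y : R3 => c * ‖y‖ ^ 2 := contDiff_const.mul (contDiff_norm_sq ℝ)
  have h1 : ∀ i, pd i (fun y : R3 => c * ‖y‖ ^ 2) = fun y => 2 * c * y i := fun i => by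
    rw [pd_const_mul i c (contDiff_norm_sq ℝ)]
    funext y
    rw [pd, (hasStrictFDerivAt_norm_sq y).hasFDerivAt.fderiv]
    fin_cases i <;> simp [inner_r3] <;> ring
  have h2 : ∀ i, pd i (fun y : R3 => 2 * c * y i) x = 2 * c := fun i => by
    rw [pd_const_mul i (2 * c) (f := fun y : R3 => y i) (coord i).contDiff]
    simp only [pd_coord, mul_one]
  rw [laplacian_eq_sum_pd h]
  simp only [h1, h2]
  ring

lemma laplacian_add' {f g : R3 → ℝ} (hf : ContDiff ℝ ∞ f) (hg : ContDiff ℝ ∞ g) (x : R3) :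
    Laplacian.laplacian (fun y => f y + g y) x =
      Laplacian.laplacian f x + Laplacian.laplacian g x := by
  rw [laplacian_eq_sum_pd hf, laplacian_eq_sum_pd hg, laplacian_eq_sum_pd (hf.add hg)]
  have : ∀ i, pd i (pd i fun y => f y + g y) = fun y => pd i (pd i f) y + pd i (pd i g) y :=
    fun i => by rw [pd_add i hf hg, pd_add i (contDiff_pd i hf) (contDiff_pd i hg)]
  simp only [this]; ring

/-- A decaying function that is subharmonic where it is positive is nonpositive. -/
lemma nonpos_of_laplacian_nonneg {h : R3 → ℝ} (hh : ContDiff ℝ ∞ h)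
    (hlim : Tendsto h (cocompact R3) (𝓝 0)) (hsub : ∀ x, 0 < h x → 0 ≤ Laplacian.laplacian h x)
    (x : R3) : h x ≤ 0 := by
  by_contra! hx
  obtain ⟨R, hR⟩ : ∃ R : ℝ, ∀ y, R ≤ ‖y‖ → h y < h x / 2 := by
    have h1 := hlim.eventually (gt_mem_nhds (half_pos hx))
    rw [← Metric.cobounded_eq_cocompact] at h1
    obtain ⟨R, _, hR⟩ := hasBasis_cobounded_norm.eventually_iff.1 h1
    exact ⟨R, fun y hy => hR hy⟩
  have hxR : ‖x‖ < R := by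
    by_contra! hc
    linarith [hR x hc]
  have hR0 : 0 < R := (norm_nonneg x).trans_lt hxR
  -- With `ε R² = h x / 4`, the perturbed function is below `3 h x / 4` on the sphere of radius `R`,
  -- so its maximum over the ball is interior. There `h > 0`, and the perturbed Laplacian is at
  -- least `6 ε`, a contradiction.
  set ε := h x / (4 * R ^ 2) with hε
  have hε0 : 0 < ε := by positivity
  have hεR : ε * R ^ 2 = h x / 4 := by rw [hε]; field_simp
  have hq : ContDiff ℝ ∞ fun y : R3 => ε * ‖y‖ ^ 2 := contDiff_const.mul (contDiff_norm_sq ℝ)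
  have hg : ContDiff ℝ ∞ fun y => h y + ε * ‖y‖ ^ 2 := hh.add hq
  obtain ⟨z, hz, hzmax⟩ := (isCompact_closedBall (0 : R3) R).exists_isMaxOn
    ⟨x, by simpa using hxR.le⟩ hg.continuous.continuousOn
  have hzx : h x ≤ h z + ε * ‖z‖ ^ 2 := by
    have : h x + ε * ‖x‖ ^ 2 ≤ h z + ε * ‖z‖ ^ 2 := hzmax (by simpa using hxR.le)
    have := mul_nonneg hε0.le (sq_nonneg ‖x‖)
    linarith
  have hzR : ‖z‖ ≤ R := by simpa using hz
  have hz2 : ε * ‖z‖ ^ 2 ≤ ε * R ^ 2 := by gcongr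
  have hzlt : ‖z‖ < R := by
    by_contra! hc
    linarith [hR z hc]
  have hloc : IsLocalMax (fun y => h y + ε * ‖y‖ ^ 2) z :=
    hzmax.isLocalMax (mem_of_superset (Metric.isOpen_ball.mem_nhds (by simpa using hzlt))
      Metric.ball_subset_closedBall)
  have h1 := laplacian_nonpos_of_isLocalMax hg hloc
  rw [laplacian_add' hh hq, laplacian_norm_sq] at h1
  have h2 := hsub z (by linarith)
  linarith

/-- The maximum principle for `h` and `-h`. It is used with `c = α⁻²` and with `c = 0`. -/
lemma eq_zero_of_laplacian_eq_mul {h : R3 → ℝ} (hh : ContDiff ℝ ∞ h)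
    (hlim : Tendsto h (cocompact R3) (𝓝 0)) {c : ℝ} (hc : 0 ≤ c)
    (heq : ∀ x, Laplacian.laplacian h x = c * h x) (x : R3) : h x = 0 := by
  refine le_antisymm (nonpos_of_laplacian_nonneg hh hlim (fun x hx => ?_) x) ?_
  · rw [heq]; positivity
  · have hn : ContDiff ℝ ∞ fun y => (0 : ℝ) - h y := contDiff_const.sub hh
    have hl : ∀ y, Laplacian.laplacian (fun y => (0 : ℝ) - h y) y = -(c * h y) := fun y => by
      rw [laplacian_sub' contDiff_const hh, heq, laplacian_eq_sum_pd contDiff_const]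
      have : ∀ i, pd i (fun _ : R3 => (0 : ℝ)) = fun _ => 0 := fun i => by funext; simp [pd]
      simp [this]
    have := nonpos_of_laplacian_nonneg hn (by simpa using hlim.const_sub 0) (fun x hx => by
      rw [hl]; nlinarith) x
    linarith

/-! ### Smoothing -/

/-- The convolution of `f` with a smooth kernel `ρ`. -/
def smoothing (f ρ : R3 → ℝ) (x : R3) : ℝ := ∫ t, f t * ρ (x - t)

section smoothing

variable {f ρ : R3 → ℝ}

lemma smoothing_eq (f ρ : R3 → ℝ) :
    smoothing f ρ = convolution f ρ (ContinuousLinearMap.mul ℝ ℝ) volume := rfl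

lemma contDiff_smoothing (hf : Continuous f) (hρ : ContDiff ℝ ∞ ρ) (hc : HasCompactSupport ρ) :
    ContDiff ℝ ∞ (smoothing f ρ) := by
  rw [smoothing_eq]
  exact hc.contDiff_convolution_right _ hf.locallyIntegrable (n := ⊤) hρ

lemma pd_smoothing (hf : Continuous f) (hρ : ContDiff ℝ ∞ ρ) (hc : HasCompactSupport ρ)
    (i : Fin 3) : pd i (smoothing f ρ) = smoothing f (pd i ρ) := by
  have hρ1 : ContDiff ℝ 1 ρ := hρ.of_le (by simp)
  funext x
  rw [smoothing_eq, pd, (hc.hasFDerivAt_convolution_right _ hf.locallyIntegrable hρ1 x).fderiv,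
    convolution_precompR_apply _ hf.locallyIntegrable (hc.fderiv (𝕜 := ℝ))
      (hρ.continuous_fderiv (by simp))]
  rfl

lemma laplacian_smoothing (hf : Continuous f) (hρ : ContDiff ℝ ∞ ρ) (hc : HasCompactSupport ρ) :
    Laplacian.laplacian (smoothing f ρ) = smoothing f (Laplacian.laplacian ρ) := by
  rw [laplacian_eq_sum_pd (contDiff_smoothing hf hρ hc), laplacian_eq_sum_pd hρ]
  have h : ∀ i, pd i (pd i (smoothing f ρ)) = smoothing f (pd i (pd i ρ)) := fun i => by
    rw [pd_smoothing hf hρ hc, pd_smoothing hf (contDiff_pd i hρ) (hasCompactSupport_pd i hc)]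
  have hi : ∀ i x, Integrable fun t => f t * pd i (pd i ρ) (x - t) := fun i x =>
    (hf.mul ((contDiff_pd i (contDiff_pd i hρ)).continuous.comp
      (continuous_const.sub continuous_id))).integrable_of_hasCompactSupport
      ((hasCompactSupport_pd i (hasCompactSupport_pd i hc)).comp_homeomorph
        (Homeomorph.subLeft x)).mul_left
  funext x
  rw [h, h, h]
  have h01 : Integrable fun t => f t * pd 0 (pd 0 ρ) (x - t) + f t * pd 1 (pd 1 ρ) (x - t) :=
    (hi 0 x).add (hi 1 x)
  simp only [smoothing, mul_add]
  rw [integral_add h01 (hi 2 x), integral_add (hi 0 x) (hi 1 x)]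

lemma tendsto_smoothing_cocompact (hf : Continuous f) (hlim : Tendsto f (cocompact R3) (𝓝 0))
    (hρ : Continuous ρ) (hc : HasCompactSupport ρ) :
    Tendsto (smoothing f ρ) (cocompact R3) (𝓝 0) := by
  have : (cocompact R3).IsCountablyGenerated := by
    rw [← Metric.cobounded_eq_cocompact, ← comap_norm_atTop]; infer_instance
  obtain ⟨N, hN⟩ : ∃ N, ∀ x, ‖f x‖ ≤ N := by
    obtain ⟨x₀, h0⟩ : ∃ x₀, ∀ y, ‖f y‖ ≤ max ‖f x₀‖ 1 := by
      by_cases h : ∃ x₀, 1 < ‖f x₀‖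
      · obtain ⟨x₀, hx₀⟩ := h
        have h1 : ∀ᶠ x in cocompact R3, ‖f x‖ ≤ ‖f x₀‖ := by
          have := hlim.norm.eventually (gt_mem_nhds
            (show ‖(0 : ℝ)‖ < ‖f x₀‖ by rw [norm_zero]; linarith))
          exact this.mono fun _ => le_of_lt
        obtain ⟨z, hz⟩ := hf.norm.exists_forall_ge' x₀ h1
        exact ⟨z, fun y => (hz y).trans (le_max_left _ _)⟩
      · push Not at h
        exact ⟨0, fun y => (h y).trans (le_max_right _ _)⟩
    exact ⟨_, h0⟩
  have h0 : (0 : ℝ) = ∫ y : R3, (0 : ℝ) := by simp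
  have e : smoothing f ρ = fun x => ∫ t, f (x - t) * ρ t := funext fun x => by
    rw [smoothing, ← integral_sub_left_eq_self _ volume x]; simp
  rw [e]
  suffices h : Tendsto (fun x => ∫ t, f (x - t) * ρ t) (cocompact R3) (𝓝 (∫ y : R3, (0 : ℝ))) by
    rwa [← h0] at h
  refine tendsto_integral_filter_of_dominated_convergence (fun t => N * ‖ρ t‖)
    (Eventually.of_forall fun x => ((hf.comp (continuous_const.sub continuous_id)).mul
      hρ).aestronglyMeasurable)
    (Eventually.of_forall fun x => ae_of_all _ fun t => ?_)
    ((hρ.integrable_of_hasCompactSupport hc).norm.const_mul _) (ae_of_all _ fun t => ?_)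
  · rw [norm_mul]; exact mul_le_mul_of_nonneg_right (hN _) (norm_nonneg _)
  · have h1 : Tendsto (fun x : R3 => f (x - t)) (cocompact R3) (𝓝 0) :=
      hlim.comp (Homeomorph.subRight t).isClosedEmbedding.tendsto_cocompact
    simpa using h1.mul_const (ρ t)

end smoothing

/-! ### Decaying divergence free fields are determined by their unfiltered vorticity. -/

lemma laplacian_helmholtz (α : ℝ) {ρ : R3 → ℝ} (hρ : ContDiff ℝ ∞ ρ) (x : R3) :
    Laplacian.laplacian (helmholtz α ρ) x =
      Laplacian.laplacian ρ x - α ^ 2 * Laplacian.laplacian (Laplacian.laplacian ρ) x := by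
  have hl := contDiff_laplacian hρ
  have e : helmholtz α ρ = fun y => ρ y - α ^ 2 * Laplacian.laplacian ρ y := rfl
  rw [e, laplacian_sub' hρ (contDiff_const.mul hl), laplacian_eq_sum_pd (contDiff_const.mul hl),
    laplacian_eq_sum_pd hl]
  simp only [pd_const_mul _ _ hl, pd_const_mul _ _ (contDiff_pd _ hl)]
  ring

/-- A decaying solution of `Δ (1 - α² Δ) f = 0` vanishes. -/
lemma eq_zero_of_integral_mul_laplacian_helmholtz {α : ℝ} (hα : 0 < α) {f : R3 → ℝ}
    (hf : Continuous f) (hlim : Tendsto f (cocompact R3) (𝓝 0))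
    (h : ∀ g : R3 → ℝ, ContDiff ℝ ∞ g → HasCompactSupport g →
      ∫ x, f x * Laplacian.laplacian (helmholtz α g) x = 0) (x : R3) : f x = 0 := by
  -- For the smooth function `W = f * ρ`, the Laplacian `ΔW` decays and satisfies `Δ(ΔW) = α⁻² ΔW`,
  -- so it vanishes; then `W` is harmonic and decays, so it vanishes too. Shrinking the support of
  -- `ρ` recovers `f`.
  have key : ∀ ρ : R3 → ℝ, ContDiff ℝ ∞ ρ → HasCompactSupport ρ → ∀ x, smoothing f ρ x = 0 := by
    intro ρ hρ hc
    have hl := contDiff_laplacian hρ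
    have hlc := hasCompactSupport_laplacian hρ hc
    have hcomp : ∀ (k : R3 → ℝ), ContDiff ℝ ∞ k → ∀ x, Laplacian.laplacian (fun t => k (x - t)) =
        fun t => Laplacian.laplacian k (x - t) := fun k hk x => by
      have e : ∀ i (k : R3 → ℝ), ContDiff ℝ ∞ k →
          pd i (fun t => k (x - t)) = fun t => -pd i k (x - t) := fun i k hk => by
        funext t
        have := (differentiableAt_of_contDiff hk (x - t)).hasFDerivAt.comp t
          ((hasFDerivAt_id t).const_sub x)
        rw [pd, show (fun t => k (x - t)) = k ∘ fun t => x - t from rfl]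
        rw [this.fderiv]
        simp [pd]
      have hk' : ContDiff ℝ ∞ fun t => k (x - t) := hk.comp (contDiff_const.sub contDiff_id)
      rw [laplacian_eq_sum_pd hk', laplacian_eq_sum_pd hk]
      have e2 : ∀ i, pd i (fun t => -pd i k (x - t)) = fun t => pd i (pd i k) (x - t) := fun i => by
        rw [show (fun t => -pd i k (x - t)) = fun t => (-1 : ℝ) * pd i k (x - t) by simp,
          pd_const_mul i _ (f := fun t => pd i k (x - t)) ((contDiff_pd i hk).comp (contDiff_const.sub contDiff_id)),
          e i _ (contDiff_pd i hk)]
        simp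
      simp only [e _ k hk, e2]
    have heq : ∀ x, Laplacian.laplacian (Laplacian.laplacian (smoothing f ρ)) x =
        (α ^ 2)⁻¹ * Laplacian.laplacian (smoothing f ρ) x := fun x => by
      have h1 := h (fun t => ρ (x - t)) (hρ.comp (contDiff_const.sub contDiff_id))
        (hc.comp_homeomorph (Homeomorph.subLeft x))
      have e1 : helmholtz α (fun t => ρ (x - t)) = fun t => helmholtz α ρ (x - t) := by
        funext t
        simp only [helmholtz, hcomp ρ hρ]
      rw [e1, hcomp _ (contDiff_helmholtz α hρ)] at h1
      rw [laplacian_smoothing hf hρ hc, laplacian_smoothing hf hl hlc]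
      have e2 : ∀ t, f t * Laplacian.laplacian (helmholtz α ρ) (x - t) =
          f t * Laplacian.laplacian ρ (x - t) -
            α ^ 2 * (f t * Laplacian.laplacian (Laplacian.laplacian ρ) (x - t)) := fun t => by
        rw [laplacian_helmholtz α hρ]; ring
      have hi : ∀ k : R3 → ℝ, ContDiff ℝ ∞ k → HasCompactSupport k →
          Integrable fun t => f t * k (x - t) := fun k hk hkc =>
        (hf.mul (hk.continuous.comp (continuous_const.sub
          continuous_id))).integrable_of_hasCompactSupport
          (hkc.comp_homeomorph (Homeomorph.subLeft x)).mul_left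
      simp_rw [e2] at h1
      rw [integral_sub (hi _ hl hlc) ((hi _ (contDiff_laplacian hl)
        (hasCompactSupport_laplacian hl hlc)).const_mul _), integral_const_mul] at h1
      rw [smoothing, smoothing, eq_inv_mul_iff_mul_eq₀ (by positivity)]
      linarith
    have hW := contDiff_smoothing hf hρ hc
    have hΔ := eq_zero_of_laplacian_eq_mul (contDiff_laplacian hW)
      (by rw [laplacian_smoothing hf hρ hc]
          exact tendsto_smoothing_cocompact hf hlim hl.continuous hlc)
      (by positivity) heq
    exact eq_zero_of_laplacian_eq_mul hW (tendsto_smoothing_cocompact hf hlim hρ.continuous hc)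
      le_rfl (fun x => by rw [hΔ, zero_mul])
  set φ : ℕ → ContDiffBump (0 : R3) := fun n =>
    ⟨1 / ((n : ℝ) + 2), 1 / ((n : ℝ) + 1), by positivity, by gcongr; norm_num⟩
  have hφ : Tendsto (fun n => (φ n).rOut) atTop (𝓝 0) := tendsto_one_div_add_atTop_nhds_zero_nat
  have ht := ContDiffBump.convolution_tendsto_right_of_continuous (μ := volume) hφ hf x
  have hz : ∀ n, (convolution ((φ n).normed volume) f (ContinuousLinearMap.lsmul ℝ ℝ) volume) x =
      0 := fun n => by
    rw [convolution_lsmul_swap]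
    have := key ((φ n).normed volume) (φ n).contDiff_normed (φ n).hasCompactSupport_normed x
    rw [smoothing] at this
    rw [← this]
    simp [mul_comm]
  simp_rw [hz] at ht
  exact tendsto_nhds_unique ht tendsto_const_nhds |>.symm ▸ rfl

lemma curl_curl {ψ : R3 → R3} (hψ : ContDiff ℝ ∞ ψ) (x : R3) :
    curl (curl ψ) x = !₂[pd 0 (fun y => pd 0 (fun y => ψ y 0) y + pd 1 (fun y => ψ y 1) y +
        pd 2 (fun y => ψ y 2) y) x,
      pd 1 (fun y => pd 0 (fun y => ψ y 0) y + pd 1 (fun y => ψ y 1) y + pd 2 (fun y => ψ y 2) y) x,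
      pd 2 (fun y => pd 0 (fun y => ψ y 0) y + pd 1 (fun y => ψ y 1) y + pd 2 (fun y => ψ y 2) y) x]
      - Laplacian.laplacian ψ x := by
  have hc := fun j => contDiff_coord j hψ
  have h : ∀ i j, ContDiff ℝ ∞ (pd i fun y => ψ y j) := fun i j => contDiff_pd i (hc j)
  have hp : ∀ k, pd k (fun y => pd 0 (fun y => ψ y 0) y + pd 1 (fun y => ψ y 1) y +
      pd 2 (fun y => ψ y 2) y) x = pd k (pd 0 fun y => ψ y 0) x + pd k (pd 1 fun y => ψ y 1) x +
      pd k (pd 2 fun y => ψ y 2) x := fun k => by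
    rw [pd_add k ((h 0 0).add (h 1 1)) (h 2 2), pd_add k (h 0 0) (h 1 1)]
  rw [curl_eq (contDiff_curl hψ)]
  simp only [curl_eq hψ, hp]
  have c10 : ∀ j, pd 1 (pd 0 fun y => ψ y j) = pd 0 (pd 1 fun y => ψ y j) :=
    fun j => pd_comm 1 0 (hc j)
  have c20 : ∀ j, pd 2 (pd 0 fun y => ψ y j) = pd 0 (pd 2 fun y => ψ y j) :=
    fun j => pd_comm 2 0 (hc j)
  have c21 : ∀ j, pd 2 (pd 1 fun y => ψ y j) = pd 1 (pd 2 fun y => ψ y j) :=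
    fun j => pd_comm 2 1 (hc j)
  apply r3_ext <;>
  · simp only [Matrix.cons_val, PiLp.sub_apply, laplacian_apply _ hψ, laplacian_eq_sum_pd (hc _),
      pd_sub _ (h _ _) (h _ _), c10, c20, c21]
    ring

/-- A decaying divergence free field without unfiltered vorticity vanishes. -/
theorem eq_zero_of_isUnfilteredVorticity_zero {α : ℝ} (hα : 0 < α) {w : R3 → R3}
    (hw : Continuous w) (hlim : Tendsto w (cocompact R3) (𝓝 0)) (hdiv : IsWeaklyDivFree w)
    (hv : IsUnfilteredVorticity α w 0) : w = 0 := by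
  have hgrad : ∀ χ : R3 → ℝ, ContDiff ℝ ∞ χ → HasCompactSupport χ →
      ∫ x, ⟪w x, (!₂[pd 0 χ x, pd 1 χ x, pd 2 χ x] : R3)⟫ = 0 := fun χ hχ hc => by
    rw [← hdiv χ hχ hc]
    refine integral_congr_ae (ae_of_all _ fun x => ?_)
    simp only [inner_gradient, real_inner_comm]
  have hint : ∀ Ψ : R3 → R3, Continuous Ψ → HasCompactSupport Ψ →
      Integrable fun x => ⟪w x, Ψ x⟫ := fun Ψ hΨ hc =>
    (hw.inner hΨ).integrable_of_hasCompactSupport (hc.mono fun x hx h => hx (by simp [h]))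
  have hcomp : ∀ j x, w x j = 0 := fun j => by
    refine eq_zero_of_integral_mul_laplacian_helmholtz hα ((coord j).continuous.comp hw)
      (by have := ((coord j).continuous.tendsto 0).comp hlim; rwa [map_zero] at this)
      fun g hg hc => ?_
    set A : ℝ →L[ℝ] R3 := (ContinuousLinearMap.id ℝ ℝ).smulRight (EuclideanSpace.single j 1)
    have hψ : ∀ g : R3 → ℝ, ContDiff ℝ ∞ g → ContDiff ℝ ∞ fun x => A (g x) :=
      fun g hg => A.contDiff.comp hg
    have hψc : ∀ g : R3 → ℝ, HasCompactSupport g → HasCompactSupport fun x => A (g x) :=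
      fun g hc => hc.comp_left (map_zero A)
    have hl := contDiff_laplacian hg
    have hlc := hasCompactSupport_laplacian hg hc
    have key : ∀ g : R3 → ℝ, ContDiff ℝ ∞ g → HasCompactSupport g →
        -- By `curl curl = grad div - Δ`, and since `w` is orthogonal to gradients, the test field
        -- `curl (g e_j)` isolates the Laplacian acting on the single component `w_j`.
        ∫ x, ⟪w x, curl (curl fun x => A (g x)) x⟫ =
          -∫ x, w x j * Laplacian.laplacian g x := fun g hg hc => by
      have hd : ContDiff ℝ ∞ fun y => pd 0 (fun y => A (g y) 0) y + pd 1 (fun y => A (g y) 1) y +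
        pd 2 (fun y => A (g y) 2) y :=
        ((contDiff_pd 0 (contDiff_coord 0 (hψ g hg))).add
        (contDiff_pd 1 (contDiff_coord 1 (hψ g hg)))).add
        (contDiff_pd 2 (contDiff_coord 2 (hψ g hg)))
      have hdc : HasCompactSupport fun y => pd 0 (fun y => A (g y) 0) y +
          pd 1 (fun y => A (g y) 1) y + pd 2 (fun y => A (g y) 2) y :=
        ((hasCompactSupport_pd 0 (hasCompactSupport_coord 0 (hψc g hc))).add
        (hasCompactSupport_pd 1 (hasCompactSupport_coord 1 (hψc g hc)))).add
        (hasCompactSupport_pd 2 (hasCompactSupport_coord 2 (hψc g hc)))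
      simp_rw [curl_curl (hψ g hg), inner_sub_right, laplacian_clm_comp A hg]
      have hA : ∀ x r, ⟪w x, A r⟫ = w x j * r := fun x r => by
        change ⟪w x, r • EuclideanSpace.single j (1 : ℝ)⟫ = _
        rw [real_inner_smul_right, EuclideanSpace.inner_single_right]
        simp [mul_comm]
      have hv1 := contDiff_vec (contDiff_pd 0 hd) (contDiff_pd 1 hd) (contDiff_pd 2 hd)
      have hv2 := hasCompactSupport_vec (hasCompactSupport_pd 0 hdc) (hasCompactSupport_pd 1 hdc)
        (hasCompactSupport_pd 2 hdc)
      rw [integral_sub (hint _ hv1.continuous hv2) (hint _ (hψ _ (contDiff_laplacian hg)).continuous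
        (hψc _ (hasCompactSupport_laplacian hg hc))), hgrad _ hd hdc, zero_sub]
      simp_rw [hA]
    have h1 := hv (curl fun x => A (g x)) (contDiff_curl (hψ g hg))
      (hasCompactSupport_curl (hψ g hg) (hψc g hc))
    have e1 : Laplacian.laplacian (curl (curl fun x => A (g x))) =
        curl (curl fun x => A (Laplacian.laplacian g x)) := by
      rw [laplacian_curl (contDiff_curl (hψ g hg)), laplacian_curl (hψ g hg)]
      congr 2
      exact funext fun x => laplacian_clm_comp A hg x
    have hcc : ∀ g : R3 → ℝ, ContDiff ℝ ∞ g → HasCompactSupport g →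
        Integrable fun x => ⟪w x, curl (curl fun x => A (g x)) x⟫ := fun g hg hc =>
      hint _ (contDiff_curl (contDiff_curl (hψ g hg))).continuous
        (hasCompactSupport_curl (contDiff_curl (hψ g hg)) (hasCompactSupport_curl (hψ g hg)
          (hψc g hc)))
    have hwg : ∀ g : R3 → ℝ, ContDiff ℝ ∞ g → HasCompactSupport g →
        Integrable fun x => w x j * g x := fun g hg hc =>
      (((coord j).continuous.comp hw).mul hg.continuous).integrable_of_hasCompactSupport hc.mul_left
    simp_rw [e1, inner_sub_right, real_inner_smul_right] at h1
    rw [integral_sub (hcc g hg hc) ((hcc _ hl hlc).const_mul _), integral_const_mul, key g hg hc,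
      key _ hl hlc] at h1
    simp only [Pi.zero_apply, inner_zero_left, integral_zero] at h1
    simp_rw [laplacian_helmholtz α hg, mul_sub, mul_left_comm _ (α ^ 2)]
    rw [integral_sub (hwg _ hl hlc) ((hwg _ (contDiff_laplacian hl)
      (hasCompactSupport_laplacian hl hlc)).const_mul _), integral_const_mul]
    linarith
  funext x
  exact r3_ext (hcomp 0 x) (hcomp 1 x) (hcomp 2 x)

/-! ### Symmetry of the initial vorticity -/

section equivariance

variable (β : ℝ)

lemma pd_comp_mirror (i : Fin 3) {f : R3 → ℝ} (hf : ContDiff ℝ ∞ f) (x : R3) :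
    pd i (fun x => f (mirror β x)) x =
      fderiv ℝ f (mirror β x) (mirror β (EuclideanSpace.single i 1)) := by
  have := (differentiableAt_of_contDiff hf (mirror β x)).hasFDerivAt.comp x
    (mirror β).toContinuousLinearEquiv.toContinuousLinearMap.hasFDerivAt
  rw [pd, show (fun x => f (mirror β x)) = f ∘ mirror β from rfl]
  exact congrArg (fun L : R3 →L[ℝ] ℝ => L (EuclideanSpace.single i 1)) this.fderiv

lemma pd_zero_comp_mirror {f : R3 → ℝ} (hf : ContDiff ℝ ∞ f) :
    pd 0 (fun x => f (mirror β x)) = fun x =>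
      Real.cos β * pd 0 f (mirror β x) + Real.sin β * pd 1 f (mirror β x) := by
  funext x
  rw [pd_comp_mirror β 0 hf, inner_gradient]
  simp [inner_r3]
  ring

lemma pd_one_comp_mirror {f : R3 → ℝ} (hf : ContDiff ℝ ∞ f) :
    pd 1 (fun x => f (mirror β x)) = fun x =>
      Real.sin β * pd 0 f (mirror β x) - Real.cos β * pd 1 f (mirror β x) := by
  funext x
  rw [pd_comp_mirror β 1 hf, inner_gradient]
  simp [inner_r3]
  ring

lemma pd_two_comp_mirror {f : R3 → ℝ} (hf : ContDiff ℝ ∞ f) :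
    pd 2 (fun x => f (mirror β x)) = fun x => pd 2 f (mirror β x) := by
  funext x
  rw [pd_comp_mirror β 2 hf, inner_gradient]
  simp [inner_r3]

lemma contDiff_comp_mirror {F : Type*} [NormedAddCommGroup F] [NormedSpace ℝ F] {f : R3 → F}
    (hf : ContDiff ℝ ∞ f) : ContDiff ℝ ∞ fun x => f (mirror β x) :=
  hf.comp (mirror β).contDiff

lemma laplacian_comp_mirror {f : R3 → ℝ} (hf : ContDiff ℝ ∞ f) (x : R3) :
    Laplacian.laplacian (fun x => f (mirror β x)) x = Laplacian.laplacian f (mirror β x) := by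
  have h := Real.sin_sq_add_cos_sq β
  have hd : ∀ i, ContDiff ℝ ∞ (pd i f) := fun i => contDiff_pd i hf
  have hm : ∀ i, ContDiff ℝ ∞ fun x => pd i f (mirror β x) := fun i =>
    contDiff_comp_mirror β (hd i)
  rw [laplacian_eq_sum_pd hf, laplacian_eq_sum_pd (contDiff_comp_mirror β hf),
    pd_zero_comp_mirror β hf, pd_one_comp_mirror β hf, pd_two_comp_mirror β hf,
    pd_add 0 (contDiff_const.mul (hm 0)) (contDiff_const.mul (hm 1)),
    pd_sub 1 (contDiff_const.mul (hm 0)) (contDiff_const.mul (hm 1)),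
    pd_const_mul 0 _ (hm 0), pd_const_mul 0 _ (hm 1), pd_const_mul 1 _ (hm 0),
    pd_const_mul 1 _ (hm 1), pd_zero_comp_mirror β (hd 0), pd_zero_comp_mirror β (hd 1),
    pd_one_comp_mirror β (hd 0), pd_one_comp_mirror β (hd 1), pd_two_comp_mirror β (hd 2),
    pd_comm 1 0 hf]
  simp only
  linear_combination (pd 0 (pd 0 f) (mirror β x) + pd 1 (pd 1 f) (mirror β x)) * h

variable {φ : R3 → R3}

lemma contDiff_mirror_comp_mirror (hφ : ContDiff ℝ ∞ φ) :
    ContDiff ℝ ∞ fun x => mirror β (φ (mirror β x)) :=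
  (mirror β).contDiff.comp (contDiff_comp_mirror β hφ)

lemma hasCompactSupport_mirror_comp_mirror (hc : HasCompactSupport φ) :
    HasCompactSupport fun x => mirror β (φ (mirror β x)) :=
  (hc.comp_homeomorph (mirror β).toHomeomorph).comp_left (map_zero (mirror β))

/-- A reflection has determinant `-1` and the curl is a pseudovector, hence the sign. -/
lemma curl_mirror_comp_mirror (hφ : ContDiff ℝ ∞ φ) (x : R3) :
    curl (fun x => mirror β (φ (mirror β x))) x = -mirror β (curl φ (mirror β x)) := by
  have h := Real.sin_sq_add_cos_sq β
  have hc := fun j => contDiff_coord j hφ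
  have hm : ∀ j, ContDiff ℝ ∞ fun x => φ (mirror β x) j := fun j =>
    contDiff_comp_mirror β (hc j)
  rw [curl_eq (contDiff_mirror_comp_mirror β hφ)]
  simp only [mirror_zero_apply, mirror_one_apply, mirror_two_apply]
  have e0 : ∀ i, pd i (fun y => Real.cos β * φ (mirror β y) 0 + Real.sin β * φ (mirror β y) 1) x =
      Real.cos β * pd i (fun y => φ (mirror β y) 0) x +
        Real.sin β * pd i (fun y => φ (mirror β y) 1) x := fun i => by
    rw [pd_add i (contDiff_const.mul (hm 0)) (contDiff_const.mul (hm 1)),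
      pd_const_mul i _ (hm 0), pd_const_mul i _ (hm 1)]
  have e1 : ∀ i, pd i (fun y => Real.sin β * φ (mirror β y) 0 - Real.cos β * φ (mirror β y) 1) x =
      Real.sin β * pd i (fun y => φ (mirror β y) 0) x -
        Real.cos β * pd i (fun y => φ (mirror β y) 1) x := fun i => by
    rw [pd_sub i (contDiff_const.mul (hm 0)) (contDiff_const.mul (hm 1)),
      pd_const_mul i _ (hm 0), pd_const_mul i _ (hm 1)]
  rw [e0, e0, e1, e1]
  simp only [pd_zero_comp_mirror β (hc _), pd_one_comp_mirror β (hc _),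
    pd_two_comp_mirror β (hc _)]
  apply r3_ext <;> simp only [curl_eq hφ, Matrix.cons_val, PiLp.neg_apply, mirror_zero_apply,
    mirror_one_apply, mirror_two_apply]
  · ring
  · ring
  · linear_combination (pd 1 (fun y => φ y 0) (mirror β x) - pd 0 (fun y => φ y 1) (mirror β x)) * h

lemma laplacian_mirror_comp_mirror (hφ : ContDiff ℝ ∞ φ) (x : R3) :
    Laplacian.laplacian (fun x => mirror β (φ (mirror β x))) x =
      mirror β (Laplacian.laplacian φ (mirror β x)) := by
  have e : ∀ j, Laplacian.laplacian (fun x => φ (mirror β x)) x j =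
      Laplacian.laplacian φ (mirror β x) j := fun j => by
    rw [laplacian_apply j (contDiff_comp_mirror β hφ), laplacian_apply j hφ,
      laplacian_comp_mirror β (contDiff_coord j hφ)]
  have := laplacian_clm_comp (mirror β).toContinuousLinearEquiv.toContinuousLinearMap
    (contDiff_comp_mirror β hφ) x
  refine this.trans ?_
  rw [r3_ext (e 0) (e 1) (e 2)]; rfl

end equivariance

lemma ae_eq_zero_of_forall_integral_inner {F : R3 → R3} (hF : LocallyIntegrable F)
    (h : ∀ φ : R3 → R3, ContDiff ℝ ∞ φ → HasCompactSupport φ → ∫ x, ⟪F x, φ x⟫ = 0) :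
    ∀ᵐ x, F x = 0 := by
  refine ae_eq_zero_of_integral_contDiff_smul_eq_zero hF fun g hg hc => ?_
  have hi := hF.integrable_smul_left_of_hasCompactSupport hg.continuous hc
  have hj : ∀ j, (∫ x, g x • F x) j = 0 := fun j => by
    refine ((coord j).integral_comp_comm hi).symm.trans ?_
    have := h (fun x => g x • EuclideanSpace.single j 1) (hg.smul contDiff_const) hc.smul_right
    rw [← this]
    refine integral_congr_ae (ae_of_all _ fun x => ?_)
    simp only [real_inner_smul_right, EuclideanSpace.inner_single_right]
    simp
  exact r3_ext (hj 0) (hj 1) (hj 2)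

/-- The vorticity of an axisymmetric field without swirl is odd under reflections. -/
lemma ae_comp_mirror_eq {α : ℝ} {u q : R3 → R3} (hu : IsAxisymmetricNoSwirl u)
    (hv : IsUnfilteredVorticity α u q) (hq : Integrable q) (β : ℝ) :
    ∀ᵐ x, q (mirror β x) = -mirror β (q x) := by
  have hS := measurePreserving_mirror β
  have hSe : MeasurableEmbedding (mirror β) := (mirror β).toHomeomorph.measurableEmbedding
  have hqS : Integrable fun x => mirror β (q (mirror β x)) :=
    (mirror β).toContinuousLinearEquiv.toContinuousLinearMap.integrable_comp
      (hS.integrable_comp_of_integrable hq)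
  -- The field `mirror β ∘ q ∘ mirror β + q` is tested against `φ`; the vorticity relation is
  -- applied to both `φ` and its reflected field, whose curl has the opposite sign.
  have key := ae_eq_zero_of_forall_integral_inner (hqS.add hq).locallyIntegrable
    fun φ hφ hc => by
      have hφ' := contDiff_mirror_comp_mirror β hφ
      have hc' := hasCompactSupport_mirror_comp_mirror β hc
      have h1 := hv _ hφ' hc'
      have h2 := hv φ hφ hc
      have e1 : ∀ x, ⟪u x, curl (fun x => mirror β (φ (mirror β x))) x -
          α ^ 2 • Laplacian.laplacian (curl fun x => mirror β (φ (mirror β x))) x⟫ =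
          -⟪u (mirror β x), curl φ (mirror β x) -
            α ^ 2 • Laplacian.laplacian (curl φ) (mirror β x)⟫ := fun x => by
        rw [laplacian_curl hφ', curl_mirror_comp_mirror β hφ,
          show Laplacian.laplacian (fun x => mirror β (φ (mirror β x))) =
            fun x => mirror β (Laplacian.laplacian φ (mirror β x)) from
            funext fun x => laplacian_mirror_comp_mirror β hφ x,
          curl_mirror_comp_mirror β (contDiff_laplacian hφ), ← laplacian_curl hφ,
          isAxisymmetricNoSwirl_iff.1 hu β x]
        generalize curl φ (mirror β x) = a
        generalize Laplacian.laplacian (curl φ) (mirror β x) = b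
        rw [← inner_mirror β (u x), ← inner_neg_right]
        congr 1
        simp only [map_sub, map_neg, map_smul, mirror_mirror]
        module
      have e2 := hS.integral_comp hSe fun x =>
        ⟪u x, curl φ x - α ^ 2 • Laplacian.laplacian (curl φ) x⟫
      simp_rw [e1] at h1
      rw [integral_neg, e2, h2] at h1
      have e3 := hS.integral_comp hSe fun x => ⟪q x, mirror β (φ (mirror β x))⟫
      simp only [mirror_mirror] at e3
      obtain ⟨N, hN⟩ := hφ.continuous.bounded_above_of_compact_support hc
      have hi : ∀ {F : R3 → R3}, Integrable F → Integrable fun y => ⟪F y, φ y⟫ := fun hF =>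
        (hF.norm.mul_const N).mono'
          (hF.aestronglyMeasurable.inner hφ.continuous.aestronglyMeasurable)
          (ae_of_all _ fun y => (norm_inner_le_norm _ _).trans
            (mul_le_mul_of_nonneg_left (hN y) (norm_nonneg _)))
      have e4 : ∀ x, ⟪((fun x => mirror β (q (mirror β x))) + q) x, φ x⟫ =
          ⟪mirror β (q (mirror β x)), φ x⟫ + ⟪q x, φ x⟫ := fun x => inner_add_left _ _ _
      simp_rw [e4]
      rw [integral_add (hi hqS) (hi hq)]
      have e5 : ∀ x, ⟪mirror β (q (mirror β x)), φ x⟫ = ⟪q (mirror β x), mirror β (φ x)⟫ :=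
        fun x => by rw [← inner_mirror β (q _), mirror_mirror]
      simp_rw [e5]
      rw [e3, ← h1]; ring
  filter_upwards [key] with x hx
  have hx : mirror β (q (mirror β x)) + q x = 0 := hx
  have := congrArg (mirror β) (eq_neg_of_add_eq_zero_left hx)
  rwa [mirror_mirror, map_neg] at this

/-- A field that is odd under reflections is a swirl. -/
lemma ae_eq_azimuthal_smul {q : R3 → R3} (hq : Integrable q)
    (h : ∀ β, ∀ᵐ x, q (mirror β x) = -mirror β (q x)) :
    ∀ᵐ x, q x = azimuthal q x • eTheta x := by
  -- The reflection fixing `x` depends on `x`, while `h β` holds only off a null set depending on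
  -- `β`. Averages over balls centred at a Lebesgue point avoid the uncountable union: each ball is
  -- invariant under that reflection, so its average is odd, and so is the limit `q x`.
  filter_upwards [IsUnifLocDoublingMeasure.ae_tendsto_average (μ := volume) hq.locallyIntegrable 1,
    ae_cylRadius_ne_zero] with x hx hr
  obtain ⟨β, hβ, hβa⟩ := exists_mirror_fix hr
  refine hβa _ ?_
  have ht : Tendsto (fun δ : ℝ => ⨍ y in Metric.closedBall x δ, q y) (𝓝[>] 0) (𝓝 (q x)) := by
    refine hx (fun _ => x) (fun δ => δ) tendsto_id ?_
    filter_upwards [self_mem_nhdsWithin] with δ hδ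
    have hδ : 0 < δ := hδ
    simpa using hδ.le
  have havg : ∀ δ, mirror β (⨍ y in Metric.closedBall x δ, q y) =
      -⨍ y in Metric.closedBall x δ, q y := fun δ => by
    have hS := measurePreserving_mirror β
    have hSe : MeasurableEmbedding (mirror β) := (mirror β).toHomeomorph.measurableEmbedding
    have h1 := hS.setIntegral_preimage_emb hSe q (Metric.closedBall x δ)
    have hball : mirror β ⁻¹' Metric.closedBall x δ = Metric.closedBall x δ := by
      ext y
      simp only [mem_preimage, Metric.mem_closedBall]
      conv_lhs => rw [← hβ]
      rw [(mirror β).dist_map]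
    rw [hball] at h1
    have h2 : ∫ y in Metric.closedBall x δ, q (mirror β y) =
        -mirror β (∫ y in Metric.closedBall x δ, q y) := by
      have h3 := (mirror β).toContinuousLinearEquiv.toContinuousLinearMap.integral_comp_comm
        (hq.restrict (s := Metric.closedBall x δ))
      change ∫ y in Metric.closedBall x δ, mirror β (q y) = mirror β _ at h3
      rw [← h3, ← integral_neg]
      exact integral_congr_ae (ae_restrict_of_ae (h β))
    rw [setAverage_eq, map_smul, neg_eq_iff_eq_neg.1 (h2.symm.trans h1), smul_neg]
  have h1 := ((mirror β).continuous.tendsto _).comp ht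
  have h2 : (mirror β ∘ fun δ : ℝ => ⨍ y in Metric.closedBall x δ, q y) =
      fun δ => -⨍ y in Metric.closedBall x δ, q y := funext havg
  rw [h2] at h1
  exact tendsto_nhds_unique h1 ht.neg

/-! ### Transported profiles -/

/-- A compactly supported, axisymmetric profile `ζ = q^θ / r` in `L^p`, `p > 3/2`. -/
structure IsVortexProfile (p R : ℝ) (ζ : R3 → ℝ) : Prop where
  exponent : 3 / 2 < p
  radius_nonneg : 0 ≤ R
  integrable : Integrable ζ
  integrable_rpow : Integrable fun z => |ζ z| ^ p
  support : ∀ᵐ z, ζ z ≠ 0 → ‖z‖ ≤ R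
  symm : ∀ β, (fun x => ζ (mirror β x)) =ᵐ[volume] ζ

lemma potVorticity_eq (q : R3 → R3) (x : R3) :
    potVorticity q x = ⟪(cylRadius x)⁻¹ • q x, eTheta x⟫ := by
  rw [potVorticity, azimuthal, real_inner_smul_left, div_eq_inv_mul]

lemma measurable_eTheta : Measurable eTheta := by
  rw [funext eTheta_eq]
  exact continuous_cylRadius.measurable.inv.smul angular.continuous.measurable

lemma norm_eTheta_le (x : R3) : ‖eTheta x‖ ≤ 1 := by
  rw [eTheta_eq, norm_smul, norm_angular, norm_inv, Real.norm_of_nonneg (cylRadius_nonneg x)]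
  exact inv_mul_le_one

lemma inner_eTheta_self {x : R3} (hx : cylRadius x ≠ 0) : ⟪eTheta x, eTheta x⟫ = (1 : ℝ) := by
  rw [real_inner_self_eq_norm_sq, eTheta_eq, norm_smul, norm_angular, norm_inv,
    Real.norm_of_nonneg (cylRadius_nonneg x), inv_mul_cancel₀ hx, one_pow]

lemma potVorticity_smul_angular (ζ : ℝ) {q : R3 → R3} {x : R3} (hq : q x = ζ • angular x)
    (hx : cylRadius x ≠ 0) : potVorticity q x = ζ := by
  have : angular x = cylRadius x • eTheta x := by
    rw [eTheta_eq, smul_smul, mul_inv_cancel₀ hx, one_smul]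
  rw [potVorticity, azimuthal, hq, this, real_inner_smul_left, real_inner_smul_left,
    inner_eTheta_self hx]
  field_simp

lemma eq_potVorticity_smul_angular {q : R3 → R3} {x : R3} (hq : q x = azimuthal q x • eTheta x) :
    q x = potVorticity q x • angular x := by
  conv_lhs => rw [hq]
  rw [potVorticity, eTheta_eq, smul_smul, div_eq_mul_inv]

lemma memLp_potVorticity {p : ℝ≥0∞} {q : R3 → R3}
    (hq : MemLp (fun x => (cylRadius x)⁻¹ • q x) p volume) : MemLp (potVorticity q) p volume := by
  refine hq.of_le ?_ (ae_of_all _ fun x => ?_)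
  · rw [funext (potVorticity_eq q)]
    exact hq.aestronglyMeasurable.inner measurable_eTheta.aestronglyMeasurable
  · rw [potVorticity_eq]
    exact (norm_inner_le_norm _ _).trans (mul_le_of_le_one_right (norm_nonneg _) (norm_eTheta_le x))

lemma memLp_of_le_of_support {F : Type*} [NormedAddCommGroup F] {p s : ℝ≥0∞} {f : R3 → F}
    (hf : MemLp f p volume) (hsp : s ≤ p) {R : ℝ} (hR : ∀ᵐ x, f x ≠ 0 → ‖x‖ ≤ R) :
    MemLp f s volume := by
  have he : (Metric.closedBall (0 : R3) R).indicator f =ᵐ[volume] f := by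
    filter_upwards [hR] with x hx
    by_cases h : x ∈ Metric.closedBall (0 : R3) R
    · rw [indicator_of_mem h]
    · rw [indicator_of_notMem h]
      by_contra h0
      exact h (by simpa using hx (Ne.symm h0))
  refine MemLp.ae_eq he (MemLp.mono_exponent_of_measure_support_ne_top (hf.ae_eq he.symm)
    (s := Metric.closedBall 0 R) (fun x hx => indicator_of_notMem hx _)
    measure_closedBall_lt_top.ne hsp)

section IsVortexProfile

variable {α p R : ℝ} {ζ : R3 → ℝ}

lemma kernelConv_eq_velocity_id (α : ℝ) (ζ : R3 → ℝ) :
    (kernelConv α fun x => ζ x • angular x) = velocity α ζ id := by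
  funext x
  simp only [kernelConv, velocity, cross_smul_right, id]

lemma IsVortexProfile.norm_velocity_sub_le (h : IsVortexProfile p R ζ) (hα : 0 < α)
    {m : R3 → R3} (hm : MeasurePreserving m volume volume) {B : ℝ} (hB0 : 0 ≤ B)
    (hB : ∀ᵐ z, ζ z ≠ 0 → ‖m z‖ ≤ B) (x x' : R3) :
    ‖velocity α ζ m x - velocity α ζ m x'‖ ≤ velocityLip α p ζ B * ‖x - x'‖ := by
  simpa using EulerAlpha.norm_velocity_sub_le hα h.exponent h.integrable h.integrable_rpow hm
    hm.measurable hB0 hB hB (δ := 0) (by simp) x x'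

lemma IsVortexProfile.lipschitzWith_velocity (h : IsVortexProfile p R ζ) (hα : 0 < α)
    {m : R3 → R3} (hm : MeasurePreserving m volume volume) {B : ℝ} (hB0 : 0 ≤ B)
    (hB : ∀ᵐ z, ζ z ≠ 0 → ‖m z‖ ≤ B) :
    LipschitzWith ⟨_, velocityLip_nonneg hα p ζ hB0⟩ (velocity α ζ m) :=
  LipschitzWith.of_dist_le_mul fun x y => by
    rw [dist_eq_norm, dist_eq_norm]; exact h.norm_velocity_sub_le hα hm hB0 hB x y

lemma IsVortexProfile.integrable_smul_angular (h : IsVortexProfile p R ζ) :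
    Integrable fun x => ζ x • angular x := by
  refine (h.integrable.abs.mul_const R).mono'
    (h.integrable.aestronglyMeasurable.smul angular.continuous.aestronglyMeasurable) ?_
  filter_upwards [h.support] with x hx
  rw [norm_smul, Real.norm_eq_abs]
  by_cases h : ζ x = 0
  · simp [h]
  exact mul_le_mul_of_nonneg_left ((norm_angular_le x).trans (hx h)) (abs_nonneg _)

lemma IsVortexProfile.isUnfilteredVorticity (h : IsVortexProfile p R ζ) (hα : 0 < α) :
    IsUnfilteredVorticity α (kernelConv α fun x => ζ x • angular x) fun x => ζ x • angular x :=
  isUnfilteredVorticity_kernelConv hα h.integrable h.support h.symm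

/-- A decaying velocity field is determined by its unfiltered vorticity. -/
lemma IsVortexProfile.eq_kernelConv (h : IsVortexProfile p R ζ) (hα : 0 < α) {u q : R3 → R3}
    (hcont : Continuous u) (hdecay : Tendsto u (cocompact R3) (𝓝 0)) (hdiv : IsWeaklyDivFree u)
    (hv : IsUnfilteredVorticity α u q) (hq : ∀ᵐ x, q x = ζ x • angular x) :
    u = kernelConv α fun x => ζ x • angular x := by
  have hi := h.integrable_smul_angular
  set w := kernelConv α fun x => ζ x • angular x with hw
  have hwc : Continuous w := by
    rw [hw, kernelConv_eq_velocity_id]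
    exact (h.lipschitzWith_velocity hα (MeasurePreserving.id volume) h.radius_nonneg
      h.support).continuous
  have hint : ∀ v Ψ : R3 → R3, Continuous v → Continuous Ψ → HasCompactSupport Ψ →
      Integrable fun x => ⟪v x, Ψ x⟫ := fun v Ψ hv hΨ hc =>
    (hv.inner hΨ).integrable_of_hasCompactSupport (hc.mono fun x hx h => hx (by simp [h]))
  have hz : (fun x => u x - w x) = 0 := by
    refine eq_zero_of_isUnfilteredVorticity_zero hα (hcont.sub hwc)
      (by simpa using hdecay.sub (tendsto_kernelConv_cocompact hα hi)) ?_ ?_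
    · intro φ hφ hc
      have h1 := hdiv φ hφ hc
      have h2 := isWeaklyDivFree_kernelConv hα hi φ hφ hc
      simp_rw [map_sub]
      have hi' : ∀ v : R3 → R3, Continuous v → Integrable fun x => fderiv ℝ φ x (v x) :=
        fun v hv => ((hφ.continuous_fderiv (by simp)).clm_apply
          hv).integrable_of_hasCompactSupport
          ((hc.fderiv (𝕜 := ℝ)).mono fun x hx h => hx (by simp [h]))
      rw [integral_sub (hi' u hcont) (hi' w hwc), h1, h2, sub_zero]
    · intro φ hφ hc
      have h1 := hv φ hφ hc
      have h2 := h.isUnfilteredVorticity hα φ hφ hc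
      have hΨ : Continuous fun x => curl φ x - α ^ 2 • Laplacian.laplacian (curl φ) x := by
          have h1 := (contDiff_curl hφ).continuous
          have h2 := (contDiff_laplacian (contDiff_curl hφ)).continuous
          fun_prop
      have hΨc : HasCompactSupport fun x => curl φ x - α ^ 2 • Laplacian.laplacian (curl φ) x :=
        (hasCompactSupport_curl hφ hc).sub
          ((hasCompactSupport_laplacian (contDiff_curl hφ)
            (hasCompactSupport_curl hφ hc)).comp_left (smul_zero (α ^ 2)))
      simp_rw [inner_sub_left]
      rw [integral_sub (hint u _ hcont hΨ hΨc) (hint w _ hwc hΨ hΨc), h1, h2]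
      simp only [Pi.zero_apply, inner_zero_left, integral_zero]
      rw [sub_eq_zero]
      refine integral_congr_ae ?_
      filter_upwards [hq] with x hx
      rw [hx]
  funext x
  exact sub_eq_zero.1 (congrFun hz x)

end IsVortexProfile

/-- The structure of the initial data. -/
theorem exists_isVortexProfile {α : ℝ} (hα : 0 < α) {p : ℝ≥0∞} (hp : 3 / 2 < p)
    {u₀ q₀ : R3 → R3} (hcont : Continuous u₀) (hdecay : Tendsto u₀ (cocompact R3) (𝓝 0))
    (hdiv : IsWeaklyDivFree u₀) (haxi : IsAxisymmetricNoSwirl u₀)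
    (hv : IsUnfilteredVorticity α u₀ q₀)
    (hLp : MemLp (fun x => (cylRadius x)⁻¹ • q₀ x) p volume)
    (hsupp : ∃ R : ℝ, ∀ᵐ x : R3, R ≤ ‖x‖ → q₀ x = 0) :
    ∃ p' R : ℝ, IsVortexProfile p' R (potVorticity q₀) ∧
      MemLp (potVorticity q₀) p volume ∧
      (∀ᵐ x, q₀ x = potVorticity q₀ x • angular x) ∧
      u₀ = kernelConv α fun x => potVorticity q₀ x • angular x := by
  obtain ⟨R₀, hR₀⟩ := hsupp
  set R := max R₀ 0
  have hR : ∀ᵐ x, q₀ x ≠ 0 → ‖x‖ ≤ R := by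
    filter_upwards [hR₀] with x hx h
    by_contra! hc
    exact h (hx ((le_max_left _ _).trans hc.le))
  have hp1 : 1 ≤ p := by
    refine le_trans ?_ hp.le
    rw [ENNReal.le_div_iff_mul_le (by simp) (by simp)]; norm_num
  have hF1 : Integrable fun x => (cylRadius x)⁻¹ • q₀ x :=
    memLp_one_iff_integrable.1 (memLp_of_le_of_support hLp hp1 (R := R) (by
      filter_upwards [hR] with x hx h
      exact hx (right_ne_zero_of_smul h)))
  have hq₀ : Integrable q₀ := by
    -- Only `q₀ / r` is assumed integrable to some power; `r` is bounded on the support.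
    have hq : q₀ =ᵐ[volume] fun x => cylRadius x • ((cylRadius x)⁻¹ • q₀ x) := by
      filter_upwards [ae_cylRadius_ne_zero] with x hx
      rw [smul_smul, mul_inv_cancel₀ hx, one_smul]
    refine Integrable.congr ?_ hq.symm
    refine (hF1.norm.const_mul R).mono'
      (continuous_cylRadius.aestronglyMeasurable.smul hF1.aestronglyMeasurable) ?_
    filter_upwards [hR] with x hx
    by_cases h : q₀ x = 0
    · simp [h]
    rw [norm_smul, Real.norm_of_nonneg (cylRadius_nonneg x)]
    exact mul_le_mul_of_nonneg_right ((cylRadius_le_norm x).trans (hx h)) (norm_nonneg _)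
  have hmir := ae_comp_mirror_eq haxi hv hq₀
  have haz := ae_eq_azimuthal_smul hq₀ hmir
  have hζLp := memLp_potVorticity hLp
  have hζsupp : ∀ᵐ z, potVorticity q₀ z ≠ 0 → ‖z‖ ≤ R := by
    filter_upwards [hR] with x hx h
    refine hx fun h0 => h ?_
    simp [potVorticity, azimuthal, h0]
  have hζ1 : Integrable (potVorticity q₀) :=
    memLp_one_iff_integrable.1 (memLp_of_le_of_support hζLp hp1 hζsupp)
  -- A finite exponent still above `3/2`, available by compact support even when `p = ∞`.
  set s : ℝ≥0∞ := min p 2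
  have hs2 : s ≤ 2 := min_le_right _ _
  have hsfin : s ≠ ⊤ := ne_top_of_le_ne_top (by simp) hs2
  have hs : 3 / 2 < s := lt_min hp (by
    rw [ENNReal.div_lt_iff (by simp) (by simp)]; norm_num)
  have hs0 : s ≠ 0 := (bot_lt_of_lt hs).ne'
  have hsr : 3 / 2 < s.toReal := by
    have := (ENNReal.toReal_lt_toReal (ENNReal.div_ne_top (by simp) (by simp)) hsfin).2 hs
    simpa using this
  have hrpow : Integrable fun z => |potVorticity q₀ z| ^ s.toReal := by
    have := (memLp_of_le_of_support hζLp (min_le_left p 2) hζsupp).integrable_norm_rpow hs0 hsfin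
    simpa using this
  have hqζ : ∀ᵐ x, q₀ x = potVorticity q₀ x • angular x := by
    filter_upwards [haz] with x hx using eq_potVorticity_smul_angular hx
  have hprof : IsVortexProfile s.toReal R (potVorticity q₀) := by
    refine ⟨hsr, le_max_right _ _, hζ1, hrpow, hζsupp, fun β => ?_⟩
    filter_upwards [hmir β] with x hx
    rw [potVorticity, potVorticity, azimuthal, azimuthal, hx, cylRadius_mirror, eTheta_mirror,
      inner_neg_neg, inner_mirror]
  exact ⟨s.toReal, R, hprof, hζLp, hqζ, hprof.eq_kernelConv hα hcont hdecay hdiv hv hqζ⟩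

/-! ### Lagrangian solutions -/

/-- The nearest time in `[0, T]`. -/
def clampTime (T t : ℝ) : ℝ := max 0 (min T t)

lemma clampTime_mem {T : ℝ} (hT : 0 ≤ T) (t : ℝ) : clampTime T t ∈ Icc 0 T :=
  ⟨le_max_left _ _, max_le hT (min_le_left _ _)⟩

lemma clampTime_of_mem {T t : ℝ} (ht : t ∈ Icc 0 T) : clampTime T t = t := by
  rw [clampTime, min_eq_right ht.2, max_eq_right ht.1]

lemma abs_clampTime_sub_le (T s t : ℝ) : |clampTime T s - clampTime T t| ≤ |s - t| := by
  have h1 := abs_max_sub_max_le_abs (min T s) (min T t) 0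
  have h2 := abs_min_sub_min_le_max T s T t
  rw [clampTime, clampTime, max_comm 0, max_comm 0]
  refine h1.trans (h2.trans ?_)
  simp

/-! ### Comparison of flows in an exponentially weighted norm. -/

section comparison

variable {K K' : ℝ≥0} {M M' T : ℝ} {u u' : ℝ → R3 → R3} {Y Y' : ℝ → R3 ≃ₜ R3}

/-- Comparison of the flows of two velocities. -/
lemma IsFlow.norm_sub_le_of_velocity (hu : IsRegularVelocity K M u) (hK : 0 < K) (hY : IsFlow u Y)
    (hY' : IsFlow u' Y') {κ : ℝ} (hκ : 0 < κ)
    (h : ∀ t ∈ Icc 0 T, ∀ x, ‖u t x - u' t x‖ ≤ K * (κ * Real.exp (4 * K * t))) :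
    ∀ t ∈ Icc 0 T, ∀ x, ‖Y t x - Y' t x‖ ≤ κ / 2 * Real.exp (4 * K * t) := by
  intro t ht x
  have hd : ∀ t, HasDerivAt (fun t => Y t x - Y' t x) (u t (Y t x) - u' t (Y' t x)) t := fun t =>
    (hY.hasDerivAt x t).fun_sub (hY'.hasDerivAt x t)
  have hK' : (0 : ℝ) < K := hK
  -- On contact with the barrier the derivative is at most `(3/2) K κ e^{4Kt}`, while the barrier
  -- grows at the rate `2 K κ e^{4Kt}`. The weight `4 K` is what buys the factor `1/2` in the
  -- conclusion.
  refine image_norm_le_of_norm_deriv_right_lt_deriv_boundary (a := 0) (b := T)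
    (f := fun t => Y t x - Y' t x)
    (f' := fun t => u t (Y t x) - u' t (Y' t x))
    (B := fun t => κ / 2 * Real.exp (4 * K * t))
    (B' := fun t => κ / 2 * (Real.exp (4 * K * t) * (4 * K)))
    (fun t _ => (hd t).continuousAt.continuousWithinAt) (fun t _ => (hd t).hasDerivWithinAt)
    ?_ (fun t => ?_) (fun t ht heq => ?_) ht
  · rw [hY.zero, hY'.zero, sub_self, norm_zero]; positivity
  · simpa using (((hasDerivAt_id t).const_mul (4 * (K : ℝ))).exp).const_mul (κ / 2)
  · have h1 := hu.norm_sub_le t (Y t x) (Y' t x)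
    have h2 := h t (Ico_subset_Icc_self ht) (Y' t x)
    have h3 : ‖u t (Y t x) - u' t (Y' t x)‖ ≤ K * ‖Y t x - Y' t x‖ +
        K * (κ * Real.exp (4 * K * t)) := by
      calc _ = ‖(u t (Y t x) - u t (Y' t x)) + (u t (Y' t x) - u' t (Y' t x))‖ := by
            congr 1; abel
        _ ≤ _ := (norm_add_le _ _).trans (add_le_add h1 h2)
    have heq : ‖Y t x - Y' t x‖ = κ / 2 * Real.exp (4 * K * t) := heq
    rw [heq] at h3
    have : 0 < K * (κ * Real.exp (4 * K * t)) := by positivity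
    calc _ ≤ _ := h3
      _ < κ / 2 * (Real.exp (4 * K * t) * (4 * K)) := by nlinarith

end comparison

/-- The velocity generated by the profile `ζ` transported by `y`. -/
def lagVelocity (α T : ℝ) (ζ : R3 → ℝ) (y : ℝ → R3 ≃ₜ R3) (t : ℝ) (x : R3) : R3 :=
  velocity α ζ (y (clampTime T t)) x

/-- A curve of volume preserving maps, Lipschitz in time and bounded on the support of `ζ`. -/
structure IsParticleMap (T B M : ℝ) (ζ : R3 → ℝ) (y : ℝ → R3 ≃ₜ R3) : Prop where
  measurePreserving : ∀ t ∈ Icc 0 T, MeasurePreserving (y t) volume volume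
  bound : ∀ t ∈ Icc 0 T, ∀ᵐ z, ζ z ≠ 0 → ‖y t z‖ ≤ B
  time : ∀ s ∈ Icc 0 T, ∀ t ∈ Icc 0 T, ∀ z, ‖y t z - y s z‖ ≤ M * |t - s|

/-- A Lipschitz constant for `lagVelocity`. -/
def lagLip (α p : ℝ) (ζ : R3 → ℝ) (B : ℝ) : ℝ≥0 := (velocityLip α p ζ B).toNNReal + 1

/-- The `+ 1` in `lagLip` serves this purpose: the comparison of flows and the divisions by `K` need
a positive constant. -/
lemma lagLip_pos (α p : ℝ) (ζ : R3 → ℝ) (B : ℝ) : 0 < lagLip α p ζ B := by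
  unfold lagLip; positivity

lemma velocityLip_le_lagLip (α p : ℝ) (ζ : R3 → ℝ) (B : ℝ) :
    velocityLip α p ζ B ≤ lagLip α p ζ B := by
  have := Real.le_coe_toNNReal (velocityLip α p ζ B)
  simp only [lagLip, NNReal.coe_add, NNReal.coe_one]
  linarith

section lagrangian

variable {α p R T B M M' : ℝ} {ζ : R3 → ℝ} {y y' : ℝ → R3 ≃ₜ R3}

/-- `velocity` is `K_α * q`, where `q` is the transported vorticity. -/
lemma velocity_eq_kernelConv (ζ : R3 → ℝ) {m : R3 ≃ₜ R3}
    (hm : MeasurePreserving m volume volume) (α : ℝ) :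
    velocity α ζ m = kernelConv α fun x => ζ (m.symm x) • angular x := by
  funext x
  have h := hm.integral_comp m.measurableEmbedding fun y =>
    cross (gradGreen α (x - y)) (ζ (m.symm y) • angular y)
  simp only [Homeomorph.symm_apply_apply] at h
  rw [kernelConv, ← h, velocity]
  simp only [cross_smul_right]

lemma measurePreserving_symm {m : R3 ≃ₜ R3} (hm : MeasurePreserving m volume volume) :
    MeasurePreserving m.symm volume volume :=
  MeasurePreserving.symm m.toMeasurableEquiv hm

/-- Transport of a profile by a volume preserving map. -/
lemma IsVortexProfile.comp_symm (h : IsVortexProfile p R ζ) {m : R3 ≃ₜ R3}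
    (hm : MeasurePreserving m volume volume) (hB0 : 0 ≤ B) (hB : ∀ᵐ z, ζ z ≠ 0 → ‖m z‖ ≤ B)
    (hsymm : ∀ β x, m (mirror β x) = mirror β (m x)) :
    IsVortexProfile p B fun x => ζ (m.symm x) := by
  have hm' := measurePreserving_symm hm
  refine ⟨h.exponent, hB0, hm'.integrable_comp_of_integrable h.integrable,
    hm'.integrable_comp_of_integrable h.integrable_rpow, ?_, fun β => ?_⟩
  · filter_upwards [hm'.quasiMeasurePreserving.ae hB] with x hx h0
    simpa using hx h0
  · have e : ∀ x, m.symm (mirror β x) = mirror β (m.symm x) := fun x => by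
      rw [Homeomorph.symm_apply_eq, hsymm, Homeomorph.apply_symm_apply]
    simp only [e]
    exact hm'.quasiMeasurePreserving.ae_eq_comp (h.symm β)

lemma IsVortexProfile.integrable_comp_symm_smul (h : IsVortexProfile p R ζ) {m : R3 ≃ₜ R3}
    (hm : MeasurePreserving m volume volume) (hB : ∀ᵐ z, ζ z ≠ 0 → ‖m z‖ ≤ B) :
    Integrable fun x => ζ (m.symm x) • angular x := by
  have hm' := measurePreserving_symm hm
  have hi := hm'.integrable_comp_of_integrable h.integrable
  refine (hi.abs.mul_const B).mono'
    (hi.aestronglyMeasurable.smul angular.continuous.aestronglyMeasurable) ?_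
  filter_upwards [hm'.quasiMeasurePreserving.ae hB] with x hx
  rw [norm_smul, Real.norm_eq_abs]
  by_cases h : ζ (m.symm x) = 0
  · simp [h]
  have := hx h
  rw [Homeomorph.apply_symm_apply] at this
  exact mul_le_mul_of_nonneg_left ((norm_angular_le x).trans this) (abs_nonneg _)

lemma IsVortexProfile.isWeaklyDivFree_velocity (h : IsVortexProfile p R ζ) (hα : 0 < α)
    {m : R3 ≃ₜ R3} (hm : MeasurePreserving m volume volume)
    (hB : ∀ᵐ z, ζ z ≠ 0 → ‖m z‖ ≤ B) : IsWeaklyDivFree (velocity α ζ m) := by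
  rw [velocity_eq_kernelConv ζ hm]
  exact isWeaklyDivFree_kernelConv hα (h.integrable_comp_symm_smul hm hB)

/-- The dependence of the velocity on the particle map. -/
lemma IsParticleMap.norm_lagVelocity_sub_le (hζ : IsVortexProfile p R ζ) (hα : 0 < α) (hT : 0 ≤ T)
    (hB0 : 0 ≤ B) (hy : IsParticleMap T B M ζ y) (hy' : IsParticleMap T B M' ζ y') {s t δ : ℝ}
    (hδ : ∀ z, ‖y (clampTime T t) z - y' (clampTime T s) z‖ ≤ δ) (x x' : R3) :
    ‖lagVelocity α T ζ y t x - lagVelocity α T ζ y' s x'‖ ≤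
      lagLip α p ζ B * (‖x - x'‖ + δ) := by
  have ht := clampTime_mem hT t
  have hs := clampTime_mem hT s
  have hδ0 : 0 ≤ δ := (norm_nonneg _).trans (hδ 0)
  refine (EulerAlpha.norm_velocity_sub_le hα hζ.exponent hζ.integrable hζ.integrable_rpow
    (hy.measurePreserving _ ht) (hy'.measurePreserving _ hs).measurable hB0 (hy.bound _ ht)
    (hy'.bound _ hs) hδ x x').trans ?_
  gcongr
  exact velocityLip_le_lagLip α p ζ B

/-- Time regularity comes from the Lipschitz dependence on the map together with the speed bound
`M`. Clamping makes the field global in time. -/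
lemma IsParticleMap.isRegularVelocity (hζ : IsVortexProfile p R ζ) (hα : 0 < α) (hT : 0 ≤ T)
    (hB0 : 0 ≤ B) (hM : 0 ≤ M) (hy : IsParticleMap T B M ζ y) :
    IsRegularVelocity (lagLip α p ζ B) (kernelBound α * (∫ z, |ζ z|) * B)
      (lagVelocity α T ζ y) := by
  refine ⟨fun t => LipschitzWith.of_dist_le_mul fun x x' => ?_, fun t x =>
    norm_velocity_le hα hζ.integrable (hy.bound _ (clampTime_mem hT t)) x, fun ε hε => ?_⟩
  · rw [dist_eq_norm, dist_eq_norm]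
    simpa using hy.norm_lagVelocity_sub_le hζ hα hT hB0 hy (s := t) (t := t) (δ := 0) (by simp) x x'
  · have hL : (0 : ℝ) < lagLip α p ζ B := lagLip_pos α p ζ B
    refine ⟨ε / (lagLip α p ζ B * (M + 1)), by positivity, fun s t hst x => ?_⟩
    refine (hy.norm_lagVelocity_sub_le hζ hα hT hB0 hy (δ := M * |s - t|) (fun z =>
      (hy.time _ (clampTime_mem hT t) _ (clampTime_mem hT s) z).trans
        (mul_le_mul_of_nonneg_left (abs_clampTime_sub_le T s t) hM)) x x).trans ?_
    rw [lt_div_iff₀ (by positivity)] at hst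
    have := abs_nonneg (s - t)
    rw [sub_self, norm_zero, zero_add]
    nlinarith

/-- Lagrangian solutions are unique. -/
theorem lagrangian_unique (hζ : IsVortexProfile p R ζ) (hα : 0 < α) (hT : 0 ≤ T) (hB0 : 0 ≤ B)
    (hM : 0 ≤ M) (hy : IsParticleMap T B M ζ y) (hy' : IsParticleMap T B M ζ y')
    (hf : IsFlow (lagVelocity α T ζ y) y) (hf' : IsFlow (lagVelocity α T ζ y') y') :
    ∀ t ∈ Icc 0 T, ∀ x, y t x = y' t x := by
  have hu := hy.isRegularVelocity hζ hα hT hB0 hM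
  set K := lagLip α p ζ B with hK
  have hK0 : 0 < K := lagLip_pos α p ζ B
  have h0T : (0 : ℝ) ∈ Icc 0 T := ⟨le_rfl, hT⟩
  -- The weighted distance halves at each step, so it is zero. The initial bound is `2 M T`; the
  -- extra `1` keeps it positive.
  have key : ∀ n : ℕ, ∀ t ∈ Icc 0 T, ∀ x, ‖y t x - y' t x‖ ≤
      (2 * M * T + 1) / 2 ^ n * Real.exp (4 * K * t) := by
    intro n
    induction n with
    | zero =>
      intro t ht x
      have h1 := hy.time 0 h0T t ht x
      have h2 := hy'.time 0 h0T t ht x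
      rw [hf.zero] at h1
      rw [hf'.zero] at h2
      rw [sub_zero, abs_of_nonneg ht.1] at h1 h2
      have h3 : ‖y t x - y' t x‖ ≤ M * t + M * t := by
        calc _ = ‖(y t x - x) - (y' t x - x)‖ := by congr 1; abel
          _ ≤ _ := (_root_.norm_sub_le _ _).trans (add_le_add h1 h2)
      have h4 : M * t ≤ M * T := mul_le_mul_of_nonneg_left ht.2 hM
      have h5 : 1 ≤ Real.exp (4 * K * t) := Real.one_le_exp (by have := ht.1; positivity)
      have h6 : 0 ≤ M * T := mul_nonneg hM hT
      rw [pow_zero, div_one]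
      nlinarith
    | succ n ih =>
      have := hf.norm_sub_le_of_velocity hu hK0 hf' (T := T) (κ := (2 * M * T + 1) / 2 ^ n)
        (by have := mul_nonneg hM hT; positivity) (fun t ht x => by
          have h1 := hy.norm_lagVelocity_sub_le hζ hα hT hB0 hy' (s := t) (t := t)
            (δ := (2 * M * T + 1) / 2 ^ n * Real.exp (4 * K * t))
            (fun z => by rw [clampTime_of_mem ht]; exact ih t ht z) x x
          simpa using h1)
      intro t ht x
      refine (this t ht x).trans_eq ?_
      rw [pow_succ]; ring
  intro t ht x
  rw [← sub_eq_zero, ← norm_le_zero_iff]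
  have hlim : Tendsto (fun n : ℕ => (2 * M * T + 1) / 2 ^ n * Real.exp (4 * K * t)) atTop
      (𝓝 (0 * Real.exp (4 * K * t))) := by
    refine Tendsto.mul_const _ ?_
    have := (tendsto_pow_atTop_nhds_zero_of_lt_one (r := (1 / 2 : ℝ)) (by norm_num)
      (by norm_num)).const_mul (2 * M * T + 1)
    rw [mul_zero] at this
    refine this.congr fun n => ?_
    rw [one_div, inv_pow, div_eq_mul_inv]
  rw [zero_mul] at hlim
  exact ge_of_tendsto' hlim fun n => key n t ht x

end lagrangian

/-! ### Existence of Lagrangian solutions -/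

/-- Curves of volume preserving maps obeying the a priori bounds of Lagrangian solutions. -/
structure IsAdmissible (T C R M : ℝ) (y : ℝ → R3 ≃ₜ R3) : Prop where
  measurePreserving : ∀ t ∈ Icc 0 T, MeasurePreserving (y t) volume volume
  bound : ∀ t ∈ Icc 0 T, ∀ z, ‖y t z - z‖ ≤ R * (Real.exp (C * t) - 1)
  time : ∀ s ∈ Icc 0 T, ∀ t ∈ Icc 0 T, ∀ z, ‖y t z - y s z‖ ≤ M * |t - s|

lemma IsWeaklyDivFree.of_tendsto {w : R3 → R3} {v : ℕ → R3 → R3} {M : ℝ}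
    (hv : ∀ n, IsWeaklyDivFree (v n)) (hc : ∀ n, Continuous (v n)) (hM : ∀ n x, ‖v n x‖ ≤ M)
    (h : ∀ x, Tendsto (fun n => v n x) atTop (𝓝 (w x))) : IsWeaklyDivFree w := by
  intro φ hφ hφc
  have hd : Continuous (fderiv ℝ φ) := hφ.continuous_fderiv (by simp)
  have hint : Integrable (fderiv ℝ φ) := hd.integrable_of_hasCompactSupport (hφc.fderiv ℝ)
  have hlim := tendsto_integral_of_dominated_convergence (μ := volume)
    (F := fun n x => fderiv ℝ φ x (v n x)) (f := fun x => fderiv ℝ φ x (w x))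
    (fun x => ‖fderiv ℝ φ x‖ * M) (fun n => (hd.clm_apply (hc n)).aestronglyMeasurable)
    (hint.norm.mul_const M) (fun n => ae_of_all _ fun x => (ContinuousLinearMap.le_opNorm _ _).trans
      (mul_le_mul_of_nonneg_left (hM n x) (norm_nonneg _)))
    (ae_of_all _ fun x => ((fderiv ℝ φ x).continuous.tendsto _).comp (h x))
  exact tendsto_nhds_unique hlim (by simp [hv _ φ hφ hφc])

variable {α p R T C M : ℝ} {ζ : R3 → ℝ} {y : ℝ → R3 ≃ₜ R3}

lemma IsAdmissible.norm_le (hy : IsAdmissible T C R M y) (hζ : IsVortexProfile p R ζ) {t : ℝ}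
    (ht : t ∈ Icc 0 T) : ∀ᵐ z, ζ z ≠ 0 → ‖y t z‖ ≤ R * Real.exp (C * t) := by
  filter_upwards [hζ.support] with z hz h0
  have h1 := hy.bound t ht z
  have h2 := norm_le_norm_add_norm_sub' (y t z) z
  linarith [hz h0]

lemma IsAdmissible.isParticleMap (hy : IsAdmissible T C R M y) (hζ : IsVortexProfile p R ζ)
    (hC : 0 ≤ C) : IsParticleMap T (R * Real.exp (C * T)) M ζ y := by
  refine ⟨hy.measurePreserving, fun t ht => ?_, hy.time⟩
  filter_upwards [hy.norm_le hζ ht] with z hz h0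
  refine (hz h0).trans ?_
  have := hζ.radius_nonneg
  have := ht.2
  gcongr

/-- The a priori bounds reproduce themselves. On the support the old map is at most `R e^{Ct}` in
norm, so the velocity is at most `C R e^{Ct}`, and integrating gives back the displacement `R
(e^{Ct} - 1)`. -/
lemma IsAdmissible.of_isFlow (hζ : IsVortexProfile p R ζ) (hα : 0 < α) (hT : 0 < T)
    (hC : C = kernelBound α * ∫ z, |ζ z|) (hC0 : 0 ≤ C) (hM : M = C * (R * Real.exp (C * T)))
    (hy : IsAdmissible T C R M y) {Y : ℝ → R3 ≃ₜ R3} (hY : IsFlow (lagVelocity α T ζ y) Y) :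
    IsAdmissible T C R M Y := by
  have hR := hζ.radius_nonneg
  have hB0 : 0 ≤ R * Real.exp (C * T) := by positivity
  have hM0 : 0 ≤ M := by rw [hM]; positivity
  have hP := hy.isParticleMap hζ hC0
  have hu := hP.isRegularVelocity hζ hα hT.le hB0 hM0
  rw [← hC, ← hM] at hu
  refine ⟨fun t ht => hY.measurePreserving hu hT (fun t ht => hζ.isWeaklyDivFree_velocity hα
    (hP.measurePreserving _ (clampTime_mem hT.le t)) (hP.bound _ (clampTime_mem hT.le t))) ht,
    fun t ht z => ?_, fun s _ t _ z => hY.norm_time_sub_le hu s t z⟩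
  refine image_norm_le_of_norm_deriv_right_le_deriv_boundary (a := 0) (b := T)
    (f := fun t => Y t z - z) (f' := fun t => lagVelocity α T ζ y t (Y t z))
    (B := fun t => R * (Real.exp (C * t) - 1)) (B' := fun t => R * (Real.exp (C * t) * C))
    (fun t _ => ((hY.hasDerivAt z t).sub_const z).continuousAt.continuousWithinAt)
    (fun t _ => ((hY.hasDerivAt z t).sub_const z).hasDerivWithinAt) ?_ (fun t => ?_)
    (fun t ht => ?_) ht
  · simp [hY.zero]
  · simpa using ((((hasDerivAt_id t).const_mul C).exp).sub_const 1).const_mul R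
  · have ht' := Ico_subset_Icc_self ht
    refine (norm_velocity_le hα hζ.integrable (hy.norm_le hζ (clampTime_mem hT.le t)) _).trans_eq ?_
    rw [← hC, clampTime_of_mem ht']; ring

/-- Lagrangian solutions exist. -/
theorem exists_lagrangian (hζ : IsVortexProfile p R ζ) (hα : 0 < α) (hT : 0 < T) :
    ∃ (B M : ℝ) (Y : ℝ → R3 ≃ₜ R3), 0 ≤ B ∧ 0 ≤ M ∧ IsParticleMap T B M ζ Y ∧
      IsFlow (lagVelocity α T ζ Y) Y := by
  obtain ⟨C, hC⟩ : ∃ C, C = kernelBound α * ∫ z, |ζ z| := ⟨_, rfl⟩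
  have hC0 : 0 ≤ C := by
    rw [hC]; exact mul_nonneg (kernelBound_pos hα).le (integral_nonneg fun _ => abs_nonneg _)
  obtain ⟨M, hM⟩ : ∃ M, M = C * (R * Real.exp (C * T)) := ⟨_, rfl⟩
  have hR := hζ.radius_nonneg
  have hB0 : 0 ≤ R * Real.exp (C * T) := by positivity
  have hM0 : 0 ≤ M := by rw [hM]; positivity
  set K := lagLip α p ζ (R * Real.exp (C * T)) with hK
  have hK0 : (0 : ℝ) < K := lagLip_pos α p ζ _
  have hreg : ∀ y, IsAdmissible T C R M y → IsRegularVelocity K M (lagVelocity α T ζ y) := by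
    intro y hy
    have := (hy.isParticleMap hζ hC0).isRegularVelocity hζ hα hT.le hB0 hM0
    rwa [← hC, ← hM] at this
  have hstep : ∀ y : {y // IsAdmissible T C R M y}, ∃ Y : {y // IsAdmissible T C R M y},
      IsFlow (lagVelocity α T ζ y) Y := fun y => by
    obtain ⟨Y, hY⟩ := (hreg y y.2).exists_flow
    exact ⟨⟨Y, .of_isFlow hζ hα hT hC hC0 hM y.2 hY⟩, hY⟩
  choose step hstep using hstep
  have hexp1 : ∀ t, 0 ≤ t → 1 ≤ Real.exp (C * t) := fun t ht =>
    Real.one_le_exp (mul_nonneg hC0 ht)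
  have hinit : IsAdmissible T C R M fun _ => Homeomorph.refl R3 := by
    refine ⟨fun _ _ => .id _, fun t ht z => ?_, fun s _ t _ z => ?_⟩
    · have := mul_nonneg hR (sub_nonneg.2 (hexp1 t ht.1))
      simpa using this
    · simp only [Homeomorph.refl_apply, sub_self, norm_zero]; positivity
  -- Picard iteration from the identity: `Z (n + 1)` is the flow of the velocity generated by `Z n`.
  let Z : ℕ → {y // IsAdmissible T C R M y} := fun n => step^[n] ⟨_, hinit⟩
  have hZ : ∀ n, IsFlow (lagVelocity α T ζ (Z n)) (Z (n + 1)) := fun n => by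
    simp only [Z, Function.iterate_succ_apply']; exact hstep _
  have hZa : ∀ n, IsAdmissible T C R M (Z n) := fun n => (Z n).2
  have hZp : ∀ n, IsParticleMap T (R * Real.exp (C * T)) M ζ (Z n) := fun n =>
    (hZa n).isParticleMap hζ hC0
  set κ := R * (Real.exp (C * T) - 1) + 1 with hκ
  have hκ0 : 0 < κ := by
    have := mul_nonneg hR (sub_nonneg.2 (hexp1 T hT.le)); positivity
  have hexpK : ∀ t, 0 ≤ t → 1 ≤ Real.exp (4 * K * t) := fun t ht =>
    Real.one_le_exp (by positivity)
  have key : ∀ n : ℕ, ∀ t ∈ Icc 0 T, ∀ x, ‖(Z (n + 1)).1 t x - (Z n).1 t x‖ ≤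
      κ / 2 ^ n * Real.exp (4 * K * t) := by
    intro n
    induction n with
    | zero =>
      intro t ht x
      have h1 : ‖(Z 1).1 t x - x‖ ≤ _ := (hZa 1).bound t ht x
      have h2 : Real.exp (C * t) ≤ Real.exp (C * T) :=
        Real.exp_le_exp.2 (mul_le_mul_of_nonneg_left ht.2 hC0)
      have h3 : R * (Real.exp (C * t) - 1) ≤ R * (Real.exp (C * T) - 1) := by gcongr
      calc ‖(Z (0 + 1)).1 t x - (Z 0).1 t x‖ ≤ κ := h1.trans (by linarith)
        _ ≤ _ := by
          rw [pow_zero, div_one]; exact le_mul_of_one_le_right hκ0.le (hexpK t ht.1)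
    | succ n ih =>
      have := (hZ (n + 1)).norm_sub_le_of_velocity (hreg _ (hZa _)) (lagLip_pos _ _ _ _) (hZ n)
        (T := T) (κ := κ / 2 ^ n) (by positivity) (fun t ht x => by
          have h1 := (hZp (n + 1)).norm_lagVelocity_sub_le hζ hα hT.le hB0 (hZp n) (s := t) (t := t)
            (δ := κ / 2 ^ n * Real.exp (4 * K * t))
            (fun z => by rw [clampTime_of_mem ht]; exact ih t ht z) x x
          simpa using h1)
      intro t ht x
      refine (this t ht x).trans_eq ?_
      rw [pow_succ]; ring
  -- Twice a bound for the first increment of the velocities, so that the tail of the geometric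
  -- series is at most `D / 2 ^ n`.
  set D := 2 * (K * (κ * Real.exp (4 * K * T))) with hD
  have hD0 : 0 < D := by positivity
  have hdist : ∀ t x n, dist (lagVelocity α T ζ (Z n) t x) (lagVelocity α T ζ (Z (n + 1)) t x) ≤
      D / 2 / 2 ^ n := by
    intro t x n
    have ht := clampTime_mem hT.le t
    have h1 := (hZp (n + 1)).norm_lagVelocity_sub_le hζ hα hT.le hB0 (hZp n) (s := t) (t := t)
      (δ := κ / 2 ^ n * Real.exp (4 * K * T)) (fun z => (key n _ ht z).trans (by
        have := ht.2; gcongr)) x x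
    rw [sub_self, norm_zero, zero_add, ← dist_eq_norm, dist_comm] at h1
    refine h1.trans_eq ?_
    rw [hD]; ring
  have hlim : ∀ t x, ∃ w, Tendsto (fun n => lagVelocity α T ζ (Z n) t x) atTop (𝓝 w) :=
    fun t x => cauchySeq_tendsto_of_complete (cauchySeq_of_le_geometric_two (hdist t x))
  -- The limit is taken in the velocities rather than in the maps. The limiting map is then the flow
  -- of a regular field, hence a homeomorphism, and Liouville's theorem applies to it.
  choose u hlim using hlim
  have hrate : ∀ t x n, ‖lagVelocity α T ζ (Z n) t x - u t x‖ ≤ D / 2 ^ n := fun t x n => by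
    rw [← dist_eq_norm]
    exact dist_le_of_le_geometric_two_of_tendsto (hdist t x) (hlim t x) n
  have hu : IsRegularVelocity K M u := by
    refine ⟨fun t => LipschitzWith.of_dist_le_mul fun x x' => ?_, fun t x => ?_, fun ε hε =>
      ⟨ε / (K * M + 1), by positivity, fun s t hst x => ?_⟩⟩
    · exact le_of_tendsto' ((hlim t x).dist (hlim t x')) fun n =>
        ((hreg _ (hZa n)).lip t).dist_le_mul x x'
    · exact le_of_tendsto' (hlim t x).norm fun n => (hreg _ (hZa n)).bound t x
    · refine le_of_tendsto' ((hlim s x).sub (hlim t x)).norm fun n => ?_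
      refine ((hZp n).norm_lagVelocity_sub_le hζ hα hT.le hB0 (hZp n) (δ := M * |s - t|) (fun z =>
        ((hZp n).time _ (clampTime_mem hT.le t) _ (clampTime_mem hT.le s) z).trans
          (mul_le_mul_of_nonneg_left (abs_clampTime_sub_le T s t) hM0)) x x).trans ?_
      rw [lt_div_iff₀ (by positivity)] at hst
      rw [sub_self, norm_zero, zero_add]
      nlinarith [abs_nonneg (s - t)]
  obtain ⟨Y, hY⟩ := hu.exists_flow
  have hpow : Tendsto (fun n : ℕ => (2 : ℝ)⁻¹ ^ n) atTop (𝓝 0) :=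
    tendsto_pow_atTop_nhds_zero_of_lt_one (by norm_num) (by norm_num)
  have hYrate : ∀ n : ℕ, ∀ t ∈ Icc 0 T, ∀ x, ‖(Z (n + 1)).1 t x - Y t x‖ ≤
      D / K * Real.exp (4 * K * T) * 2⁻¹ ^ n := by
    intro n t ht x
    have := (hZ n).norm_sub_le_of_velocity (hreg _ (hZa n)) (lagLip_pos _ _ _ _) hY (T := T)
      (κ := D / K * 2⁻¹ ^ n) (by positivity) (fun t ht x => (hrate t x n).trans (by
        have e : K * (D / K * 2⁻¹ ^ n * Real.exp (4 * K * t)) =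
            D / 2 ^ n * Real.exp (4 * K * t) := by rw [inv_pow]; field_simp
        rw [e]
        exact le_mul_of_one_le_right (by positivity) (hexpK t ht.1)))
    refine (this t ht x).trans ?_
    have h1 : Real.exp (4 * K * t) ≤ Real.exp (4 * K * T) :=
      Real.exp_le_exp.2 (mul_le_mul_of_nonneg_left ht.2 (by positivity))
    calc _ ≤ D / K * 2⁻¹ ^ n * Real.exp (4 * K * T) := by
          gcongr; exact half_le_self (by positivity)
      _ = _ := by ring
  have hYlim : ∀ t ∈ Icc 0 T, ∀ x, Tendsto (fun n => (Z (n + 1)).1 t x) atTop (𝓝 (Y t x)) := by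
    intro t ht x
    rw [tendsto_iff_norm_sub_tendsto_zero]
    refine squeeze_zero (fun _ => norm_nonneg _) (fun n => hYrate n t ht x) ?_
    simpa using hpow.const_mul (D / K * Real.exp (4 * K * T))
  have hYa : IsAdmissible T C R M Y := by
    refine ⟨fun t ht => hY.measurePreserving hu hT (fun t _ => ?_) ht, fun t ht z => ?_,
      fun s hs t ht z => ?_⟩
    · exact IsWeaklyDivFree.of_tendsto (fun n => hζ.isWeaklyDivFree_velocity hα
        ((hZp n).measurePreserving _ (clampTime_mem hT.le t))
        ((hZp n).bound _ (clampTime_mem hT.le t))) (fun n => ((hreg _ (hZa n)).lip t).continuous)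
        (fun n => (hreg _ (hZa n)).bound t) (hlim t)
    · exact le_of_tendsto' ((hYlim t ht z).sub_const z).norm fun n => (hZa _).bound t ht z
    · exact le_of_tendsto' ((hYlim t ht z).sub (hYlim s hs z)).norm fun n =>
        (hZa _).time s hs t ht z
  have hYp := hYa.isParticleMap hζ hC0
  -- The maps converge uniformly on `[0, T]`, so the velocities they generate converge to the one
  -- generated by `Y`, which closes the fixed point equation.
  have heq : u = lagVelocity α T ζ Y := by
    funext t x
    refine tendsto_nhds_unique ((tendsto_add_atTop_iff_nat 1).2 (hlim t x)) ?_
    rw [tendsto_iff_norm_sub_tendsto_zero]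
    refine squeeze_zero (fun _ => norm_nonneg _) (fun n =>
      (hZp (n + 1)).norm_lagVelocity_sub_le hζ hα hT.le hB0 hYp
        (hYrate n _ (clampTime_mem hT.le t)) x x) ?_
    simpa using (hpow.const_mul (D / K * Real.exp (4 * K * T))).const_mul (K : ℝ)
  exact ⟨_, M, Y, hB0, hM0, hYp, heq ▸ hY⟩

/-! ### Symmetry of Lagrangian solutions -/

variable {α p R T B M : ℝ} {ζ : R3 → ℝ} {y : ℝ → R3 ≃ₜ R3}

/-- Conjugation of a homeomorphism with a reflection. -/
def conjMirror (β : ℝ) (m : R3 ≃ₜ R3) : R3 ≃ₜ R3 :=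
  ((mirror β).toHomeomorph.trans m).trans (mirror β).toHomeomorph

lemma conjMirror_apply (β : ℝ) (m : R3 ≃ₜ R3) (x : R3) :
    conjMirror β m x = mirror β (m (mirror β x)) := rfl

/-- `angular` and the cross product each change sign under a reflection; the two signs cancel. -/
lemma velocity_conjMirror (hζ : IsVortexProfile p R ζ) (β : ℝ) (m : R3 ≃ₜ R3) (x : R3) :
    velocity α ζ (conjMirror β m) x = mirror β (velocity α ζ m (mirror β x)) := by
  have h := (measurePreserving_mirror β).integral_comp
    (mirror β).toHomeomorph.measurableEmbedding
    fun z => ζ z • cross (gradGreen α (x - conjMirror β m z)) (angular (conjMirror β m z))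
  rw [velocity, ← h, velocity]
  refine Eq.trans ?_ ((mirror β).toContinuousLinearEquiv.integral_comp_comm _)
  refine integral_congr_ae ?_
  filter_upwards [hζ.symm β] with z hz
  have hz : ζ (mirror β z) = ζ z := hz
  have e : x - mirror β (m z) = mirror β (mirror β x - m z) := by
    rw [map_sub, mirror_mirror]
  simp only [conjMirror_apply, mirror_mirror, hz, e, gradGreen_mirror, angular_mirror,
    LinearIsometryEquiv.coe_toContinuousLinearEquiv, map_smul]
  rw [← map_neg, cross_mirror, ← neg_one_smul ℝ (angular (m z)), cross_smul_right]
  simp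

lemma IsParticleMap.conjMirror (hy : IsParticleMap T B M ζ y) (hζ : IsVortexProfile p R ζ)
    (β : ℝ) : IsParticleMap T B M ζ fun t => EulerAlpha.conjMirror β (y t) := by
  have hS := measurePreserving_mirror β
  refine ⟨fun t ht => hS.comp ((hy.measurePreserving t ht).comp hS), fun t ht => ?_,
    fun s hs t ht z => ?_⟩
  · filter_upwards [hζ.symm β, hS.quasiMeasurePreserving.ae (hy.bound t ht)] with z h1 h2 h0
    rw [conjMirror_apply, LinearIsometryEquiv.norm_map]
    exact h2 (by rwa [show ζ (mirror β z) = ζ z from h1])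
  · rw [conjMirror_apply, conjMirror_apply, ← map_sub, LinearIsometryEquiv.norm_map]
    exact hy.time s hs t ht _

lemma IsFlow.conjMirror (hf : IsFlow (lagVelocity α T ζ y) y) (hζ : IsVortexProfile p R ζ)
    (β : ℝ) : IsFlow (lagVelocity α T ζ fun t => EulerAlpha.conjMirror β (y t))
      fun t => EulerAlpha.conjMirror β (y t) := by
  refine ⟨fun x => by rw [conjMirror_apply, hf.zero, mirror_mirror], fun x t => ?_⟩
  have h := (mirror β).toContinuousLinearEquiv.toContinuousLinearMap.hasFDerivAt.comp_hasDerivAt t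
    (hf.hasDerivAt (mirror β x) t)
  refine h.congr_deriv ?_
  have e := velocity_conjMirror (α := α) hζ β (y (clampTime T t)) (mirror β (y t (mirror β x)))
  rw [mirror_mirror] at e
  exact e.symm

/-- Lagrangian solutions commute with reflections at planes containing the axis. -/
theorem lagrangian_mirror (hζ : IsVortexProfile p R ζ) (hα : 0 < α) (hT : 0 ≤ T) (hB0 : 0 ≤ B)
    (hM : 0 ≤ M) (hy : IsParticleMap T B M ζ y) (hf : IsFlow (lagVelocity α T ζ y) y) {t : ℝ}
    (ht : t ∈ Icc 0 T) (β : ℝ) (x : R3) : y t (mirror β x) = mirror β (y t x) := by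
  have h := lagrangian_unique hζ hα hT hB0 hM (hy.conjMirror hζ β) hy (hf.conjMirror hζ β) hf t ht x
  rw [← h, conjMirror_apply, mirror_mirror]

lemma isAxisymmetricNoSwirl_velocity (hζ : IsVortexProfile p R ζ) {m : R3 ≃ₜ R3}
    (hm : ∀ β x, m (mirror β x) = mirror β (m x)) : IsAxisymmetricNoSwirl (velocity α ζ m) := by
  refine isAxisymmetricNoSwirl_iff.2 fun β x => ?_
  have h := velocity_conjMirror (α := α) hζ β m (mirror β x)
  have e : conjMirror β m = m := by
    ext1 z; rw [conjMirror_apply, hm, mirror_mirror]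
  rwa [e, mirror_mirror] at h

/-! ### Continuity in time of the velocity in the Lipschitz norm -/

/-- Composition with volume preserving maps is continuous in `L^P` for finite `P`. Nothing is asked
of `f` beyond integrability, so no rate is available. -/
lemma tendsto_integral_rpow_comp_sub {P : ℝ} (hP : 1 ≤ P) {f : R3 → ℝ} (hf : Integrable f)
    (hfP : Integrable fun z => |f z| ^ P) {g : ℝ → R3 → R3}
    (hg : Continuous fun z : ℝ × R3 => g z.1 z.2)
    (hm : ∀ t, MeasurePreserving (g t) volume volume) (t₀ : ℝ) :
    Tendsto (fun t => ∫ x, |f (g t x) - f (g t₀ x)| ^ P) (𝓝 t₀) (𝓝 0) := by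
  have hP0 : 0 < P := one_pos.trans_le hP
  set s := ENNReal.ofReal P with hs
  have hs1 : 1 ≤ s := by rwa [hs, ENNReal.one_le_ofReal]
  have hs0 : s ≠ 0 := (one_pos.trans_le hs1).ne'
  have hst : s ≠ ⊤ := ENNReal.ofReal_ne_top
  have hsr : s.toReal = P := ENNReal.toReal_ofReal hP0.le
  have : Fact (1 ≤ s) := ⟨hs1⟩
  have hmem : MemLp f s volume := by
    rw [← integrable_norm_rpow_iff hf.aestronglyMeasurable hs0 hst, hsr]
    exact hfP
  let G : C(ℝ, C(R3, R3)) := ContinuousMap.curry ⟨_, hg⟩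
  have hG : ∀ t, MeasurePreserving (G t) volume volume := hm
  have hlim := Tendsto.compMeasurePreservingLp (tendsto_const_nhds (x := hmem.toLp f))
    (G.continuous.tendsto t₀) hG (hG t₀) hst
  have hn : ∀ t, ∫ x, |f (g t x) - f (g t₀ x)| ^ P =
      ‖Lp.compMeasurePreserving (G t) (hG t) (hmem.toLp f) -
        Lp.compMeasurePreserving (G t₀) (hG t₀) (hmem.toLp f)‖ ^ P := by
    intro t
    rw [Lp.toLp_compMeasurePreserving, Lp.toLp_compMeasurePreserving, ← MemLp.toLp_sub,
      Lp.norm_toLp, MemLp.eLpNorm_eq_integral_rpow_norm hs0 hst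
        ((hmem.comp_measurePreserving (hG t)).sub (hmem.comp_measurePreserving (hG t₀))), hsr,
      ENNReal.toReal_ofReal (by positivity), Real.rpow_inv_rpow (by positivity) hP0.ne']
    rfl
  simp only [hn]
  have h0 := (hlim.sub_const (Lp.compMeasurePreserving (G t₀) (hG t₀) (hmem.toLp f))).norm.rpow_const
    (p := P) (Or.inr hP0.le)
  simpa [Real.zero_rpow hP0.ne'] using h0

lemma velocity_smul (α c : ℝ) (ζ : R3 → ℝ) (m : R3 → R3) (x : R3) :
    velocity α (fun z => c * ζ z) m x = c • velocity α ζ m x := by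
  simp only [velocity, mul_smul, integral_smul]

/-- A Lipschitz bound that is linear in `ζ` up to the arbitrarily small contribution of `λ`. -/
lemma norm_velocity_id_sub_le {α : ℝ} (hα : 0 < α) {p : ℝ} (hp : 3 / 2 < p) {ζ : R3 → ℝ}
    (h1 : Integrable ζ) (h2 : Integrable fun z => |ζ z| ^ p) {B : ℝ} (hB0 : 0 ≤ B)
    (hB : ∀ᵐ z, ζ z ≠ 0 → ‖z‖ ≤ B) {l : ℝ} (hl : 0 < l) (x x' : R3) :
    ‖velocity α ζ id x - velocity α ζ id x'‖ ≤
      kernelBound α * (B * ((∫ z, |ζ z|) + 2 * ((∫ z, |ζ z|) + l * (l⁻¹ ^ p * ∫ z, |ζ z| ^ p) +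
        l * ∫ w, singularPart p w)) + ∫ z, |ζ z|) * ‖x - x'‖ := by
  have hl' : 0 < l⁻¹ := inv_pos.2 hl
  have e1 : ∀ z, |l⁻¹ * ζ z| = l⁻¹ * |ζ z| := fun z => by rw [abs_mul, abs_of_pos hl']
  have e2 : ∀ z, |l⁻¹ * ζ z| ^ p = l⁻¹ ^ p * |ζ z| ^ p := fun z => by
    rw [e1, Real.mul_rpow hl'.le (abs_nonneg _)]
  -- The singular part of `potentialBound` does not scale with `ζ`. Applying the estimate to `ζ / l`
  -- and multiplying by `l` gives that part the factor `l`.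
  have h := norm_velocity_sub_le hα hp (ζ := fun z => l⁻¹ * ζ z) (h1.const_mul _)
    (by simpa only [e2] using h2.const_mul _) (.id volume) measurable_id hB0
    (by filter_upwards [hB] with z hz h0 using hz (right_ne_zero_of_mul h0))
    (by filter_upwards [hB] with z hz h0 using hz (right_ne_zero_of_mul h0)) (δ := 0) (by simp) x x'
  rw [velocity_smul, velocity_smul, ← smul_sub, norm_smul, Real.norm_of_nonneg hl'.le,
    velocityLip, potentialBound, add_zero] at h
  simp only [e2] at h
  simp only [e1, integral_const_mul] at h
  rw [inv_mul_le_iff₀ hl] at h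
  refine h.trans_eq ?_
  generalize l⁻¹ ^ p = c
  field_simp

variable {α p R T B M : ℝ} {ζ : R3 → ℝ} {y : ℝ → R3 ≃ₜ R3}

/-- Comparing the maps controls only the sup norm of the difference. For its Lipschitz constant the
difference is written as one velocity, generated by a density that is small in `L¹` and `L^p`. -/
lemma velocity_sub_eq_velocity_id (hζ : IsVortexProfile p R ζ) (hα : 0 < α) {m m' : R3 ≃ₜ R3}
    (hm : MeasurePreserving m volume volume) (hm' : MeasurePreserving m' volume volume)
    (hB : ∀ᵐ z, ζ z ≠ 0 → ‖m z‖ ≤ B) (hB' : ∀ᵐ z, ζ z ≠ 0 → ‖m' z‖ ≤ B) (x : R3) :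
    velocity α ζ m x - velocity α ζ m' x =
      velocity α (fun z => ζ (m.symm z) - ζ (m'.symm z)) id x := by
  rw [velocity_eq_kernelConv ζ hm, velocity_eq_kernelConv ζ hm',
    ← kernelConv_eq_velocity_id]
  have h1 := (isKernelConvolution_kernelConv hα (hζ.integrable_comp_symm_smul hm hB) x).1
  have h2 := (isKernelConvolution_kernelConv hα (hζ.integrable_comp_symm_smul hm' hB') x).1
  refine (integral_sub h1 h2).symm.trans (integral_congr_ae (ae_of_all _ fun z => ?_))
  simp only [sub_smul, cross_sub_right]

lemma ae_comp_symm_ne_zero {m : R3 ≃ₜ R3} (hm : MeasurePreserving m volume volume)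
    (hB : ∀ᵐ z, ζ z ≠ 0 → ‖m z‖ ≤ B) : ∀ᵐ z, ζ (m.symm z) ≠ 0 → ‖z‖ ≤ B := by
  filter_upwards [(measurePreserving_symm hm).quasiMeasurePreserving.ae hB] with x hx h0
  simpa using hx h0

/-- The velocity of a Lagrangian solution is continuous in time in the Lipschitz norm. -/
lemma eventually_lagVelocity_sub (hζ : IsVortexProfile p R ζ) (hα : 0 < α) (hT : 0 ≤ T)
    (hB0 : 0 ≤ B) (hy : IsParticleMap T B M ζ y)
    (hc : Continuous fun z : ℝ × R3 => (y z.1).symm z.2) (t₀ : ℝ) {ε : ℝ≥0} (hε : 0 < ε) :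
    ∀ᶠ t in 𝓝 t₀, (∀ x, ‖lagVelocity α T ζ y t x - lagVelocity α T ζ y t₀ x‖ ≤ ε) ∧
      LipschitzWith ε fun x => lagVelocity α T ζ y t x - lagVelocity α T ζ y t₀ x := by
  have hp1 : 1 ≤ p := by linarith [hζ.exponent]
  have hk := kernelBound_pos hα
  have hclamp : Continuous (clampTime T) := by unfold clampTime; fun_prop
  have hc' : Continuous fun z : ℝ × R3 => (y (clampTime T z.1)).symm z.2 :=
    hc.comp ((hclamp.comp continuous_fst).prodMk continuous_snd)
  have hm : ∀ t, MeasurePreserving (y (clampTime T t)) volume volume := fun t =>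
    hy.measurePreserving _ (clampTime_mem hT t)
  have hms := fun t => measurePreserving_symm (hm t)
  have hb := fun t => hy.bound _ (clampTime_mem hT t)
  set Q : ℝ → R3 → ℝ := fun t z =>
    ζ ((y (clampTime T t)).symm z) - ζ ((y (clampTime T t₀)).symm z) with hQ
  have hQB : ∀ t, ∀ᵐ z, Q t z ≠ 0 → ‖z‖ ≤ B := fun t => by
    filter_upwards [ae_comp_symm_ne_zero (hm t) (hb t), ae_comp_symm_ne_zero (hm t₀) (hb t₀)]
      with z h1 h2 h0
    by_contra h
    have h1' := not_imp_comm.1 h1 h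
    have h2' := not_imp_comm.1 h2 h
    exact h0 (by simp [hQ, h1', h2'])
  have hQ1 : ∀ t, Integrable (Q t) := fun t =>
    ((hms t).integrable_comp_of_integrable hζ.integrable).sub
      ((hms t₀).integrable_comp_of_integrable hζ.integrable)
  have hQp : ∀ t, Integrable fun z => |Q t z| ^ p := fun t => by
    have hmem : MemLp ζ (ENNReal.ofReal p) volume := by
      rw [← integrable_norm_rpow_iff hζ.integrable.aestronglyMeasurable
        (by simpa using by linarith) ENNReal.ofReal_ne_top, ENNReal.toReal_ofReal (by linarith)]
      exact hζ.integrable_rpow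
    have := ((hmem.comp_measurePreserving (hms t)).sub
      (hmem.comp_measurePreserving (hms t₀))).integrable_norm_rpow
        (by simpa using by linarith) ENNReal.ofReal_ne_top
    rwa [ENNReal.toReal_ofReal (by linarith)] at this
  have l1 : Tendsto (fun t => ∫ z, |Q t z|) (𝓝 t₀) (𝓝 0) := by
    have := tendsto_integral_rpow_comp_sub le_rfl hζ.integrable
      (by simpa using hζ.integrable.abs) hc' hms t₀
    simpa using this
  have lp : Tendsto (fun t => ∫ z, |Q t z| ^ p) (𝓝 t₀) (𝓝 0) :=
    tendsto_integral_rpow_comp_sub hp1 hζ.integrable hζ.integrable_rpow hc' hms t₀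
  have hσ : 0 ≤ ∫ w, singularPart p w := integral_nonneg fun w => singularPart_nonneg p w
  set σ := ∫ w, singularPart p w
  -- Chosen to keep the singular contribution strictly below `ε`; the remaining terms tend to `0` as
  -- `t → t₀`. The `+ 1` covers a vanishing coefficient.
  set l : ℝ := ε / (kernelBound α * (B * (2 * σ)) + 1) with hl
  have hε' : (0 : ℝ) < ε := hε
  have hl0 : 0 < l := by positivity
  have hlim : Tendsto (fun t => kernelBound α * (B * ((∫ z, |Q t z|) + 2 * ((∫ z, |Q t z|) +
      l * (l⁻¹ ^ p * ∫ z, |Q t z| ^ p) + l * σ)) + ∫ z, |Q t z|)) (𝓝 t₀)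
      (𝓝 (kernelBound α * (B * (0 + 2 * (0 + l * (l⁻¹ ^ p * 0) + l * σ)) + 0))) :=
    ((((l1.add (((l1.add ((lp.const_mul _).const_mul l)).add_const _).const_mul 2)).const_mul
      B).add l1).const_mul _)
  have hlt : kernelBound α * (B * (0 + 2 * (0 + l * (l⁻¹ ^ p * 0) + l * σ)) + 0) < ε := by
    calc _ = l * (kernelBound α * (B * (2 * σ))) := by ring
      _ < l * (kernelBound α * (B * (2 * σ)) + 1) := by
        have := mul_pos hl0 one_pos; nlinarith
      _ = ε := by rw [hl]; field_simp
  have hsup : Tendsto (fun t => kernelBound α * (∫ z, |Q t z|) * B) (𝓝 t₀)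
      (𝓝 (kernelBound α * 0 * B)) := (l1.const_mul _).mul_const _
  have he : ∀ t x, lagVelocity α T ζ y t x - lagVelocity α T ζ y t₀ x =
      velocity α (Q t) id x := fun t x =>
    velocity_sub_eq_velocity_id hζ hα (hm t) (hm t₀) (hb t) (hb t₀) x
  filter_upwards [hlim.eventually (gt_mem_nhds hlt),
    hsup.eventually (gt_mem_nhds (show kernelBound α * 0 * B < ε by simpa using hε'))] with t h1 h2
  refine ⟨fun x => ?_, LipschitzWith.of_dist_le_mul fun x x' => ?_⟩
  · rw [he]
    exact (norm_velocity_le hα (hQ1 t) (hQB t) x).trans h2.le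
  · rw [dist_eq_norm, dist_eq_norm, he, he]
    refine (norm_velocity_id_sub_le hα hζ.exponent (hQ1 t) (hQp t) hB0 (hQB t) hl0 x x').trans ?_
    gcongr

lemma isContinuousLipCurve_lagVelocity (hζ : IsVortexProfile p R ζ) (hα : 0 < α) (hT : 0 ≤ T)
    (hB0 : 0 ≤ B) (hM : 0 ≤ M) (hy : IsParticleMap T B M ζ y)
    (hc : Continuous fun z : ℝ × R3 => (y z.1).symm z.2) :
    IsContinuousLipCurve T (lagVelocity α T ζ y) := by
  have hu := hy.isRegularVelocity hζ hα hT hB0 hM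
  refine ⟨fun t _ => ⟨max (lagLip α p ζ B) (kernelBound α * (∫ z, |ζ z|) * B).toNNReal,
    fun x => (hu.bound t x).trans ((Real.le_coe_toNNReal _).trans ?_),
    (hu.lip t).weaken (le_max_left _ _)⟩, fun t₀ _ ε hε => ?_⟩
  · exact_mod_cast le_max_right _ _
  · obtain ⟨δ, hδ, h⟩ := Metric.eventually_nhds_iff.1
      (eventually_lagVelocity_sub hζ hα hT hB0 hy hc t₀ hε)
    exact ⟨δ, hδ, fun t _ ht => h (by rwa [Real.dist_eq])⟩

/-! ### Lagrangian solutions are weak solutions -/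

lemma IsLagrangianFlow.continuousOn {T : ℝ} {u : ℝ → R3 → R3} {y : ℝ → R3 ≃ₜ R3}
    (hy : IsLagrangianFlow T u y) (x : R3) : ContinuousOn (fun t => y t x) (Icc 0 T) := by
  refine Metric.continuousOn_iff.2 fun t₀ ht₀ ε hε => ?_
  obtain ⟨δ, hδ, h⟩ := hy.continuous t₀ ht₀ (ε / 2) (half_pos hε)
  refine ⟨δ, hδ, fun t ht htd => ?_⟩
  rw [dist_eq_norm]
  linarith [(h t ht (by rwa [Real.dist_eq] at htd) x).1]

/-- A Lagrangian flow on `[0, T]` is the flow of any regular extension of the velocity. -/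
lemma IsLagrangianFlow.eq_of_isFlow {T M : ℝ} {K : ℝ≥0} {u v : ℝ → R3 → R3} {y Y : ℝ → R3 ≃ₜ R3}
    (hy : IsLagrangianFlow T u y) (hv : IsRegularVelocity K M v) (huv : ∀ t ∈ Icc 0 T, u t = v t)
    (hY : IsFlow v Y) : ∀ t ∈ Icc 0 T, y t = Y t := by
  intro t ht
  ext1 x
  refine hY.eq_of_integral_eq hv (hy.continuousOn x) (fun t ht => ?_) t ht
  rw [hy.trajectory t ht x]
  congr 1
  refine intervalIntegral.integral_congr fun s hs => ?_
  rw [uIcc_of_le ht.1] at hs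
  simp only [huv s ⟨hs.1, hs.2.trans ht.2⟩]

lemma IsFlow.isLagrangianFlow {T M : ℝ} {K : ℝ≥0} {u : ℝ → R3 → R3} {Y : ℝ → R3 ≃ₜ R3}
    (hu : IsRegularVelocity K M u) (hY : IsFlow u Y)
    (hm : ∀ t ∈ Icc 0 T, MeasurePreserving (Y t) volume volume) : IsLagrangianFlow T u Y := by
  refine ⟨hm, fun t₀ _ ε hε => ?_, fun t _ x => hY.eq_add_integral hu t x⟩
  have hM := hu.bound_nonneg
  refine ⟨ε / (Real.exp (K * |T|) * M + 1), by positivity, fun t ht htd x => ?_⟩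
  have h1 := hY.norm_time_sub_le hu t₀ t x
  have h2 := hY.norm_symm_time_sub_le hu t₀ t x
  rw [lt_div_iff₀ (by positivity)] at htd
  have ht' : |t| ≤ |T| := abs_le_abs_of_nonneg ht.1 ht.2
  have h3 : Real.exp (K * |t|) ≤ Real.exp (K * |T|) := by gcongr
  have h4 : 1 ≤ Real.exp (K * |T|) := Real.one_le_exp (by positivity)
  have h5 : 0 ≤ M * |t - t₀| := by positivity
  have h6 : Real.exp (K * |T|) * (M * |t - t₀|) ≤ ε := by nlinarith [abs_nonneg (t - t₀)]
  exact ⟨h1.trans ((le_mul_of_one_le_left h5 h4).trans h6),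
    h2.trans ((mul_le_mul_of_nonneg_right h3 h5).trans h6)⟩

/-- The space-time map `(t, x) ↦ (t, Y_t⁻¹ x)` preserves volume. -/
lemma measurePreserving_prodMk {S : Set ℝ} (hS : MeasurableSet S) {g : ℝ → R3 → R3}
    (hg : Continuous fun z : ℝ × R3 => g z.1 z.2)
    (hm : ∀ t ∈ S, MeasurePreserving (g t) volume volume) :
    MeasurePreserving (fun z : ℝ × R3 => (z.1, g z.1 z.2))
      ((volume.restrict S).prod volume) ((volume.restrict S).prod volume) := by
  refine (MeasurePreserving.id (volume.restrict S)).skew_product hg.measurable ?_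
  filter_upwards [ae_restrict_mem hS] with t ht using (hm t ht).map_eq

lemma integrable_comp_snd {S : Set ℝ} [IsFiniteMeasure (volume.restrict S)] {ζ : R3 → ℝ}
    (hζ : Integrable ζ) :
    Integrable (fun z : ℝ × R3 => ζ z.2) ((volume.restrict S).prod volume) := by
  simpa using (integrable_const (1 : ℝ)).mul_prod (μ := volume.restrict S) hζ

lemma ae_cylRadius_snd_ne_zero (S : Set ℝ) :
    ∀ᵐ z ∂(volume.restrict S).prod (volume : Measure R3), cylRadius z.2 ≠ 0 :=
  Measure.quasiMeasurePreserving_snd.ae ae_cylRadius_ne_zero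

lemma eq_azimuthal_smul_eTheta {q : R3 → R3} {ζ : ℝ} {x : R3} (hq : q x = ζ • angular x)
    (hx : cylRadius x ≠ 0) : q x = azimuthal q x • eTheta x := by
  have h := potVorticity_smul_angular ζ hq hx
  rw [potVorticity, div_eq_mul_inv] at h
  rw [eTheta_eq, smul_smul, h, hq]

variable {T : ℝ} {ζ : R3 → ℝ} {Y : ℝ → R3 ≃ₜ R3}

/-- The vorticity obtained by transporting `q₀^θ / r = ζ` along the flow. -/
def transportedVorticity (ζ : R3 → ℝ) (Y : ℝ → R3 ≃ₜ R3) (t : ℝ) (x : R3) : R3 :=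
  ζ ((Y t).symm x) • angular x

lemma potVorticity_transportedVorticity (ζ : R3 → ℝ) (Y : ℝ → R3 ≃ₜ R3) (t : ℝ) {x : R3}
    (hx : cylRadius x ≠ 0) :
    potVorticity (transportedVorticity ζ Y t) x = ζ ((Y t).symm x) :=
  potVorticity_smul_angular _ rfl hx

lemma ae_potVorticity_transportedVorticity_comp {t : ℝ}
    (hm : MeasurePreserving (Y t) volume volume) :
    ∀ᵐ x, potVorticity (transportedVorticity ζ Y t) (Y t x) = ζ x := by
  filter_upwards [hm.quasiMeasurePreserving.ae ae_cylRadius_ne_zero] with x hx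
  rw [potVorticity_transportedVorticity ζ Y t hx, Homeomorph.symm_apply_apply]

lemma locallyIntegrableOn_transportedVorticity (hζ : Integrable ζ)
    (hc : Continuous fun z : ℝ × R3 => (Y z.1).symm z.2)
    (hm : ∀ t ∈ Icc 0 T, MeasurePreserving (Y t) volume volume) :
    LocallyIntegrableOn (fun z : ℝ × R3 => potVorticity (transportedVorticity ζ Y z.1) z.2)
      (Icc 0 T ×ˢ univ) := by
  refine IntegrableOn.locallyIntegrableOn ?_
  rw [IntegrableOn, volume_restrict_prod]
  refine ((measurePreserving_prodMk measurableSet_Icc hc fun t ht =>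
    measurePreserving_symm (hm t ht)).integrable_comp_of_integrable
      (integrable_comp_snd (S := Icc 0 T) hζ)).congr ?_
  filter_upwards [ae_cylRadius_snd_ne_zero (Icc 0 T)] with z hz
  exact (potVorticity_transportedVorticity ζ Y z.1 hz).symm

/-- After the volume preserving change `x ↦ Y_t x` the profile no longer depends on time. For each
label the remaining factor is the time derivative of `φ(t, Y_t x)`, which vanishes at both ends. -/
lemma isWeaklyTransported_transportedVorticity {K : ℝ≥0} {M : ℝ} {u : ℝ → R3 → R3}
    (hu : IsRegularVelocity K M u) (hY : IsFlow u Y) (hT : 0 ≤ T) (hζ : Integrable ζ)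
    (hm : ∀ t ∈ Icc 0 T, MeasurePreserving (Y t) volume volume) :
    IsWeaklyTransported T u fun t => potVorticity (transportedVorticity ζ Y t) := by
  intro φ hφ hφc hφs
  have huc := hu.continuous_uncurry
  have hYc := hY.continuous_uncurry hu
  have hd : Continuous (fderiv ℝ φ) := hφ.continuous_fderiv (by simp)
  have hφd : ∀ z, DifferentiableAt ℝ φ z := fun z => hφ.differentiable (by simp) z
  rw [volume_restrict_prod]
  have hmp := measurePreserving_prodMk (S := Ioo 0 T) measurableSet_Ioo hYc fun t ht =>
    hm t (Ioo_subset_Icc_self ht)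
  have hmps := measurePreserving_prodMk (S := Ioo 0 T) measurableSet_Ioo
    (hY.continuous_symm_uncurry hu) fun t ht => measurePreserving_symm (hm t (Ioo_subset_Icc_self ht))
  have hζs := (hmps.integrable_comp_of_integrable
      (integrable_comp_snd (S := Ioo 0 T) hζ)).aestronglyMeasurable
  have hF : Continuous fun z : ℝ × R3 => fderiv ℝ φ z (1, u z.1 z.2) :=
    hd.clm_apply (continuous_const.prodMk huc)
  have e1 : ∫ z, fderiv ℝ φ z (1, u z.1 z.2) * potVorticity (transportedVorticity ζ Y z.1) z.2
      ∂((volume.restrict (Ioo 0 T)).prod volume) =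
      ∫ z, fderiv ℝ φ z (1, u z.1 z.2) * ζ ((Y z.1).symm z.2)
        ∂((volume.restrict (Ioo 0 T)).prod volume) := by
    refine integral_congr_ae ?_
    filter_upwards [ae_cylRadius_snd_ne_zero (Ioo 0 T)] with z hz
    rw [potVorticity_transportedVorticity ζ Y z.1 hz]
  rw [e1, ← hmp.integral_comp_aestronglyMeasurable
    (g := fun z : ℝ × R3 => fderiv ℝ φ z (1, u z.1 z.2) * ζ ((Y z.1).symm z.2))
    (hF.aestronglyMeasurable.mul hζs)]
  simp only [Homeomorph.symm_apply_apply]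
  have hG : Continuous fun z : ℝ × R3 =>
      fderiv ℝ φ (z.1, Y z.1 z.2) (1, u z.1 (Y z.1 z.2)) :=
    hF.comp (continuous_fst.prodMk hYc)
  obtain ⟨C, hC⟩ := hd.bounded_above_of_compact_support (hφc.fderiv ℝ)
  have hint : Integrable (fun z : ℝ × R3 =>
      fderiv ℝ φ (z.1, Y z.1 z.2) (1, u z.1 (Y z.1 z.2)) * ζ z.2)
      ((volume.restrict (Ioo 0 T)).prod volume) := by
    refine (integrable_comp_snd (S := Ioo 0 T) hζ).bdd_mul (c := C * max 1 M)
      hG.aestronglyMeasurable (ae_of_all _ fun z => ?_)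
    have hC0 : 0 ≤ C := (norm_nonneg _).trans (hC 0)
    refine (ContinuousLinearMap.le_opNorm _ _).trans (mul_le_mul (hC _) ?_ (norm_nonneg _) hC0)
    rw [Prod.norm_mk, norm_one]
    exact max_le_max le_rfl (hu.bound _ _)
  rw [integral_prod_symm _ hint]
  refine integral_eq_zero_of_ae (ae_of_all _ fun x => ?_)
  simp only [integral_mul_const, Pi.zero_apply]
  have hder : ∀ t, HasDerivAt (fun t => φ (t, Y t x))
      (fderiv ℝ φ (t, Y t x) (1, u t (Y t x))) t := fun t =>
    (hφd _).hasFDerivAt.comp_hasDerivAt t ((hasDerivAt_id t).prodMk (hY.hasDerivAt x t))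
  have hends : ∀ t, t ∉ Ioo 0 T → φ (t, Y t x) = 0 := fun t ht =>
    image_eq_zero_of_notMem_tsupport fun h => ht (hφs h).1
  have : ∫ t in Ioo 0 T, fderiv ℝ φ (t, Y t x) (1, u t (Y t x)) = 0 := by
    rw [← integral_Ioc_eq_integral_Ioo, ← intervalIntegral.integral_of_le hT,
      intervalIntegral.integral_eq_sub_of_hasDerivAt (fun t _ => hder t)
        ((hG.comp (Continuous.prodMk_left x)).intervalIntegrable _ _),
      hends T (by simp), hends 0 (by simp), sub_zero]
  rw [this, zero_mul]

theorem isWeakSolution_of_lagrangian {α p R B M : ℝ} {P : ℝ≥0∞} {u₀ q₀ : R3 → R3}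
    (hζ : IsVortexProfile p R ζ) (hα : 0 < α) (hT : 0 ≤ T) (hB0 : 0 ≤ B) (hM : 0 ≤ M)
    (hY : IsParticleMap T B M ζ Y) (hf : IsFlow (lagVelocity α T ζ Y) Y)
    (hP : MemLp ζ P volume) (hq₀ : ∀ᵐ x, q₀ x = ζ x • angular x)
    (hu₀ : u₀ = kernelConv α fun x => ζ x • angular x) :
    IsWeakSolution α T P u₀ q₀ (lagVelocity α T ζ Y) (transportedVorticity ζ Y) := by
  have hu := hY.isRegularVelocity hζ hα hT hB0 hM
  have hm := hY.measurePreserving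
  have hmir := fun t ht => lagrangian_mirror hζ hα hT hB0 hM hY hf (t := t) ht
  have hsym := hf.continuous_symm_uncurry hu
  have hlag : ∀ t ∈ Icc 0 T, lagVelocity α T ζ Y t = velocity α ζ (Y t) := fun t ht => by
    rw [← clampTime_of_mem ht]; funext x; rw [lagVelocity, clampTime_of_mem (clampTime_mem hT t)]
  have hker : ∀ t ∈ Icc 0 T, lagVelocity α T ζ Y t = kernelConv α (transportedVorticity ζ Y t) :=
    fun t ht => by rw [hlag t ht, velocity_eq_kernelConv ζ (hm t ht)]; rfl
  have hqi : ∀ t ∈ Icc 0 T, Integrable (transportedVorticity ζ Y t) := fun t ht =>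
    hζ.integrable_comp_symm_smul (hm t ht) (hY.bound t ht)
  have hY0 : ∀ x, (Y 0).symm x = x := fun x => by
    rw [Homeomorph.symm_apply_eq, hf.zero]
  have h0T : (0 : ℝ) ∈ Icc 0 T := ⟨le_rfl, hT⟩
  refine ⟨isContinuousLipCurve_lagVelocity hζ hα hT hB0 hM hY hsym, fun t ht => ?_,
    fun t ht => ?_, fun t ht => ?_, fun t ht => ?_, ⟨Y, hf.isLagrangianFlow hu hm,
      fun y' hy' t ht => hy'.eq_of_isFlow hu (fun _ _ => rfl) hf t ht⟩, fun t ht => ?_, ?_, ?_,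
    locallyIntegrableOn_transportedVorticity hζ.integrable hsym hm,
    isWeaklyTransported_transportedVorticity hu hf hT hζ.integrable hm⟩
  · rw [hlag t ht]; exact isAxisymmetricNoSwirl_velocity hζ (hmir t ht)
  · refine (hP.comp_measurePreserving (measurePreserving_symm (hm t ht))).of_le_mul (c := B)
      (hqi t ht).aestronglyMeasurable ?_
    filter_upwards [ae_comp_symm_ne_zero (hm t ht) (hY.bound t ht)] with x hx
    rw [transportedVorticity, norm_smul, mul_comm]
    by_cases h : ζ ((Y t).symm x) = 0
    · simp [h]
    · exact mul_le_mul_of_nonneg_right ((norm_angular_le x).trans (hx h)) (norm_nonneg _)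
  · rw [hker t ht]
    exact (hζ.comp_symm (hm t ht) hB0 (hY.bound t ht) (hmir t ht)).isUnfilteredVorticity hα
  · filter_upwards [ae_cylRadius_ne_zero] with x hx
    exact eq_azimuthal_smul_eTheta rfl hx
  · rw [hker t ht]; exact isKernelConvolution_kernelConv hα (hqi t ht)
  · rw [hker 0 h0T, hu₀]; congr 1; funext x; rw [transportedVorticity, hY0]
  · filter_upwards [hq₀] with x hx
    rw [hx, transportedVorticity, hY0]

/-! ### Weak solutions are Lagrangian solutions -/

/-- Compactness of `[0, T]` makes the Lipschitz constants and the modulus of continuity in time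
uniform; clamping extends the field to all times. -/
lemma IsContinuousLipCurve.exists_isRegularVelocity {T : ℝ} (hT : 0 ≤ T) {u : ℝ → R3 → R3}
    (hu : IsContinuousLipCurve T u) :
    ∃ (K : ℝ≥0) (M : ℝ), IsRegularVelocity K M fun t => u (clampTime T t) := by
  have hC : ∃ C : ℝ≥0, ∀ t ∈ Icc 0 T, (∀ x, ‖u t x‖ ≤ C) ∧ LipschitzWith C (u t) := by
    refine isCompact_Icc.induction_on (p := fun S : Set ℝ => ∃ C : ℝ≥0, ∀ t ∈ S,
      (∀ x, ‖u t x‖ ≤ C) ∧ LipschitzWith C (u t)) ⟨0, by simp⟩ ?_ ?_ fun t₀ ht₀ => ?_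
    · rintro S S' hS ⟨C, h⟩
      exact ⟨C, fun t ht => h t (hS ht)⟩
    · rintro S S' ⟨C, h⟩ ⟨C', h'⟩
      refine ⟨max C C', fun t ht => ?_⟩
      rcases ht with ht | ht
      · exact ⟨fun x => ((h t ht).1 x).trans (by exact_mod_cast le_max_left _ _),
          (h t ht).2.weaken (le_max_left _ _)⟩
      · exact ⟨fun x => ((h' t ht).1 x).trans (by exact_mod_cast le_max_right _ _),
          (h' t ht).2.weaken (le_max_right _ _)⟩
    · obtain ⟨C, hb, hl⟩ := hu.mem_lip t₀ ht₀
      obtain ⟨δ, hδ, h⟩ := hu.continuous t₀ ht₀ 1 one_pos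
      refine ⟨Icc 0 T ∩ Metric.ball t₀ δ,
        inter_mem_nhdsWithin _ (Metric.ball_mem_nhds _ hδ), 1 + C, fun t ht => ?_⟩
      obtain ⟨h1, h2⟩ := h t ht.1 (by simpa [Real.dist_eq] using ht.2)
      refine ⟨fun x => ?_, ?_⟩
      · have := norm_le_norm_add_norm_sub' (u t x) (u t₀ x)
        push_cast
        have h3 := h1 x
        rw [NNReal.coe_one] at h3
        linarith [hb x]
      · have := h2.add hl
        simpa using this
  obtain ⟨C, hC⟩ := hC
  have hv := fun t => hC _ (clampTime_mem hT t)
  -- Seen as a curve of bounded continuous functions, the velocity is uniformly continuous in the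
  -- sup norm.
  let F : ℝ → BoundedContinuousFunction R3 R3 := fun t =>
    BoundedContinuousFunction.ofNormedAddCommGroup (u (clampTime T t)) (hv t).2.continuous C (hv t).1
  have hF : ContinuousOn F (Icc 0 T) := by
    refine Metric.continuousOn_iff.2 fun t₀ ht₀ ε hε => ?_
    obtain ⟨δ, hδ, h⟩ := hu.continuous t₀ ht₀ ⟨ε / 2, (half_pos hε).le⟩ (half_pos hε)
    refine ⟨δ, hδ, fun t ht htd => ?_⟩
    refine ((BoundedContinuousFunction.dist_le (half_pos hε).le).2 fun x => ?_).trans_lt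
      (half_lt_self hε)
    rw [dist_eq_norm]
    simp only [F, BoundedContinuousFunction.coe_ofNormedAddCommGroup, clampTime_of_mem ht,
      clampTime_of_mem ht₀]
    exact (h t ht (by rwa [Real.dist_eq] at htd)).1 x
  refine ⟨C, C, fun t => (hv t).2, fun t => (hv t).1, fun ε hε => ?_⟩
  obtain ⟨δ, hδ, h⟩ := Metric.uniformContinuousOn_iff.1
    (isCompact_Icc.uniformContinuousOn_of_continuous hF) ε hε
  refine ⟨δ, hδ, fun s t hst x => ?_⟩
  have h1 := h _ (clampTime_mem hT s) _ (clampTime_mem hT t)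
    ((abs_clampTime_sub_le T s t).trans_lt hst)
  have h2 := (F (clampTime T s)).dist_coe_le_dist (g := F (clampTime T t)) x
  rw [dist_eq_norm] at h2
  simp only [F, BoundedContinuousFunction.coe_ofNormedAddCommGroup,
    clampTime_of_mem (clampTime_mem hT _)] at h1 h2
  exact h2.trans h1.le

/-- A cutoff function. -/
lemma exists_cutoff (ρ : ℝ) : ∃ χ : R3 → ℝ, ContDiff ℝ ∞ χ ∧ HasCompactSupport χ ∧
    ∀ z, ‖z‖ ≤ ρ → χ z = 1 := by
  let f : ContDiffBump (0 : R3) := ⟨|ρ| + 1, |ρ| + 2, by positivity, by linarith⟩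
  refine ⟨f, f.contDiff, f.hasCompactSupport, fun z hz => f.one_of_mem_closedBall ?_⟩
  rw [mem_closedBall_zero_iff]
  exact hz.trans ((le_abs_self ρ).trans (by change |ρ| ≤ |ρ| + 1; linarith))

lemma locallyIntegrable_of_forall_mul {g : R3 → ℝ}
    (h : ∀ φ : R3 → ℝ, Continuous φ → HasCompactSupport φ → Integrable fun z => φ z * g z) :
    LocallyIntegrable g := by
  refine locallyIntegrable_iff.2 fun k hk => ?_
  obtain ⟨ρ, hρ⟩ := hk.isBounded.subset_closedBall (0 : R3)
  obtain ⟨χ, hχ, hχc, h1⟩ := exists_cutoff ρ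
  refine ((h χ hχ.continuous hχc).integrableOn (s := k)).congr_fun (fun z hz => ?_)
    hk.measurableSet
  simp only [h1 z (mem_closedBall_zero_iff.1 (hρ hz)), one_mul]

/-! ### Transport of the potential vorticity of a weak solution. -/

section weak

variable {T M : ℝ} {K : ℝ≥0} {v : ℝ → R3 → R3} {Y : ℝ → R3 ≃ₜ R3}

lemma IsFlow.continuousOn_integral_comp_mul (hv : IsRegularVelocity K M v) (hY : IsFlow v Y)
    {ψ χ f : R3 → ℝ} (hψ : Continuous ψ) (hψc : HasCompactSupport ψ)
    (hχ : ∀ t ∈ Icc 0 T, ∀ z, ψ (Y t z) ≠ 0 → χ z = 1) (hf : Integrable fun z => χ z * f z) :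
    ContinuousOn (fun t => ∫ z, ψ (Y t z) * f z) (Icc 0 T) := by
  obtain ⟨C, hC⟩ := hψ.bounded_above_of_compact_support hψc
  have e : ∀ t ∈ Icc 0 T, ∫ z, ψ (Y t z) * f z = ∫ z, ψ (Y t z) * (χ z * f z) := fun t ht => by
    refine integral_congr_ae (ae_of_all _ fun z => ?_)
    by_cases h : ψ (Y t z) = 0
    · simp [h]
    · simp [hχ t ht z h]
  refine ContinuousOn.congr (continuousOn_of_dominated (bound := fun z => C * ‖χ z * f z‖)
    (fun t _ => ((hψ.comp (Y t).continuous).aestronglyMeasurable.mul hf.aestronglyMeasurable))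
    (fun t _ => ae_of_all _ fun z => ?_) (hf.norm.const_mul C) (ae_of_all _ fun z => ?_)) e
  · exact (norm_mul_le (ψ (Y t z)) (χ z * f z)).trans
      (mul_le_mul_of_nonneg_right (hC _) (norm_nonneg _))
  · have : Continuous fun t => Y t z := (hY.continuous_uncurry hv).comp (Continuous.prodMk_left z)
    exact ((hψ.comp this).mul continuous_const).continuousOn

end weak

lemma isOpen_cylRadius_ne_zero : IsOpen {x : R3 | cylRadius x ≠ 0} :=
  isOpen_ne_fun continuous_cylRadius continuous_const

lemma potVorticity_eq_inner (q : R3 → R3) (x : R3) :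
    potVorticity q x = ⟪q x, (cylRadius x ^ 2)⁻¹ • angular x⟫ := by
  rw [potVorticity_eq, eTheta_eq, real_inner_smul_left, real_inner_smul_right,
    real_inner_smul_right, pow_two, mul_inv, mul_assoc]

/-- At a fixed time, integrability of `q` says nothing about `q / r` near the axis. Since the axis
is null, comparing functions off it loses nothing. -/
lemma locallyIntegrableOn_potVorticity {q : R3 → R3} (hq : LocallyIntegrable q) :
    LocallyIntegrableOn (potVorticity q) {x | cylRadius x ≠ 0} := by
  have hW : ContinuousOn (fun x => (cylRadius x ^ 2)⁻¹ • angular x) {x | cylRadius x ≠ 0} :=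
    ((continuous_cylRadius.pow 2).continuousOn.inv₀ fun x hx => pow_ne_zero 2 hx).smul
      angular.continuous.continuousOn
  have hWm : Measurable fun x => (cylRadius x ^ 2)⁻¹ • angular x :=
    (continuous_cylRadius.pow 2).measurable.inv.smul angular.continuous.measurable
  refine (locallyIntegrableOn_iff isOpen_cylRadius_ne_zero.isLocallyClosed).2 fun k hk hkc => ?_
  obtain ⟨C, hC⟩ := hkc.exists_bound_of_continuousOn (hW.mono hk)
  have hqk := hq.integrableOn_isCompact hkc
  refine Integrable.mono' (hqk.norm.mul_const C) ?_ ?_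
  · rw [funext (potVorticity_eq_inner q)]
    exact hqk.aestronglyMeasurable.inner hWm.aestronglyMeasurable
  · filter_upwards [ae_restrict_mem hkc.measurableSet] with x hx
    rw [potVorticity_eq_inner]
    exact (norm_inner_le_norm _ _).trans (mul_le_mul_of_nonneg_left (hC x hx) (norm_nonneg _))

/-- The azimuthal test field belonging to a scalar test function off the axis. -/
lemma contDiff_smul_angular {ψ : R3 → ℝ} (hψ : ContDiff ℝ ∞ ψ)
    (hψs : tsupport ψ ⊆ {x | cylRadius x ≠ 0}) :
    ContDiff ℝ ∞ fun x => (ψ x * (cylRadius x ^ 2)⁻¹) • angular x := by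
  have hc : ContDiff ℝ ∞ fun x => cylRadius x ^ 2 := by
    simp only [cylRadius_sq]
    fun_prop
  refine contDiff_iff_contDiffAt.2 fun x => ?_
  by_cases hx : x ∈ tsupport ψ
  · exact (hψ.contDiffAt.mul (hc.contDiffAt.inv (pow_ne_zero 2 (hψs hx)))).smul
      angular.contDiff.contDiffAt
  · refine contDiffAt_const (c := 0) |>.congr_of_eventuallyEq ?_
    filter_upwards [notMem_tsupport_iff_eventuallyEq.1 hx] with z hz
    simp only [hz, Pi.zero_apply, zero_mul, zero_smul]

section weak

variable {T M : ℝ} {K : ℝ≥0} {v : ℝ → R3 → R3} {Y : ℝ → R3 ≃ₜ R3}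

lemma eqOn_Ioo_of_forall_rat {F : ℝ → ℝ} (hF : ContinuousOn F (Ioo 0 T))
    (h : ∀ s : ℚ, (s : ℝ) ∈ Ioo 0 T → F s = 0) : ∀ t ∈ Ioo 0 T, F t = 0 := by
  intro t ht
  by_contra hne
  have ho : IsOpen (Ioo 0 T ∩ F ⁻¹' {0}ᶜ) :=
    hF.isOpen_inter_preimage isOpen_Ioo isOpen_compl_singleton
  obtain ⟨s, hs⟩ := (Rat.denseRange_cast (𝕜 := ℝ)).exists_mem_open ho ⟨t, ht, hne⟩
  exact hs.2 (h s hs.1)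

lemma IsFlow.norm_le_of_comp_ne_zero (hv : IsRegularVelocity K M v) (hY : IsFlow v Y)
    {ψ : R3 → ℝ} {ρ : ℝ} (hρ : tsupport ψ ⊆ Metric.closedBall 0 ρ) {t : ℝ} (ht : t ∈ Icc 0 T)
    {z : R3} (hz : ψ (Y t z) ≠ 0) : ‖z‖ ≤ ρ + M * T := by
  have h1 := mem_closedBall_zero_iff.1 (hρ (subset_tsupport _ hz))
  have h2 := hY.norm_time_sub_le hv 0 t z
  rw [hY.zero, sub_zero, abs_of_nonneg ht.1] at h2
  have h3 := norm_le_norm_add_norm_sub (Y t z) z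
  have h4 := mul_le_mul_of_nonneg_left ht.2 hv.bound_nonneg
  linarith

/-- A weakly transported density is, along the flow, almost everywhere in time equal to a fixed
function. -/
lemma IsFlow.exists_forall_ae_integral_eq (hv : IsRegularVelocity K M v) (hY : IsFlow v Y)
    (hT : 0 < T) (hm : ∀ t ∈ Icc 0 T, MeasurePreserving (Y t) volume volume) {h : ℝ → R3 → ℝ}
    (hint : LocallyIntegrableOn (fun z : ℝ × R3 => h z.1 z.2) (Icc 0 T ×ˢ univ))
    (htr : IsWeaklyTransported T v h) :
    ∃ g : R3 → ℝ, LocallyIntegrable g ∧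
      ∀ ψ : R3 → ℝ, ContDiff ℝ ∞ ψ → HasCompactSupport ψ →
        ∀ᵐ t ∂volume.restrict (Ioo 0 T), ∫ x, ψ x * h t x = ∫ z, ψ (Y t z) * g z := by
  have hmp := measurePreserving_prodMk (S := Ioo 0 T) measurableSet_Ioo (hY.continuous_uncurry hv)
    fun t ht => hm t (Ioo_subset_Icc_self ht)
  have hH : ∀ φ : R3 → ℝ, Continuous φ → HasCompactSupport φ →
      Integrable (fun z : ℝ × R3 => φ z.2 * h z.1 (Y z.1 z.2))
        ((volume.restrict (Ioo 0 T)).prod volume) := fun φ hφ hφc => by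
    have := hmp.integrable_comp_of_integrable (hY.integrable_comp_symm_mul hv hint hφ hφc)
    simpa only [Function.comp_def, Homeomorph.symm_apply_apply] using this
  have hchange : ∀ (φ : R3 → ℝ), ∀ t ∈ Icc 0 T,
      ∫ x, φ ((Y t).symm x) * h t x = ∫ z, φ z * h t (Y t z) := fun φ t ht => by
    have := (hm t ht).integral_comp (Y t).measurableEmbedding fun x => φ ((Y t).symm x) * h t x
    simpa only [Homeomorph.symm_apply_apply] using this.symm
  -- The average over time of `h` along trajectories, which must equal `h t ∘ Y t` if `h` is
  -- transported.
  set g : R3 → ℝ := fun z => T⁻¹ * ∫ t in Ioo 0 T, h t (Y t z) with hg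
  have hgφ : ∀ (φ : R3 → ℝ) z, φ z * g z = T⁻¹ * ∫ t in Ioo 0 T, φ z * h t (Y t z) :=
    fun φ z => by rw [integral_const_mul, hg]; ring
  have hgint : ∀ φ : R3 → ℝ, Continuous φ → HasCompactSupport φ →
      Integrable fun z => φ z * g z := fun φ hφ hφc => by
    simp only [hgφ φ]
    exact (hH φ hφ hφc).integral_prod_right.const_mul _
  have hlip : ∀ (φ : R3 → ℝ) (L : ℝ≥0), LipschitzWith L φ → HasCompactSupport φ →
      ∀ᵐ t ∂volume.restrict (Ioo 0 T), ∫ z, φ z * h t (Y t z) = ∫ z, φ z * g z := by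
    intro φ L hφ hφc
    obtain ⟨k, hk⟩ := hY.ae_integral_comp_symm_mul_eq_const hv hT hint htr hφ hφc
    have hk' : ∀ᵐ t ∂volume.restrict (Ioo 0 T), ∫ z, φ z * h t (Y t z) = k := by
      filter_upwards [hk, ae_restrict_mem measurableSet_Ioo] with t ht htT
      rw [← ht, hchange φ t (Ioo_subset_Icc_self htT)]
    have e : ∫ z, φ z * g z = k := by
      simp only [hgφ φ]
      rw [integral_const_mul, ← integral_prod_symm _ (hH φ hφ.continuous hφc),
        integral_prod _ (hH φ hφ.continuous hφc), integral_congr_ae hk']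
      simp [hT.le, hT.ne']
    filter_upwards [hk'] with t ht
    rw [ht, e]
  refine ⟨g, locallyIntegrable_of_forall_mul hgint, fun ψ hψ hψc => ?_⟩
  obtain ⟨L, hL⟩ := exists_lipschitzWith_of_contDiff hψ hψc
  obtain ⟨ρ, hρ⟩ := hψc.isCompact.isBounded.subset_closedBall (0 : R3)
  obtain ⟨χ, hχ, hχc, h1⟩ := exists_cutoff (ρ + M * T)
  have hχ1 : ∀ t ∈ Icc 0 T, ∀ z, ψ (Y t z) ≠ 0 → χ z = 1 := fun t ht z hz =>
    h1 z (hY.norm_le_of_comp_ne_zero hv hρ ht hz)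
  -- The exceptional set of times depends on the test function, while the wanted one, `ψ ∘ Y_t`,
  -- moves with `t`. Countably many `ψ ∘ Y_s` with rational `s` share one null set, and continuity
  -- in `s` then allows `s = t`.
  have hrat : ∀ᵐ t ∂volume.restrict (Ioo 0 T), ∀ s : ℚ,
      ∫ z, ψ (Y s z) * h t (Y t z) = ∫ z, ψ (Y s z) * g z := by
    refine ae_all_iff.2 fun s => ?_
    have hYL : LipschitzWith ⟨Real.exp (K * |(s : ℝ)|), (Real.exp_pos _).le⟩ (Y s) :=
      LipschitzWith.of_dist_le_mul fun x y => by
        rw [dist_eq_norm, dist_eq_norm]; exact hY.norm_sub_le_zero hv s x y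
    exact hlip (fun z => ψ (Y s z)) _ (hL.comp hYL) (hψc.comp_homeomorph (Y s))
  filter_upwards [hrat, (hH χ hχ.continuous hχc).prod_right_ae,
    ae_restrict_mem measurableSet_Ioo] with t hr hi ht
  have hA := hY.continuousOn_integral_comp_mul hv hψ.continuous hψc hχ1 hi
  have hB := hY.continuousOn_integral_comp_mul hv hψ.continuous hψc hχ1
    (hgint χ hχ.continuous hχc)
  have := eqOn_Ioo_of_forall_rat ((hA.sub hB).mono Ioo_subset_Icc_self)
    (fun s _ => sub_eq_zero.2 (hr s)) t ht
  have heq : ∫ z, ψ (Y t z) * h t (Y t z) = ∫ z, ψ (Y t z) * g z := sub_eq_zero.1 this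
  rw [← heq, ← hchange (fun z => ψ (Y t z)) t (Ioo_subset_Icc_self ht)]
  simp only [Homeomorph.apply_symm_apply]

/-- Off the axis, the vorticity depends weakly continuously on time. -/
lemma continuousOn_integral_mul_potVorticity {α : ℝ} (hv : IsRegularVelocity K M v)
    {q : ℝ → R3 → R3} (hq : ∀ t ∈ Icc 0 T, IsUnfilteredVorticity α (v t) (q t)) {ψ : R3 → ℝ}
    (hψ : ContDiff ℝ ∞ ψ) (hψc : HasCompactSupport ψ)
    (hψs : tsupport ψ ⊆ {x | cylRadius x ≠ 0}) :
    ContinuousOn (fun t => ∫ x, ψ x * potVorticity (q t) x) (Icc 0 T) := by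
  -- Pairing `q` with `ψ e_θ / r` gives `ψ q^θ / r`. The field is smooth because `ψ` avoids the
  -- axis, and moving all derivatives onto it leaves only `v`, which is continuous in time.
  set Φ : R3 → R3 := fun x => (ψ x * (cylRadius x ^ 2)⁻¹) • angular x with hΦ
  have hΦs : ContDiff ℝ ∞ Φ := contDiff_smul_angular hψ hψs
  have hΦc : HasCompactSupport Φ := (hψc.mul_right).smul_right
  have hcs := contDiff_curl hΦs
  have hcc := hasCompactSupport_curl hΦs hΦc
  set G : R3 → R3 := fun x => curl Φ x - α ^ 2 • Laplacian.laplacian (curl Φ) x with hG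
  have hGc : Continuous G := by
    have h1 := hcs.continuous
    have h2 := (contDiff_laplacian hcs).continuous
    fun_prop
  have hGs : HasCompactSupport G :=
    hcc.sub ((hasCompactSupport_laplacian hcs hcc).smul_left (f := fun _ => α ^ 2))
  have e : ∀ t ∈ Icc 0 T, ∫ x, ψ x * potVorticity (q t) x = ∫ x, ⟪v t x, G x⟫ := fun t ht => by
    rw [hq t ht Φ hΦs hΦc]
    refine integral_congr_ae (ae_of_all _ fun x => ?_)
    simp only [hΦ, potVorticity_eq_inner, real_inner_smul_right]
    ring
  have hvc := hv.continuous_uncurry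
  refine ContinuousOn.congr (Continuous.continuousOn ?_) e
  refine continuous_of_dominated (bound := fun x => M * ‖G x‖) (fun t => ?_)
    (fun t => ae_of_all _ fun x => ?_)
    ((hGc.integrable_of_hasCompactSupport hGs).norm.const_mul M) (ae_of_all _ fun x => ?_)
  · exact ((hv.lip t).continuous.inner hGc).aestronglyMeasurable
  · exact (norm_inner_le_norm _ _).trans
      (mul_le_mul_of_nonneg_right (hv.bound t x) (norm_nonneg _))
  · exact (hvc.comp (Continuous.prodMk_left x)).inner continuous_const

lemma integrable_mul_of_tsupport_subset {U : Set R3} {f ψ : R3 → ℝ}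
    (hf : LocallyIntegrableOn f U) (hψ : Continuous ψ) (hψc : HasCompactSupport ψ)
    (hψs : tsupport ψ ⊆ U) : Integrable fun x => ψ x * f x := by
  have h := (hf.integrableOn_compact_subset hψs hψc).continuousOn_mul hψ.continuousOn hψc
  refine (integrableOn_iff_integrable_of_support_subset fun x hx => ?_).1 h
  exact subset_tsupport ψ (left_ne_zero_of_mul hx)

lemma ae_eq_of_forall_integral_mul {f g : R3 → ℝ}
    (hf : LocallyIntegrableOn f {x | cylRadius x ≠ 0})
    (hg : LocallyIntegrableOn g {x | cylRadius x ≠ 0})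
    (h : ∀ ψ : R3 → ℝ, ContDiff ℝ ∞ ψ → HasCompactSupport ψ →
      tsupport ψ ⊆ {x | cylRadius x ≠ 0} → ∫ x, ψ x * f x = ∫ x, ψ x * g x) :
    f =ᵐ[volume] g := by
  have h0 := isOpen_cylRadius_ne_zero.ae_eq_zero_of_integral_contDiff_smul_eq_zero
    (f := fun x => f x - g x) (hf.sub hg) fun ψ hψ hψc hψs => by
      have i1 := integrable_mul_of_tsupport_subset hf hψ.continuous hψc hψs
      have i2 := integrable_mul_of_tsupport_subset hg hψ.continuous hψc hψs
      simp only [smul_eq_mul, mul_sub]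
      rw [integral_sub i1 i2, sub_eq_zero]
      exact h ψ hψ hψc hψs
  filter_upwards [h0, ae_cylRadius_ne_zero] with x hx hr
  exact sub_eq_zero.1 (hx hr)

/-- The potential vorticity of a weak solution is transported by its flow. -/
lemma IsFlow.ae_potVorticity_eq_comp_symm {α : ℝ} (hv : IsRegularVelocity K M v)
    (hY : IsFlow v Y) (hT : 0 < T) (hm : ∀ t ∈ Icc 0 T, MeasurePreserving (Y t) volume volume)
    {q : ℝ → R3 → R3} (hqi : ∀ t ∈ Icc 0 T, LocallyIntegrable (q t))
    (hq : ∀ t ∈ Icc 0 T, IsUnfilteredVorticity α (v t) (q t))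
    (hint : LocallyIntegrableOn (fun z : ℝ × R3 => potVorticity (q z.1) z.2) (Icc 0 T ×ˢ univ))
    (htr : IsWeaklyTransported T v fun t => potVorticity (q t)) {ζ : R3 → ℝ} (hζ : Integrable ζ)
    (h0 : potVorticity (q 0) =ᵐ[volume] ζ) :
    ∀ t ∈ Icc 0 T, potVorticity (q t) =ᵐ[volume] fun x => ζ ((Y t).symm x) := by
  obtain ⟨g, hgi, hg⟩ := hY.exists_forall_ae_integral_eq hv hT hm hint htr
  have key : ∀ ψ : R3 → ℝ, ContDiff ℝ ∞ ψ → HasCompactSupport ψ →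
      tsupport ψ ⊆ {x | cylRadius x ≠ 0} → ∀ t ∈ Icc 0 T,
      ∫ x, ψ x * potVorticity (q t) x = ∫ z, ψ (Y t z) * g z := by
    intro ψ hψ hψc hψs
    obtain ⟨ρ, hρ⟩ := hψc.isCompact.isBounded.subset_closedBall (0 : R3)
    obtain ⟨χ, hχ, hχc, h1⟩ := exists_cutoff (ρ + M * T)
    -- Both sides are continuous on `[0, T]`, so the identity extends to every time, including `t =
    -- 0`.
    refine Measure.eqOn_Icc_of_ae_eq volume hT.ne ?_
      (continuousOn_integral_mul_potVorticity hv hq hψ hψc hψs)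
      (hY.continuousOn_integral_comp_mul hv hψ.continuous hψc
        (fun t ht z hz => h1 z (hY.norm_le_of_comp_ne_zero hv hρ ht hz))
        (hgi.integrable_smul_left_of_hasCompactSupport hχ.continuous hχc))
    rw [← restrict_Ioo_eq_restrict_Icc]
    exact hg ψ hψ hψc
  have hpv := fun t ht => locallyIntegrableOn_potVorticity (hqi t ht)
  -- The identity at `t = 0` is the only place where the initial value enters, since the weak
  -- equation does not see it.
  have hgζ : g =ᵐ[volume] ζ := by
    refine EventuallyEq.trans (EventuallyEq.symm ?_) h0
    have h0T : (0 : ℝ) ∈ Icc 0 T := ⟨le_rfl, hT.le⟩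
    refine ae_eq_of_forall_integral_mul (hpv 0 h0T) (hgi.locallyIntegrableOn _)
      fun ψ hψ hψc hψs => ?_
    rw [key ψ hψ hψc hψs 0 h0T]
    simp only [hY.zero]
  intro t ht
  refine ae_eq_of_forall_integral_mul (hpv t ht) (((measurePreserving_symm
    (hm t ht)).integrable_comp_of_integrable hζ).locallyIntegrable.locallyIntegrableOn _)
    fun ψ hψ hψc hψs => ?_
  rw [key ψ hψ hψc hψs t ht]
  have := (hm t ht).integral_comp (Y t).measurableEmbedding fun x => ψ x * ζ ((Y t).symm x)
  simp only [Homeomorph.symm_apply_apply] at this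
  rw [← this]
  refine integral_congr_ae ?_
  filter_upwards [hgζ] with z hz
  rw [hz]

end weak

variable {α p R T B B' M M' : ℝ} {ζ : R3 → ℝ} {Y : ℝ → R3 ≃ₜ R3}

lemma IsParticleMap.mono (hY : IsParticleMap T B M ζ Y) (hB : B ≤ B') (hM : M ≤ M') :
    IsParticleMap T B' M' ζ Y := by
  refine ⟨hY.measurePreserving, fun t ht => ?_, fun s hs t ht z => (hY.time s hs t ht z).trans
    (mul_le_mul_of_nonneg_right hM (abs_nonneg _))⟩
  filter_upwards [hY.bound t ht] with z hz h0 using (hz h0).trans hB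

lemma IsWeaklyTransported.congr {u v : ℝ → R3 → R3} {h : ℝ → R3 → ℝ}
    (hu : IsWeaklyTransported T u h) (huv : ∀ t ∈ Icc 0 T, u t = v t) :
    IsWeaklyTransported T v h := by
  intro φ hφ hφc hφs
  refine (setIntegral_congr_fun (measurableSet_Ioo.prod MeasurableSet.univ) fun z hz => ?_).trans
    (hu φ hφ hφc hφs)
  simp only [huv z.1 (Ioo_subset_Icc_self hz.1)]

/-- Every weak solution is the one generated by a Lagrangian solution. -/
theorem IsWeakSolution.exists_lagrangian {s : ℝ≥0∞} {u₀ q₀ : R3 → R3} {u q : ℝ → R3 → R3}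
    (h : IsWeakSolution α T s u₀ q₀ u q) (hs : 1 ≤ s) (hT : 0 < T)
    (hζ : IsVortexProfile p R ζ) (hq₀ : ∀ᵐ x, q₀ x = ζ x • angular x) :
    ∃ (B M : ℝ) (Y : ℝ → R3 ≃ₜ R3), 0 ≤ B ∧ 0 ≤ M ∧ IsParticleMap T B M ζ Y ∧
      IsFlow (lagVelocity α T ζ Y) Y ∧ ∀ t ∈ Icc 0 T, u t = lagVelocity α T ζ Y t ∧
        q t =ᵐ[volume] transportedVorticity ζ Y t := by
  obtain ⟨K, M, hv⟩ := h.lip.exists_isRegularVelocity hT.le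
  set v : ℝ → R3 → R3 := fun t => u (clampTime T t) with hvdef
  have huv : ∀ t ∈ Icc 0 T, u t = v t := fun t ht => by simp only [hvdef, clampTime_of_mem ht]
  obtain ⟨Y, hY⟩ := hv.exists_flow
  have hm : ∀ t ∈ Icc 0 T, MeasurePreserving (Y t) volume volume := by
    obtain ⟨y, hy, -⟩ := h.flow
    intro t ht
    rw [← hy.eq_of_isFlow hv huv hY t ht]
    exact hy.measurePreserving t ht
  have h0 : potVorticity (q 0) =ᵐ[volume] ζ := by
    filter_upwards [h.initial_vorticity, hq₀, ae_cylRadius_ne_zero] with x h1 h2 hx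
    exact potVorticity_smul_angular _ (h1.trans h2) hx
  have hpot := hY.ae_potVorticity_eq_comp_symm hv hT hm
    (fun t ht => (h.memLp t ht).locallyIntegrable hs)
    (fun t ht => huv t ht ▸ h.vorticity t ht) h.locallyIntegrable (h.transport.congr huv)
    hζ.integrable h0
  have hq : ∀ t ∈ Icc 0 T, q t =ᵐ[volume] transportedVorticity ζ Y t := fun t ht => by
    filter_upwards [hpot t ht, h.azimuthal_only t ht] with x h1 h2
    rw [eq_potVorticity_smul_angular h2, h1, transportedVorticity]
  -- Recovery of `u` from the transported vorticity, in Lagrangian variables, is the fixed point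
  -- equation.
  have hlag : v = lagVelocity α T ζ Y := by
    funext t
    have ht := clampTime_mem hT.le t
    have e : u (clampTime T t) = kernelConv α (q (clampTime T t)) :=
      funext fun x => (h.recovery _ ht x).2
    simp only [hvdef, e, kernelConv_congr (hq _ ht)]
    exact (velocity_eq_kernelConv ζ (hm _ ht) α).symm
  have hM := hv.bound_nonneg
  refine ⟨R + M * T, M, Y, add_nonneg hζ.radius_nonneg (mul_nonneg hM hT.le), hM,
    ⟨hm, fun t ht => ?_, fun s _ t _ z => hY.norm_time_sub_le hv s t z⟩, hlag ▸ hY,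
    fun t ht => ⟨by rw [huv t ht, hlag], hq t ht⟩⟩
  filter_upwards [hζ.support] with z hz hz0
  have h2 := hY.norm_time_sub_le hv 0 t z
  rw [hY.zero, sub_zero, abs_of_nonneg ht.1] at h2
  have h3 := norm_le_norm_add_norm_sub' (Y t z) z
  have h4 := mul_le_mul_of_nonneg_left ht.2 hM
  linarith [hz hz0]

/-- Weak solutions coincide with a given Lagrangian solution. -/
theorem IsWeakSolution.eq_of_lagrangian {s : ℝ≥0∞} {u₀ q₀ : R3 → R3} {u q : ℝ → R3 → R3}
    (h : IsWeakSolution α T s u₀ q₀ u q) (hs : 1 ≤ s) (hα : 0 < α) (hT : 0 < T)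
    (hζ : IsVortexProfile p R ζ) (hq₀ : ∀ᵐ x, q₀ x = ζ x • angular x) (hB0 : 0 ≤ B) (hM : 0 ≤ M)
    (hY : IsParticleMap T B M ζ Y) (hf : IsFlow (lagVelocity α T ζ Y) Y) :
    ∀ t ∈ Icc 0 T, u t = lagVelocity α T ζ Y t ∧ q t =ᵐ[volume] transportedVorticity ζ Y t := by
  obtain ⟨B', M', Y', hB', hM', hY', hf', huq⟩ := h.exists_lagrangian hs hT hζ hq₀
  -- The two solutions come with different constants, so uniqueness is applied with their maxima.
  have heq : ∀ t ∈ Icc 0 T, Y' t = Y t := fun t ht => Homeomorph.ext <|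
    lagrangian_unique hζ hα hT.le (le_max_of_le_left hB0) (le_max_of_le_left hM)
      (hY'.mono (le_max_right B B') (le_max_right M M'))
      (hY.mono (le_max_left B B') (le_max_left M M')) hf' hf t ht
  intro t ht
  have e1 : lagVelocity α T ζ Y' t = lagVelocity α T ζ Y t := by
    funext x; rw [lagVelocity, lagVelocity, heq _ (clampTime_mem hT.le t)]
  have e2 : transportedVorticity ζ Y' t = transportedVorticity ζ Y t := by
    funext x; rw [transportedVorticity, transportedVorticity, heq t ht]
  rw [← e1, ← e2]
  exact huq t ht

end EulerAlpha

end

/-! ### Existence, uniqueness and transport for the weak formulation. -/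

theorem theorem2p1 (α : ℝ) (hα : 0 < α) (p : ℝ≥0∞) (hp : 3 / 2 < p)
    (u₀ q₀ : EulerAlpha.R3 → EulerAlpha.R3)
    (hu₀_cont : Continuous u₀)
    (hu₀_decay : Tendsto u₀ (cocompact EulerAlpha.R3) (𝓝 0))
    (hu₀_div : EulerAlpha.IsWeaklyDivFree u₀)
    (hu₀_axi : EulerAlpha.IsAxisymmetricNoSwirl u₀)
    (hq₀ : EulerAlpha.IsUnfilteredVorticity α u₀ q₀)
    (hq₀_Lp : MemLp (fun x => (EulerAlpha.cylRadius x)⁻¹ • q₀ x) p volume)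
    (hq₀_supp : ∃ R : ℝ, ∀ᵐ x : EulerAlpha.R3, R ≤ ‖x‖ → q₀ x = 0)
    (T : ℝ) (hT : 0 < T) :
    ∃ (u q : ℝ → EulerAlpha.R3 → EulerAlpha.R3) (y : ℝ → EulerAlpha.R3 ≃ₜ EulerAlpha.R3),
      EulerAlpha.IsWeakSolution α T p u₀ q₀ u q ∧
      EulerAlpha.IsLagrangianFlow T u y ∧
      (∀ t ∈ Icc 0 T, ∀ᵐ x,
        EulerAlpha.potVorticity (q t) (y t x) = EulerAlpha.potVorticity q₀ x) ∧
      ∀ s : ℝ≥0∞, 1 ≤ s → ∀ u' q' : ℝ → EulerAlpha.R3 → EulerAlpha.R3,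
        EulerAlpha.IsWeakSolution α T s u₀ q₀ u' q' →
        ∀ t ∈ Icc 0 T, u' t = u t ∧ q' t =ᵐ[volume] q t := by
  obtain ⟨p', R, hζ, hLp, hq, hu⟩ :=
    EulerAlpha.exists_isVortexProfile hα hp hu₀_cont hu₀_decay hu₀_div hu₀_axi hq₀ hq₀_Lp hq₀_supp
  obtain ⟨B, M, Y, hB, hM, hY, hf⟩ := EulerAlpha.exists_lagrangian hζ hα hT
  exact ⟨_, _, Y,
    EulerAlpha.isWeakSolution_of_lagrangian hζ hα hT.le hB hM hY hf hLp hq hu,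
    hf.isLagrangianFlow (hY.isRegularVelocity hζ hα hT.le hB hM) hY.measurePreserving,
    fun t ht => EulerAlpha.ae_potVorticity_transportedVorticity_comp (hY.measurePreserving t ht),
    fun s hs u' q' h => h.eq_of_lagrangian hs hα hT hζ hq hB hM hY hf⟩
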